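/- Let $\mathcal P=C^\infty(\mathbb R/2\pi\mathbb Z;\mathbb R)$, $\partial=d/dx$, let $(\xi,X)=\int_0^{2\pi}(\xi_1X_1+\xi_2X_2)\,dx$ on $\mathcal P^2$, and let gradients of functionals be taken with respect to this form. Put $$K[u,v]=(v-uu_x,\,-uv_x),\qquad \mathcal M=\{(u,v)\in\mathcal P^2:\ u_x^2-2v_x\neq0\ \text{for all }x\},$$ $$\vartheta=\begin{pmatrix}0&-1\\1&0\end{pmatrix},\qquad \eta=\begin{pmatrix}\partial^{-1}&u_x\partial^{-1}\\ \partial^{-1}u_x& v_x\partial^{-1}+\partial^{-1}v_x\end{pmatrix},$$ $$H_\vartheta=\tfrac12\int_0^{2\pi}(v^2+v_xu^2)\,dx,\qquad H_\eta=\tfrac12\int_0^{2\pi}(u_xv-v_xu)\,dx .$$ Here $\eta$ at $(u,v)$ is the multivalued operator $\eta\xi=(a+u_xb,\ v_xb+c)$ with any $a,b,c\in\mathcal P$ such that $a_x=\xi_1$, $b_x=\xi_2$, $c_x=u_x\xi_1+v_x\xi_2$. A family $R$ of (possibly multivalued, not everywhere defined) operators from covectors to vectors, depending on the point of $\mathcal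 M$, is called implectic if its graphs form a smooth Dirac structure: each graph equals its own orthogonal complement for the form $(\xi,X')+(\xi',X)$, each of its elements extends to a smooth section over $\mathcal M$, and every three smooth sections $(\xi_i,X_i)$ satisfy the Jacobi identity $(L_{X_1}\xi_2,X_3)+(L_{X_2}\xi_3,X_1)+(L_{X_3}\xi_1,X_2)=0$, where $L_X\xi=\xi'[X]+(X')^*\xi$. (For an everywhere defined single-valued smooth operator $R$ this says that $\{F,G\}=(\mathrm{grad}\,F,R\,\mathrm{grad}\,G)$ is a Poisson bracket.) Then the following hold. 1. Let $J\subset\mathbb R$ be open and let $u(t,x)$ be smooth on $J\times\mathbb R$ and $2\pi$-periodic in $x$. With $D_t=\partial/\partial t+u\,\partial/\partial x$, the equation $D_t^2u=0$ holds on $J\times\mathbb R$ if and only if there is a smooth $v(t,x)$, $2\pi$-periodic in $x$, with $u_t=v-uu_x$ and $v_t=-uv_x$. 2. $K$ is bi-Hamiltonian on $\mathcal M$: $\vartheta$ and $\eta$ are implectic and compatible (all operators $\eta+s\vartheta$, $s\in\mathbb R$, are implectic), $H_\vartheta$ and $H_\eta$ are smooth functionals with smooth gradients, and $$K=-\vartheta\,\mathrm{grad}\,H_\vartheta=-\eta\,\mathrm{grad}\,H_\eta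 ,$$ where the last equality means that $-K$ is one of the values of $\eta\,\mathrm{grad}\,H_\eta$. 3. $K$ is completely integrable on $\mathcal M$: there are smooth functionals $\gamma_n$ $(n\ge0)$ on $\mathcal M$ with smooth gradients lying in the domain of $\eta$, that are conserved, $(\mathrm{grad}\,\gamma_n,K)=0$, satisfy the recursion $\vartheta\,\mathrm{grad}\,\gamma_n\in\eta\,\mathrm{grad}\,\gamma_{n+1}$, are pairwise in involution for both Poisson brackets defined by $\vartheta$ and $\eta$, and are functionally independent: at some point of $\mathcal M$ all the gradients $\mathrm{grad}\,\gamma_n$, $n\ge0$, are linearly independent. 4. The system has the Lax representation $$f_x=\ell f,\quad f_t=(-u\ell+q(\lambda))f,\qquad \ell=\begin{pmatrix}-\lambda u_x&-v_x\\2\lambda^2&\lambda u_x\end{pmatrix},\quad q(\lambda)=\begin{pmatrix}0&0\\-\lambda&0\end{pmatrix}.$$ That is, let $J\subset\mathbb R$ be an open interval and let $u(t,x),v(t,x)$ be smooth for $t\in J$, $x\in\mathbb R$, and $2\pi$-periodic in $x$. If $u_t=v-uu_x$ and $v_t=-uv_x$ on $J$, then for every $\lambda\in\mathbb C$, $t_0\in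 J$, $x_0\in\mathbb R$, $f_0\in\mathbb C^2$ the linear system has exactly one smooth solution $f:J\times\mathbb R\to\mathbb C^2$ with $f(t_0,x_0)=f_0$. Moreover, whether or not $(u,v)$ solves the system, for every $\lambda\ne0$ the zero curvature equation $\ell_t-p_x+[\ell,p]=0$ with $p=-u\ell+q(\lambda)$ holds on $J\times\mathbb R$ if and only if $(u_t+uu_x-v)_x=0$ and $(v_t+uv_x)_x=0$ there. -/

import Mathlib

open scoped ContDiff

noncomputable section

namespace RiemannHydro

/-! ### The phase space of smooth `2π`-periodic functions -/

/-- The algebra `C^∞(ℝ/2πℤ; ℝ)`, as smooth `2π`-periodic functions on the line. -/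
def Per : Subalgebra ℝ (ℝ → ℝ) where
  carrier := {f | ContDiff ℝ ∞ f ∧ Function.Periodic f (2 * Real.pi)}
  mul_mem' := fun hf hg => ⟨hf.1.mul hg.1, hf.2.mul hg.2⟩
  add_mem' := fun hf hg => ⟨hf.1.add hg.1, hf.2.add hg.2⟩
  algebraMap_mem' := fun _ => ⟨contDiff_const, fun _ => rfl⟩

/-- The derivative `∂ = d/dx` on `C^∞(ℝ/2πℤ; ℝ)`. -/
def dx (f : Per) : Per :=
  ⟨deriv f.1, ((contDiff_infty_iff_deriv (𝕜 := ℝ)).1 f.2.1).2, fun x => by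
    have h : (fun y => f.1 (y + 2 * Real.pi)) = f.1 := funext f.2.2
    have h2 := deriv_comp_add_const f.1 (2 * Real.pi) x
    rw [h] at h2
    exact h2.symm⟩

/-- `C^∞(ℝ/2πℤ; ℝ²)`: points `(u, v)`, and also tangent vectors and (regular) covectors. -/
abbrev Phase : Type := Per × Per

/-- The function `x ↦ (u(x), v(x))` underlying a point of `Phase`. -/
def toFun (p : Phase) (x : ℝ) : ℝ × ℝ := (p.1.1 x, p.2.1 x)

/-- The nonsingular phase space `{(u, v) : u_x² - 2 v_x ≠ 0 for all x}`. -/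
def nonsingular : Set Phase :=
  {p | ∀ x : ℝ, (dx p.1).1 x ^ 2 - 2 * (dx p.2).1 x ≠ 0}

/-- The standard bilinear form `(ξ, X) = ∫_0^{2π} (ξ₁ X₁ + ξ₂ X₂) dx`. -/
def pairing (f g : ℝ → ℝ × ℝ) : ℝ :=
  ∫ x in (0 : ℝ)..(2 * Real.pi), ((f x).1 * (g x).1 + (f x).2 * (g x).2)

/-! ### Differential calculus on the phase space

Smooth curves are those that are jointly smooth in `(t, x)`, and smooth maps are those that send
smooth curves to smooth curves; for maps on open subsets of the Fréchet space
`C^∞(ℝ/2πℤ; ℝ²)` this is the usual notion of smoothness. -/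

/-- `c` is a smooth curve in `C^∞(ℝ/2πℤ; ℝ²)` for times in `O`. -/
def SmoothCurveOn (O : Set ℝ) (c : ℝ → Phase) : Prop :=
  ContDiffOn ℝ ∞ (fun q : ℝ × ℝ => toFun (c q.1) q.2) (O ×ˢ Set.univ)

/-- The velocity `x ↦ (u_t(t, x), v_t(t, x))` of a curve. -/
def velocity (c : ℝ → Phase) (t : ℝ) : ℝ → ℝ × ℝ :=
  fun x => deriv (fun s => toFun (c s) x) t

/-- `Φ` is a smooth map on `U`. -/
def SmoothMapOn (U : Set Phase) (Φ : Phase → Phase) : Prop :=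
  ∀ (O : Set ℝ) (c : ℝ → Phase), IsOpen O → SmoothCurveOn O c → Set.MapsTo c O U →
    SmoothCurveOn O (fun t => Φ (c t))

/-- The derivative `Φ'[Y]` of `Φ` at `p` in the direction `Y`. -/
def dirDeriv (Φ : Phase → Phase) (p Y : Phase) : ℝ → ℝ × ℝ :=
  velocity (fun s => Φ (p + s • Y)) 0

/-- The functional `H` is smooth on `U` with (smooth) gradient `g = grad H` with respect to the
standard bilinear form. -/
def HasGradOn (U : Set Phase) (H : Phase → ℝ) (g : Phase → Phase) : Prop :=
  SmoothMapOn U g ∧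
  ∀ (O : Set ℝ) (c : ℝ → Phase), IsOpen O → SmoothCurveOn O c → Set.MapsTo c O U →
    ∀ t ∈ O, HasDerivAt (fun s => H (c s)) (pairing (toFun (g (c t))) (velocity c t)) t

/-! ### Implectic operators

A possibly nonlocal operator from covectors to vectors is given at each point `p` by its graph,
a set of pairs `(ξ, X)` meaning `X = R(p) ξ`. An operator that contains `∂⁻¹` is neither
everywhere defined nor single valued on periodic functions (`∂⁻¹ f` exists only if `f` has mean
zero, and then up to a constant), so that skew-symmetry and the Jacobi identity take the form
of a Dirac structure. For an everywhere defined single-valued operator this says exactly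
that the operator is skew-symmetric, smooth, and that `{F, G} = (grad F, R grad G)` satisfies the
Jacobi identity. -/

/-- A family of graphs of operators `R(p)`. -/
abbrev OpFamily : Type := Phase → Set (Phase × Phase)

/-- A smooth section over `U`: covector and vector fields `ξ`, `X` with `X(p) = R(p) ξ(p)`. -/
structure IsSection (U : Set Phase) (R : OpFamily) (ξ X : Phase → Phase) : Prop where
  smooth_covector : SmoothMapOn U ξ
  smooth_vector : SmoothMapOn U X
  mem : ∀ p ∈ U, (ξ p, X p) ∈ R p

/-- `(L_X ξ, Y)` at `p`, where `L_X ξ = ξ'[X] + (X')^* ξ` is the Lie derivative of the covector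
field `ξ` along `X`. -/
def lieTerm (X ξ Y : Phase → Phase) (p : Phase) : ℝ :=
  pairing (dirDeriv ξ p (X p)) (toFun (Y p)) + pairing (toFun (ξ p)) (dirDeriv X p (Y p))

/-- `R` is an implectic (Hamiltonian, Poisson) operator over `U`. -/
structure IsImplecticOn (U : Set Phase) (R : OpFamily) : Prop where
  /-- Skew-symmetry, together with maximality of the domain: the graph is its own
  orthogonal complement for the form `(ξ, X') + (ξ', X)`. -/
  skew : ∀ p ∈ U, ∀ e : Phase × Phase, e ∈ R p ↔
    ∀ e' ∈ R p, pairing (toFun e.1) (toFun e'.2) + pairing (toFun e'.1) (toFun e.2) = 0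
  /-- The graphs depend smoothly on the point. -/
  smooth : ∀ p ∈ U, ∀ e ∈ R p, ∃ ξ X : Phase → Phase, IsSection U R ξ X ∧ (ξ p, X p) = e
  /-- The Jacobi identity. -/
  jacobi : ∀ ξ₁ X₁ ξ₂ X₂ ξ₃ X₃ : Phase → Phase,
    IsSection U R ξ₁ X₁ → IsSection U R ξ₂ X₂ → IsSection U R ξ₃ X₃ →
    ∀ p ∈ U, lieTerm X₁ ξ₂ X₃ p + lieTerm X₂ ξ₃ X₁ p + lieTerm X₃ ξ₁ X₂ p = 0

/-- The linear combination `S + s R` of two operators. -/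
def pencil (R S : OpFamily) (s : ℝ) : OpFamily :=
  fun p => {e | ∃ X Y : Phase, (e.1, X) ∈ R p ∧ (e.1, Y) ∈ S p ∧ e.2 = Y + s • X}

/-- Two implectic operators are compatible if all their combinations are implectic. -/
def CompatibleOn (U : Set Phase) (R S : OpFamily) : Prop :=
  ∀ s : ℝ, IsImplecticOn U (pencil R S s)

/-- The vector field `K` is Hamiltonian: `K = - R grad H` on `U`. -/
def IsHamiltonianOn (U : Set Phase) (R : OpFamily) (H : Phase → ℝ) (K : Phase → Phase) : Prop :=
  ∃ g : Phase → Phase, HasGradOn U H g ∧ ∀ p ∈ U, (g p, -K p) ∈ R p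

/-- `K` is a bi-Hamiltonian vector field on `U` for the compatible implectic operators `R`, `S`
and the Hamiltonians `HR`, `HS`. -/
structure IsBiHamiltonianOn (U : Set Phase) (R S : OpFamily) (HR HS : Phase → ℝ)
    (K : Phase → Phase) : Prop where
  implectic_fst : IsImplecticOn U R
  implectic_snd : IsImplecticOn U S
  compatible : CompatibleOn U R S
  hamiltonian_fst : IsHamiltonianOn U R HR K
  hamiltonian_snd : IsHamiltonianOn U S HS K

/-- Complete integrability of a bi-Hamiltonian vector field `K`: an infinite, functionally
independent hierarchy of smooth functionals `γ n` with gradients `g n`, conserved by `K`, linked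
by the recursion `S (grad γ (n+1)) = R (grad γ n)` and in involution for both Poisson brackets. -/
def IsCompletelyIntegrableOn (U : Set Phase) (R S : OpFamily) (K : Phase → Phase) : Prop :=
  ∃ (γ : ℕ → Phase → ℝ) (g : ℕ → Phase → Phase),
    (∀ n, HasGradOn U (γ n) (g n)) ∧
    (∀ n, ∀ p ∈ U, pairing (toFun (g n p)) (toFun (K p)) = 0) ∧
    (∀ n, ∀ p ∈ U, ∃ X, (g n p, X) ∈ R p ∧ (g (n + 1) p, X) ∈ S p) ∧
    (∀ n, ∀ p ∈ U, ∃ X, (g n p, X) ∈ S p) ∧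
    (∀ m n, ∀ p ∈ U, ∀ X, (g n p, X) ∈ R p → pairing (toFun (g m p)) (toFun X) = 0) ∧
    (∀ m n, ∀ p ∈ U, ∀ X, (g n p, X) ∈ S p → pairing (toFun (g m p)) (toFun X) = 0) ∧
    (∃ p ∈ U, LinearIndependent ℝ (fun n => g n p))

/-! ### The Riemann type system for `N = 2` -/

/-- The vector field `K[u, v] = (v - u u_x, - u v_x)`. -/
def riemannField (p : Phase) : Phase :=
  (p.2 - p.1 * dx p.1, -(p.1 * dx p.2))

/-- `c` solves `c_t = K[c]` for times in `J`. -/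
def IsSolutionOn (K : Phase → Phase) (J : Set ℝ) (c : ℝ → Phase) : Prop :=
  SmoothCurveOn J c ∧ ∀ t ∈ J, ∀ x : ℝ, velocity c t x = toFun (K (c t)) x

/-- The material derivative `D_t F = F_t + u F_x`. -/
def materialDeriv (u F : ℝ → ℝ → ℝ) (t x : ℝ) : ℝ :=
  deriv (fun s => F s x) t + u t x * deriv (fun y => F t y) x

/-- The constant operator `ϑ = ((0, -1), (1, 0))`. -/
def thetaOp : OpFamily := fun _ => {e | e.2 = (-e.1.2, e.1.1)}

/-- The nonlocal operator
`η = ((∂⁻¹, u_x ∂⁻¹), (∂⁻¹ u_x, v_x ∂⁻¹ + ∂⁻¹ v_x))`: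
`η ξ = (a + u_x b, v_x b + c)` with `a = ∂⁻¹ ξ₁`, `b = ∂⁻¹ ξ₂`, `c = ∂⁻¹ (u_x ξ₁ + v_x ξ₂)`. -/
def etaOp : OpFamily := fun p =>
  {e | ∃ a b c : Per, dx a = e.1.1 ∧ dx b = e.1.2 ∧
    dx c = dx p.1 * e.1.1 + dx p.2 * e.1.2 ∧
    e.2 = (a + dx p.1 * b, dx p.2 * b + c)}

/-- `H_ϑ = ½ ∫_0^{2π} (v² + v_x u²) dx`. -/
def hamTheta (p : Phase) : ℝ :=
  (1 / 2) * ∫ x in (0 : ℝ)..(2 * Real.pi), (p.2.1 x ^ 2 + (dx p.2).1 x * p.1.1 x ^ 2)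

/-- `H_η = ½ ∫_0^{2π} (u_x v - v_x u) dx`. -/
def hamEta (p : Phase) : ℝ :=
  (1 / 2) * ∫ x in (0 : ℝ)..(2 * Real.pi),
    ((dx p.1).1 x * p.2.1 x - (dx p.2).1 x * p.1.1 x)

/-! ### The Lax pair -/

/-- `ℓ[u, v; z] = ((-z u_x, -v_x), (2 z², z u_x))` at `x`, with spectral parameter `z`. -/
def laxL (z : ℂ) (p : Phase) (x : ℝ) : Matrix (Fin 2) (Fin 2) ℂ :=
  !![-z * ((dx p.1).1 x : ℂ), -((dx p.2).1 x : ℂ); 2 * z ^ 2, z * ((dx p.1).1 x : ℂ)]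

/-- `q(z) = ((0, 0), (-z, 0))`. -/
def laxQ (z : ℂ) : Matrix (Fin 2) (Fin 2) ℂ := !![0, 0; -z, 0]

/-- `p(ℓ) = -u ℓ + q(z)`. -/
def laxP (z : ℂ) (p : Phase) (x : ℝ) : Matrix (Fin 2) (Fin 2) ℂ :=
  -((p.1.1 x : ℂ) • laxL z p x) + laxQ z

/-- `f(t, x)` is a smooth solution of `f_x = ℓ f`, `f_t = p(ℓ) f` for `t ∈ J`, `x ∈ ℝ`. -/
def IsLaxSolution (z : ℂ) (J : Set ℝ) (c : ℝ → Phase) (f : ℝ × ℝ → Fin 2 → ℂ) : Prop :=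
  ContDiffOn ℝ ∞ f (J ×ˢ Set.univ) ∧
  ∀ t ∈ J, ∀ x : ℝ,
    deriv (fun y => f (t, y)) x = (laxL z (c t) x).mulVec (f (t, x)) ∧
    deriv (fun s => f (s, x)) t = (laxP z (c t) x).mulVec (f (t, x))

/-- The two linear equations are compatible: every initial value at every point is attained by
exactly one common solution. -/
def LaxCompatible (z : ℂ) (J : Set ℝ) (c : ℝ → Phase) : Prop :=
  ∀ t₀ ∈ J, ∀ (x₀ : ℝ) (f₀ : Fin 2 → ℂ),
    ∃ f : ℝ × ℝ → Fin 2 → ℂ, (IsLaxSolution z J c f ∧ f (t₀, x₀) = f₀) ∧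
      ∀ f' : ℝ × ℝ → Fin 2 → ℂ, IsLaxSolution z J c f' → f' (t₀, x₀) = f₀ →
        Set.EqOn f' f (J ×ˢ Set.univ)

/-- The zero curvature equation `ℓ_t - p_x + [ℓ, p] = 0`, entry by entry. -/
def ZeroCurvature (z : ℂ) (J : Set ℝ) (c : ℝ → Phase) : Prop :=
  ∀ t ∈ J, ∀ (x : ℝ) (i j : Fin 2),
    deriv (fun s => laxL z (c s) x i j) t - deriv (fun y => laxP z (c t) y i j) x
      + (laxL z (c t) x * laxP z (c t) x - laxP z (c t) x * laxL z (c t) x) i j = 0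

end RiemannHydro

end

open RiemannHydro

/-! Setting v = D_t u turns D_t² u = 0 into D_t u = v, D_t v = 0, which is the first claim.
Smoothness on the phase space is tested along curves, so most of the calculus takes place in the
algebra `Curv O` of jointly smooth curves, with its two commuting derivations `Curv.dt` and
`Curv.dx`; smoothness of a construction is then membership in this algebra.

An element of the graph of η + sϑ is described by three periodic potentials a, b, c with c_x = u_x
a_x + v_x b_x (`PencilElt`). One computation thus serves η (the case s = 0) and the whole pencil. In
these terms the skew-symmetry and Jacobi expressions are integrals of explicit x-derivatives
(`PencilElt.skew`, `pencil_jacobi`). The graph is maximal because the domain is cut out by three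
integral conditions, and the integration constants of a, b, c fill exactly the orthogonal complement
of the domain (`exists_eq_linear_combination`). The nondegeneracy used throughout is ∫ u_x² ≠ 0, a
consequence of nonsingularity.

The hierarchy comes from the resolvent of the Lax operator. Eliminating the first component from f_x
= ℓ f with spectral parameter z gives f₂'' = (z² w + z u_xx) f₂, where w = u_x² - 2 v_x. With λ =
-1/(2z), a suitably normalised product b of two solutions satisfies (w - 2λ u_xx) b² = 1 + λ² (2 b
b'' - b'²), an equation with a formal power series solution b = w^{-1/2} + O(λ). Its x-derivative is
a linear third order equation (`resolvent_linear`), which for a = -u_x b - λ b_x says that λ ϑ(a_x,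
b_x) is a value of η(a_x, b_x); this is the recursion, started in the kernel of η
(`pencilElt_gammaGrad`). Its first variation shows that (a_x, b_x) is the gradient of ∫ 1/b
(`resolvent_variation`, `hasGradOn_gammaFun`). Involution follows by shifting indices with the two
skew-symmetries. Conservation follows since -K is a value of η grad H_η while ϑ grad H_η, the
translation field up to sign, is a value of η at 0. Independence is checked at a point with w = 1,
where the n-th coefficient of a is a trigonometric polynomial of degree exactly n + 1.

For the Lax pair, a solution of the x-equation at time t₀ is transported along the characteristics,
which are explicit parabolas, and multiplied by exp((t - t₀) q) = 1 + (t - t₀) q. Uniqueness is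
uniqueness for linear ordinary differential equations, first in t and then in x. -/

/-! ### Smooth dependence of integrals on parameters -/

theorem continuousOn_parametric_integral {E G : Type} [NormedAddCommGroup E] [NormedAddCommGroup G] [NormedSpace ℝ G]
    {S : Set E} (a b : ℝ) {F : E × ℝ → G} (hF : ContinuousOn F (S ×ˢ Set.univ)) :
    ContinuousOn (fun q => ∫ s in a..b, F (q, s)) S := by
  rw [continuousOn_iff_continuous_domRestrict]
  have h : Continuous (Function.uncurry fun (q : S) (s : ℝ) => F (q.1, s)) := by
    have : Continuous (fun z : S × ℝ => ((z.1.1, z.2) : E × ℝ)) := by fun_prop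
    exact hF.comp_continuous this (fun z => ⟨z.1.2, trivial⟩)
  exact intervalIntegral.continuous_parametric_intervalIntegral_of_continuous' h a b

section ParametricIntegral

variable {E : Type} [NormedAddCommGroup E] [NormedSpace ℝ E] [ProperSpace E]

/-- Closed balls of the parameter space are compact, so the partial derivative is bounded on a small
ball times [a, b]; a constant then dominates and differentiation under the integral is allowed. -/
theorem hasFDerivAt_parametric_integral {G : Type} [NormedAddCommGroup G] [NormedSpace ℝ G]
    {S : Set E} (hS : IsOpen S) (a b : ℝ) {F : E × ℝ → G}
    (hF : ContDiffOn ℝ 1 F (S ×ˢ Set.univ)) {q : E} (hq : q ∈ S) :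
    HasFDerivAt (fun q => ∫ s in a..b, F (q, s))
      (∫ s in a..b, (fderiv ℝ F (q, s)).comp (ContinuousLinearMap.inl ℝ E ℝ)) q := by
  have hO : IsOpen (S ×ˢ (Set.univ : Set ℝ)) := hS.prod isOpen_univ
  obtain ⟨ε, hε, hball⟩ := Metric.nhds_basis_closedBall.mem_iff.1 (hS.mem_nhds hq)
  have hF' : ContinuousOn (fun z => (fderiv ℝ F z).comp (ContinuousLinearMap.inl ℝ E ℝ))
      (S ×ˢ Set.univ) := by
    have := hF.continuousOn_fderiv_of_isOpen hO le_rfl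
    exact this.clm_comp continuousOn_const
  have hK : IsCompact (Metric.closedBall q ε ×ˢ Set.uIcc a b) :=
    (isCompact_closedBall q ε).prod isCompact_uIcc
  obtain ⟨C, hC⟩ := hK.exists_bound_of_continuousOn
    (hF'.mono (Set.prod_mono hball (Set.subset_univ _)))
  have hsl : ∀ x ∈ S, Continuous (fun s : ℝ => F (x, s)) := fun x hx =>
    hF.continuousOn.comp_continuous (by fun_prop) (fun s => ⟨hx, trivial⟩)
  refine intervalIntegral.hasFDerivAt_integral_of_dominated_of_fderiv_le (𝕜 := ℝ)
    (F := fun x s => F (x, s))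
    (F' := fun x s => (fderiv ℝ F (x, s)).comp (ContinuousLinearMap.inl ℝ E ℝ))
    (bound := fun _ => C) (s := Metric.ball q ε) (Metric.ball_mem_nhds q hε) ?_ ?_ ?_ ?_ ?_ ?_
  · filter_upwards [Metric.ball_mem_nhds q hε] with x hx
    exact (hsl x (hball (Metric.ball_subset_closedBall hx))).aestronglyMeasurable
  · exact (hsl q hq).intervalIntegrable a b
  · exact (hF'.comp_continuous (f := fun s : ℝ => (q, s)) (by fun_prop)
      (fun s => ⟨hq, trivial⟩)).aestronglyMeasurable
  · refine Filter.Eventually.of_forall fun s hs x hx => ?_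
    exact hC (x, s) ⟨Metric.ball_subset_closedBall hx, Set.uIoc_subset_uIcc hs⟩
  · exact intervalIntegrable_const
  · refine Filter.Eventually.of_forall fun s hs x hx => ?_
    have hx' : (x, s) ∈ S ×ˢ (Set.univ : Set ℝ) :=
      ⟨hball (Metric.ball_subset_closedBall hx), trivial⟩
    have h1 := ((hF.contDiffAt (hO.mem_nhds hx')).differentiableAt one_ne_zero).hasFDerivAt
    exact h1.comp x (hasFDerivAt_prodMk_left x s)

/-- The target G is quantified inside the induction because the derivative is again a parametric
integral, with values in a space of linear maps. -/
theorem contDiffOn_parametric_integral_nat {S : Set E} (hS : IsOpen S) (a b : ℝ) (n : ℕ) :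
    ∀ {G : Type} [NormedAddCommGroup G] [NormedSpace ℝ G] {F : E × ℝ → G},
      ContDiffOn ℝ n F (S ×ˢ Set.univ) →
      ContDiffOn ℝ n (fun q => ∫ s in a..b, F (q, s)) S := by
  have hO : IsOpen (S ×ˢ (Set.univ : Set ℝ)) := hS.prod isOpen_univ
  induction n with
  | zero =>
    intro G _ _ F hF
    rw [Nat.cast_zero, contDiffOn_zero] at *
    exact continuousOn_parametric_integral a b hF
  | succ n ih =>
    intro G _ _ F hF
    have h1 : ContDiffOn ℝ 1 F (S ×ˢ Set.univ) := hF.of_le (by simp)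
    have hd := fun q hq => hasFDerivAt_parametric_integral hS a b h1 (q := q) hq
    rw [Nat.cast_add, Nat.cast_one, contDiffOn_succ_iff_fderiv_of_isOpen hS]
    refine ⟨fun q hq => (hd q hq).differentiableAt.differentiableWithinAt, by simp, ?_⟩
    have hF' : ContDiffOn ℝ n (fun z => (fderiv ℝ F z).comp (ContinuousLinearMap.inl ℝ E ℝ))
        (S ×ˢ Set.univ) :=
      (hF.fderiv_of_isOpen hO (by simp)).clm_comp contDiffOn_const
    exact (ih hF').congr fun q hq => (hd q hq).fderiv

theorem contDiffOn_parametric_integral {G : Type} [NormedAddCommGroup G] [NormedSpace ℝ G]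
    {S : Set E} (hS : IsOpen S) (a b : ℝ) {F : E × ℝ → G}
    (hF : ContDiffOn ℝ ∞ F (S ×ˢ Set.univ)) :
    ContDiffOn ℝ ∞ (fun q => ∫ s in a..b, F (q, s)) S :=
  contDiffOn_infty.2 fun n =>
    contDiffOn_parametric_integral_nat hS a b n (contDiffOn_infty.1 hF n)

/-- Rescaling the integration variable by the upper limit turns the moving endpoint into a parameter
of an integral over [0, 1]. -/
theorem contDiffOn_parametric_primitive {G : Type} [NormedAddCommGroup G] [NormedSpace ℝ G]
    {S : Set E} (hS : IsOpen S) {F : E × ℝ → G}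
    (hF : ContDiffOn ℝ ∞ F (S ×ˢ Set.univ)) :
    ContDiffOn ℝ ∞ (fun z : E × ℝ => ∫ s in (0 : ℝ)..z.2, F (z.1, s)) (S ×ˢ Set.univ) := by
  have h : ContDiffOn ℝ ∞ (fun z : (E × ℝ) × ℝ => z.1.2 • F (z.1.1, z.1.2 * z.2))
      ((S ×ˢ Set.univ) ×ˢ Set.univ) := by
    refine ContDiffOn.smul (by fun_prop) (hF.comp (by fun_prop) ?_)
    rintro z ⟨hz, -⟩
    exact ⟨hz.1, trivial⟩
  refine (contDiffOn_parametric_integral (hS.prod isOpen_univ) 0 1 h).congr fun z _ => ?_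
  simp only
  rw [intervalIntegral.integral_smul]
  have := intervalIntegral.smul_integral_comp_mul_left (a := 0) (b := 1)
    (fun s => F (z.1, s)) z.2
  rw [this]
  simp

end ParametricIntegral

noncomputable section

namespace RiemannHydro

/-! ### The differential algebra of periodic functions -/

theorem Per.differentiable (f : Per) : Differentiable ℝ f.1 :=
  f.2.1.differentiable (by simp)

theorem Per.continuous (f : Per) : Continuous f.1 := f.2.1.continuous

theorem Per.hasDerivAt (f : Per) (x : ℝ) : HasDerivAt f.1 ((dx f).1 x) x :=
  ((Per.differentiable f) x).hasDerivAt

/-- The derivation `d/dx` of the algebra of periodic functions. -/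
def dxD : Derivation ℝ Per Per :=
  Derivation.mk'
    { toFun := dx
      map_add' := fun f g => Subtype.ext <| funext fun x =>
        (((Per.hasDerivAt f) x).add ((Per.hasDerivAt g) x)).deriv
      map_smul' := fun r f => Subtype.ext <| funext fun x =>
        (((Per.hasDerivAt f) x).const_smul r).deriv }
    fun f g => Subtype.ext <| funext fun x => by
      refine ((((Per.hasDerivAt f) x).mul ((Per.hasDerivAt g) x)).deriv).trans ?_
      change (dx f).1 x * g.1 x + f.1 x * (dx g).1 x = f.1 x * (dx g).1 x + g.1 x * (dx f).1 x
      ring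

theorem dxD_apply (f : Per) : dxD f = dx f := rfl

theorem dx_add (f g : Per) : dx (f + g) = dx f + dx g := dxD.map_add f g
theorem dx_sub (f g : Per) : dx (f - g) = dx f - dx g := dxD.map_sub f g
theorem dx_neg (f : Per) : dx (-f) = -dx f := dxD.map_neg f
theorem dx_zero : dx 0 = 0 := dxD.map_zero
theorem dx_smul (r : ℝ) (f : Per) : dx (r • f) = r • dx f := dxD.map_smul r f
theorem dx_mul (f g : Per) : dx (f * g) = dx f * g + f * dx g := by
  have := dxD.leibniz f g
  simp only [smul_eq_mul, dxD_apply] at this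
  rw [this]; ring
theorem dx_algebraMap (r : ℝ) : dx (algebraMap ℝ Per r) = 0 := dxD.map_algebraMap r

theorem eq_algebraMap_of_dx_eq_zero {f : Per} (h : dx f = 0) : f = algebraMap ℝ Per (f.1 0) := by
  refine Subtype.ext <| funext fun x => ?_
  exact is_const_of_deriv_eq_zero (Per.differentiable f)
    (fun y => congrFun (congrArg Subtype.val h) y) x 0

/-- The integral over a period. -/
def perInt : Per →ₗ[ℝ] ℝ where
  toFun f := ∫ x in (0 : ℝ)..(2 * Real.pi), f.1 x
  map_add' f g := intervalIntegral.integral_add ((Per.continuous f).intervalIntegrable _ _)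
    ((Per.continuous g).intervalIntegrable _ _)
  map_smul' r _ := intervalIntegral.integral_smul r _

theorem perInt_apply (f : Per) : perInt f = ∫ x in (0 : ℝ)..(2 * Real.pi), f.1 x := rfl

theorem perInt_dx (f : Per) : perInt (dx f) = 0 := by
  rw [perInt_apply, intervalIntegral.integral_eq_sub_of_hasDerivAt (fun x _ => (Per.hasDerivAt f) x)
    ((Per.continuous (dx f)).intervalIntegrable _ _)]
  have := f.2.2 0
  simp at this
  simp [this]

/-- This is the form in which every integration by parts below is carried out: the boundary term h
is exhibited and the rest is an identity in the differential algebra. -/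
theorem perInt_eq_of_sub_eq_dx {f g h : Per} (e : f - g = dx h) : perInt f = perInt g := by
  have := perInt_dx h
  rwa [← e, map_sub, sub_eq_zero] at this

theorem perInt_algebraMap_mul (r : ℝ) (f : Per) :
    perInt (algebraMap ℝ Per r * f) = r * perInt f := by
  rw [← Algebra.smul_def, map_smul, smul_eq_mul]

theorem perInt_algebraMap (r : ℝ) : perInt (algebraMap ℝ Per r) = 2 * Real.pi * r := by
  have : perInt (algebraMap ℝ Per r) = ∫ _ in (0 : ℝ)..(2 * Real.pi), r := rfl
  rw [this]; simp

theorem Per.eq_zero_of_nonneg {f : Per} (h0 : ∀ x, 0 ≤ f.1 x) (h : perInt f = 0) : f = 0 := by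
  have hpi := Real.two_pi_pos
  have h1 : ∀ x ∈ Set.Ico (0 : ℝ) (2 * Real.pi), f.1 x = 0 := by
    intro x hx
    by_contra hne
    have hpos : 0 < f.1 x := lt_of_le_of_ne (h0 x) (Ne.symm hne)
    have := intervalIntegral.integral_pos (f := f.1) hpi (Per.continuous f).continuousOn
      (fun y _ => h0 y) ⟨x, Set.Ico_subset_Icc_self hx, hpos⟩
    exact this.ne' h
  refine Subtype.ext <| funext fun x => ?_
  obtain ⟨y, hy, hxy⟩ := f.2.2.exists_mem_Ico₀ hpi x
  rw [hxy, h1 y hy]; rfl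

theorem eq_zero_of_perInt_sq {f g : Per} (h : perInt (f * f + g * g) = 0) : f = 0 ∧ g = 0 := by
  have h1 : f * f + g * g = 0 := Per.eq_zero_of_nonneg
    (fun x => add_nonneg (mul_self_nonneg (f.1 x)) (mul_self_nonneg (g.1 x))) h
  have h2 : ∀ x, f.1 x * f.1 x + g.1 x * g.1 x = 0 := fun x =>
    congrFun (congrArg Subtype.val h1) x
  constructor <;> refine Subtype.ext <| funext fun x => ?_
  · change f.1 x = 0
    nlinarith [h2 x, mul_self_nonneg (f.1 x), mul_self_nonneg (g.1 x)]
  · change g.1 x = 0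
    nlinarith [h2 x, mul_self_nonneg (f.1 x), mul_self_nonneg (g.1 x)]

theorem pairing_toFun (p q : Phase) :
    pairing (toFun p) (toFun q) = perInt (p.1 * q.1 + p.2 * q.2) := rfl

/-- The primitive, vanishing at the origin, of `f` minus its mean. -/
def anti (f : Per) : Per :=
  ⟨fun x => (∫ y in (0 : ℝ)..x, f.1 y) - x * (perInt f / (2 * Real.pi)), by
    have hd : ∀ x, HasDerivAt (fun x => (∫ y in (0 : ℝ)..x, f.1 y) - x * (perInt f / (2 * Real.pi)))
        (f.1 x - perInt f / (2 * Real.pi)) x := fun x => by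
      have h1 := intervalIntegral.integral_hasDerivAt_right
        ((Per.continuous f).intervalIntegrable 0 x)
        ((Per.continuous f).stronglyMeasurableAtFilter _ _) (Per.continuous f).continuousAt
      exact (h1.sub ((hasDerivAt_id x).mul_const (perInt f / (2 * Real.pi)))).congr_deriv (by simp)
    refine contDiff_infty_iff_deriv.2 ⟨fun x => (hd x).differentiableAt, ?_⟩
    rw [funext fun x => (hd x).deriv]
    exact f.2.1.sub contDiff_const, fun x => by
    have h1 : (∫ y in (0 : ℝ)..(x + 2 * Real.pi), f.1 y)
        = (∫ y in (0 : ℝ)..x, f.1 y) + ∫ y in x..(x + 2 * Real.pi), f.1 y :=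
      (intervalIntegral.integral_add_adjacent_intervals ((Per.continuous f).intervalIntegrable _ _)
        ((Per.continuous f).intervalIntegrable _ _)).symm
    have h2 := f.2.2.intervalIntegral_add_eq x 0
    rw [zero_add] at h2
    have h3 : (2 * Real.pi) ≠ 0 := Real.two_pi_pos.ne'
    simp only
    rw [h1, h2, ← perInt_apply]
    field_simp
    ring⟩

theorem dx_anti (f : Per) : dx (anti f) = f - algebraMap ℝ Per (perInt f / (2 * Real.pi)) := by
  refine Subtype.ext <| funext fun x => ?_
  have h1 := intervalIntegral.integral_hasDerivAt_right
    ((Per.continuous f).intervalIntegrable 0 x)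
    ((Per.continuous f).stronglyMeasurableAtFilter _ _) (Per.continuous f).continuousAt
  exact (show HasDerivAt (anti f).1 (f.1 x - perInt f / (2 * Real.pi)) x from
    (h1.sub ((hasDerivAt_id x).mul_const (perInt f / (2 * Real.pi)))).congr_deriv
      (by simp)).deriv

theorem dx_anti_of_perInt_eq_zero {f : Per} (h : perInt f = 0) : dx (anti f) = f := by
  rw [dx_anti, h, zero_div, map_zero, sub_zero]

theorem anti_zero_apply (f : Per) : (anti f).1 0 = 0 := by simp [anti]

/-! ### Smooth curves of periodic functions -/

open TopologicalSpace

/-- The algebra of curves in the periodic functions that are jointly smooth for times in `O`. -/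
def Curv (O : Opens ℝ) : Subalgebra ℝ (ℝ → Per) where
  carrier := {f | ContDiffOn ℝ ∞ (fun q : ℝ × ℝ => (f q.1).1 q.2) ((O : Set ℝ) ×ˢ Set.univ)}
  mul_mem' hf hg := ContDiffOn.mul hf hg
  add_mem' hf hg := ContDiffOn.add hf hg
  algebraMap_mem' _ := contDiffOn_const

variable {O : Opens ℝ}

theorem isOpen_strip (O : Opens ℝ) : IsOpen ((O : Set ℝ) ×ˢ (Set.univ : Set ℝ)) :=
  O.isOpen.prod isOpen_univ

theorem smoothCurveOn_iff (c : ℝ → Phase) : SmoothCurveOn O c ↔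
    (fun t => (c t).1) ∈ Curv O ∧ (fun t => (c t).2) ∈ Curv O :=
  ⟨fun h => ⟨h.fst, h.snd⟩, fun h => ContDiffOn.prodMk h.1 h.2⟩

namespace Curv

theorem hasFDerivAt (f : Curv O) {t : ℝ} (ht : t ∈ O) (x : ℝ) :
    HasFDerivAt (fun q : ℝ × ℝ => (f.1 q.1).1 q.2)
      (fderiv ℝ (fun q : ℝ × ℝ => (f.1 q.1).1 q.2) (t, x)) (t, x) :=
  ((f.2.contDiffAt ((isOpen_strip O).mem_nhds ⟨ht, trivial⟩)).differentiableAt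
    (by simp)).hasFDerivAt

theorem hasDerivAt_fst (f : Curv O) {t : ℝ} (ht : t ∈ O) (x : ℝ) :
    HasDerivAt (fun s => (f.1 s).1 x)
      (fderiv ℝ (fun q : ℝ × ℝ => (f.1 q.1).1 q.2) (t, x) (1, 0)) t := by
  have h := (hasFDerivAt f ht x).comp t (hasFDerivAt_prodMk_left (𝕜 := ℝ) t x)
  exact h.hasDerivAt.congr_deriv (by simp)

theorem hasDerivAt_snd (f : Curv O) {t : ℝ} (ht : t ∈ O) (x : ℝ) :
    HasDerivAt (fun y => (f.1 t).1 y)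
      (fderiv ℝ (fun q : ℝ × ℝ => (f.1 q.1).1 q.2) (t, x) (0, 1)) x := by
  have h := (hasFDerivAt f ht x).comp x (hasFDerivAt_prodMk_right (𝕜 := ℝ) t x)
  exact h.hasDerivAt.congr_deriv (by simp)

theorem contDiffOn_fderiv_apply (f : Curv O) (e : ℝ × ℝ) :
    ContDiffOn ℝ ∞ (fun z => fderiv ℝ (fun q : ℝ × ℝ => (f.1 q.1).1 q.2) z e)
      ((O : Set ℝ) ×ˢ Set.univ) :=
  (f.2.fderiv_of_isOpen (isOpen_strip O) (by simp)).clm_apply contDiffOn_const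

open Classical in
/-- The time derivative of a smooth curve, as a function of time. -/
def dtFun (f : Curv O) (t : ℝ) : Per :=
  if ht : t ∈ O then
    ⟨fun x => deriv (fun s => (f.1 s).1 x) t, by
      have h1 : (fun x => deriv (fun s => (f.1 s).1 x) t) =
          fun x => fderiv ℝ (fun q : ℝ × ℝ => (f.1 q.1).1 q.2) (t, x) (1, 0) :=
        funext fun x => (hasDerivAt_fst f ht x).deriv
      rw [h1]
      have h2 := (contDiffOn_fderiv_apply f (1, 0)).comp
        (contDiff_prodMk_right t).contDiffOn (s := Set.univ) (fun x _ => ⟨ht, trivial⟩)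
      exact contDiffOn_univ.1 h2, fun x => by
      simp only
      exact congrArg (deriv · t) (funext fun s => (f.1 s).2.2 x)⟩
  -- Elements of the algebra are unconstrained at times outside O. The value zero there keeps
  -- additivity and the Leibniz rule true at all times.
  else 0

theorem dtFun_apply (f : Curv O) {t : ℝ} (ht : t ∈ O) (x : ℝ) :
    (dtFun f t).1 x = deriv (fun s => (f.1 s).1 x) t := by
  simp [dtFun, ht]

theorem dtFun_of_notMem (f : Curv O) {t : ℝ} (ht : t ∉ O) : dtFun f t = 0 := by
  simp [dtFun, ht]

theorem hasDerivAt_dtFun (f : Curv O) {t : ℝ} (ht : t ∈ O) (x : ℝ) :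
    HasDerivAt (fun s => (f.1 s).1 x) ((dtFun f t).1 x) t := by
  rw [dtFun_apply f ht]
  exact (hasDerivAt_fst f ht x).differentiableAt.hasDerivAt

theorem dt_mem (f : Curv O) : dtFun f ∈ Curv O :=
  (contDiffOn_fderiv_apply f (1, 0)).congr fun z hz => by
    rw [dtFun_apply f hz.1]
    exact (hasDerivAt_fst f hz.1 z.2).deriv

theorem dtFun_eq_of_hasDerivAt (f : Curv O) {t : ℝ} (ht : t ∈ O) {g : Per}
    (h : ∀ x, HasDerivAt (fun s => (f.1 s).1 x) (g.1 x) t) : dtFun f t = g :=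
  Subtype.ext <| funext fun x => (hasDerivAt_dtFun f ht x).unique (h x)

/-- The time derivative as a linear map. -/
def dtLin : Curv O →ₗ[ℝ] Curv O where
  toFun f := ⟨dtFun f, dt_mem f⟩
  map_add' f g := Subtype.ext <| funext fun t => by
    change dtFun (f + g) t = dtFun f t + dtFun g t
    by_cases ht : t ∈ O
    · exact dtFun_eq_of_hasDerivAt _ ht fun x =>
        (hasDerivAt_dtFun f ht x).add (hasDerivAt_dtFun g ht x)
    · simp [dtFun_of_notMem _ ht]
  map_smul' r f := Subtype.ext <| funext fun t => by
    change dtFun (r • f) t = r • dtFun f t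
    by_cases ht : t ∈ O
    · exact dtFun_eq_of_hasDerivAt _ ht fun x => (hasDerivAt_dtFun f ht x).const_smul r
    · simp [dtFun_of_notMem _ ht]

theorem dtLin_mul (f g : Curv O) : dtLin (f * g) = f • dtLin g + g • dtLin f :=
  Subtype.ext <| funext fun t => by
    change dtFun (f * g) t = f.1 t * dtFun g t + g.1 t * dtFun f t
    by_cases ht : t ∈ O
    · refine dtFun_eq_of_hasDerivAt _ ht fun x => ?_
      refine ((hasDerivAt_dtFun f ht x).mul (hasDerivAt_dtFun g ht x)).congr_deriv ?_
      change (dtFun f t).1 x * (g.1 t).1 x + (f.1 t).1 x * (dtFun g t).1 x =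
        (f.1 t).1 x * (dtFun g t).1 x + (g.1 t).1 x * (dtFun f t).1 x
      ring
    · simp [dtFun_of_notMem _ ht]

/-- The time derivative on the algebra of smooth curves. -/
def dt : Derivation ℝ (Curv O) (Curv O) where
  toLinearMap := dtLin
  map_one_eq_zero' := by
    have h := dtLin_mul (1 : Curv O) 1
    rw [one_mul, one_smul] at h
    exact left_eq_add.1 h
  leibniz' := dtLin_mul

theorem hasDerivAt_dt (f : Curv O) {t : ℝ} (ht : t ∈ O) (x : ℝ) :
    HasDerivAt (fun s => (f.1 s).1 x) (((dt f).1 t).1 x) t :=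
  hasDerivAt_dtFun f ht x

theorem dx_mem (f : Curv O) : (fun t => RiemannHydro.dx (f.1 t)) ∈ Curv O :=
  (contDiffOn_fderiv_apply f (0, 1)).congr fun z hz => (hasDerivAt_snd f hz.1 z.2).deriv

/-- The space derivative as a linear map. -/
def dxLin : Curv O →ₗ[ℝ] Curv O where
  toFun f := ⟨fun t => RiemannHydro.dx (f.1 t), dx_mem f⟩
  map_add' f g := Subtype.ext <| funext fun t => dx_add (f.1 t) (g.1 t)
  map_smul' r f := Subtype.ext <| funext fun t => dx_smul r (f.1 t)

theorem dxLin_mul (f g : Curv O) : dxLin (f * g) = f • dxLin g + g • dxLin f :=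
  Subtype.ext <| funext fun t => dxD.leibniz (f.1 t) (g.1 t)

/-- The space derivative on the algebra of smooth curves. -/
def dx : Derivation ℝ (Curv O) (Curv O) where
  toLinearMap := dxLin
  map_one_eq_zero' := by
    have h := dxLin_mul (1 : Curv O) 1
    rw [one_mul, one_smul] at h
    exact left_eq_add.1 h
  leibniz' := dxLin_mul

theorem dx_apply (f : Curv O) (t : ℝ) : (dx f).1 t = RiemannHydro.dx (f.1 t) := rfl

/-- Both sides are values of the second Fréchet derivative, which is symmetric. -/
theorem dt_dx (f : Curv O) : dt (dx f) = dx (dt f) := by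
  refine Subtype.ext <| funext fun t => ?_
  by_cases ht : t ∈ O
  · refine Subtype.ext <| funext fun x => ?_
    set F : ℝ × ℝ → ℝ := fun q => (f.1 q.1).1 q.2
    have hz : (t, x) ∈ (O : Set ℝ) ×ˢ (Set.univ : Set ℝ) := ⟨ht, trivial⟩
    have hF : ContDiffAt ℝ ∞ F (t, x) := f.2.contDiffAt ((isOpen_strip O).mem_nhds hz)
    have hd : HasFDerivAt (fderiv ℝ F) (fderiv ℝ (fderiv ℝ F) (t, x)) (t, x) :=
      ((hF.fderiv_right (m := 1) (by decide)).differentiableAt one_ne_zero).hasFDerivAt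
    have hsymm : IsSymmSndFDerivAt ℝ F (t, x) := hF.isSymmSndFDerivAt (by simpa using (by decide : (2 : WithTop ℕ∞) ≤ ∞))
    have e1 : ((dt (dx f)).1 t).1 x = fderiv ℝ (fderiv ℝ F) (t, x) (1, 0) (0, 1) := by
      have h1 : HasDerivAt (fun s => fderiv ℝ F (s, x) (0, 1))
          (fderiv ℝ (fderiv ℝ F) (t, x) (1, 0) (0, 1)) t := by
        have := (hd.comp t (hasFDerivAt_prodMk_left (𝕜 := ℝ) t x)).hasDerivAt
        exact (this.clm_apply (hasDerivAt_const t ((0 : ℝ), (1 : ℝ)))).congr_deriv (by simp)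
      refine (hasDerivAt_dt (dx f) ht x).unique (h1.congr_of_eventuallyEq ?_)
      filter_upwards [O.isOpen.mem_nhds ht] with s hs
      exact (hasDerivAt_snd f hs x).deriv
    have e2 : ((dx (dt f)).1 t).1 x = fderiv ℝ (fderiv ℝ F) (t, x) (0, 1) (1, 0) := by
      have h1 : HasDerivAt (fun y => fderiv ℝ F (t, y) (1, 0))
          (fderiv ℝ (fderiv ℝ F) (t, x) (0, 1) (1, 0)) x := by
        have := (hd.comp x (hasFDerivAt_prodMk_right (𝕜 := ℝ) t x)).hasDerivAt
        exact (this.clm_apply (hasDerivAt_const x ((1 : ℝ), (0 : ℝ)))).congr_deriv (by simp)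
      refine (Per.hasDerivAt ((dt f).1 t) x).unique (h1.congr_of_eventuallyEq ?_)
      refine Filter.Eventually.of_forall fun y => ?_
      exact (hasDerivAt_dt f ht y).unique (hasDerivAt_fst f ht y)
    rw [e1, e2, hsymm.eq]
  · change dtFun _ t = RiemannHydro.dx (dtFun f t)
    rw [dtFun_of_notMem _ ht, dtFun_of_notMem _ ht, dx_zero]

/-- Evaluation at a time. -/
def ev (t : ℝ) : Curv O →+* Per := (Pi.evalRingHom (fun _ : ℝ => Per) t).comp (Curv O).subtype

theorem hasDerivAt_perInt (f : Curv O) {t : ℝ} (ht : t ∈ O) :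
    HasDerivAt (fun s => perInt (f.1 s)) (perInt ((dt f).1 t)) t := by
  have h := hasFDerivAt_parametric_integral O.isOpen 0 (2 * Real.pi)
    (f.2.of_le (by simp)) ht
  have h2 := h.hasDerivAt
  have hi : IntervalIntegrable (fun x => (fderiv ℝ (fun q : ℝ × ℝ => (f.1 q.1).1 q.2)
      (t, x)).comp (ContinuousLinearMap.inl ℝ ℝ ℝ)) MeasureTheory.volume 0 (2 * Real.pi) := by
    refine ContinuousOn.intervalIntegrable ?_
    have := (f.2.of_le (m := 1) (by simp)).continuousOn_fderiv_of_isOpen (isOpen_strip O) le_rfl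
    refine ContinuousOn.clm_comp ?_ continuousOn_const
    exact this.comp (by fun_prop) (fun x _ => ⟨ht, trivial⟩)
  rw [ContinuousLinearMap.intervalIntegral_apply hi] at h2
  refine h2.congr_deriv (intervalIntegral.integral_congr fun x _ => ?_)
  simpa using (hasDerivAt_fst f ht x).unique (hasDerivAt_dt f ht x)

theorem perInt_mem (f : Curv O) : (fun t => algebraMap ℝ Per (perInt (f.1 t))) ∈ Curv O := by
  have h := contDiffOn_parametric_integral O.isOpen 0 (2 * Real.pi) f.2
  exact ContDiffOn.comp (t := (O : Set ℝ)) h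
    (contDiffOn_fst (𝕜 := ℝ) (E := ℝ) (F := ℝ) (s := (O : Set ℝ) ×ˢ Set.univ)) (fun z hz => hz.1)

theorem anti_mem (f : Curv O) : (fun t => anti (f.1 t)) ∈ Curv O := by
  have h := contDiffOn_parametric_primitive O.isOpen f.2
  have h2 : ContDiffOn ℝ ∞ (fun q : ℝ × ℝ => perInt (f.1 q.1)) ((O : Set ℝ) ×ˢ Set.univ) :=
    perInt_mem f
  exact h.sub (contDiffOn_snd.mul (h2.div_const _))

theorem inv_mem {f : ℝ → Per} (hf : f ∈ Curv O) {g : ℝ → Per}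
    (h0 : ∀ t ∈ O, ∀ x, (f t).1 x ≠ 0) (hg : ∀ t ∈ O, ∀ x, (g t).1 x = ((f t).1 x)⁻¹) :
    g ∈ Curv O :=
  (ContDiffOn.inv hf fun z hz => h0 z.1 hz.1 z.2).congr fun z hz => hg z.1 hz.1 z.2

end Curv

end RiemannHydro
end

noncomputable section

namespace RiemannHydro

open TopologicalSpace

variable {O : Opens ℝ}

/-! ### Calculus along smooth curves -/

namespace Curv

theorem mem_congr {f g : ℝ → Per} (hf : f ∈ Curv O) (h : ∀ t ∈ O, g t = f t) : g ∈ Curv O :=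
  ContDiffOn.congr (f := fun q : ℝ × ℝ => (f q.1).1 q.2) hf fun z hz => by rw [h z.1 hz.1]

theorem dt_congr {f g : Curv O} (h : ∀ t ∈ O, f.1 t = g.1 t) {t : ℝ} (ht : t ∈ O) :
    (dt f).1 t = (dt g).1 t := by
  refine dtFun_eq_of_hasDerivAt f ht fun x => (hasDerivAt_dt g ht x).congr_of_eventuallyEq ?_
  filter_upwards [O.isOpen.mem_nhds ht] with s hs
  rw [h s hs]

theorem dt_eq_of_hasDerivAt (f : Curv O) {t : ℝ} (ht : t ∈ O) {g : Per}
    (h : ∀ x, HasDerivAt (fun s => (f.1 s).1 x) (g.1 x) t) : (dt f).1 t = g :=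
  dtFun_eq_of_hasDerivAt f ht h

theorem dt_add_apply (f g : Curv O) (t : ℝ) : (dt (f + g)).1 t = (dt f).1 t + (dt g).1 t := by
  rw [dt.map_add]; rfl

theorem dt_sub_apply (f g : Curv O) (t : ℝ) : (dt (f - g)).1 t = (dt f).1 t - (dt g).1 t := by
  exact congrFun (congrArg Subtype.val (map_sub dtLin f g)) t

theorem dt_neg_apply (f : Curv O) (t : ℝ) : (dt (-f)).1 t = -(dt f).1 t := by
  exact congrFun (congrArg Subtype.val (map_neg dtLin f)) t

theorem dt_smul_apply (r : ℝ) (f : Curv O) (t : ℝ) : (dt (r • f)).1 t = r • (dt f).1 t := by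
  rw [dt.map_smul]; rfl

theorem dt_mul_apply (f g : Curv O) (t : ℝ) :
    (dt (f * g)).1 t = (dt f).1 t * g.1 t + f.1 t * (dt g).1 t := by
  rw [dt.leibniz, add_comm, mul_comm ((dt f).1 t)]; rfl

theorem dt_dx_apply (f : Curv O) (t : ℝ) :
    (dt (dx f)).1 t = RiemannHydro.dx ((dt f).1 t) := by
  rw [dt_dx]; rfl

/-- The first component of a smooth curve. -/
def fst {c : ℝ → Phase} (h : SmoothCurveOn O c) : Curv O :=
  ⟨fun t => (c t).1, ((smoothCurveOn_iff c).1 h).1⟩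

/-- The second component of a smooth curve. -/
def snd {c : ℝ → Phase} (h : SmoothCurveOn O c) : Curv O :=
  ⟨fun t => (c t).2, ((smoothCurveOn_iff c).1 h).2⟩

theorem fst_apply {c : ℝ → Phase} (h : SmoothCurveOn O c) (t : ℝ) : (fst h).1 t = (c t).1 := rfl

theorem snd_apply {c : ℝ → Phase} (h : SmoothCurveOn O c) (t : ℝ) : (snd h).1 t = (c t).2 := rfl

theorem velocity_eq {c : ℝ → Phase} (h : SmoothCurveOn O c) {t : ℝ} (ht : t ∈ O) :
    velocity c t = toFun ((dt (fst h)).1 t, (dt (snd h)).1 t) :=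
  funext fun x => ((hasDerivAt_dt (fst h) ht x).prodMk (hasDerivAt_dt (snd h) ht x)).deriv

theorem _root_.RiemannHydro.smoothCurveOn_mk (f g : Curv O) :
    SmoothCurveOn O (fun t => (f.1 t, g.1 t)) :=
  (smoothCurveOn_iff _).2 ⟨f.2, g.2⟩

theorem _root_.RiemannHydro.SmoothCurveOn.congr {c d : ℝ → Phase} (h : SmoothCurveOn O c)
    (e : ∀ t ∈ O, d t = c t) : SmoothCurveOn O d :=
  (smoothCurveOn_iff _).2 ⟨mem_congr (fst h).2 fun t ht => congrArg Prod.fst (e t ht),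
    mem_congr (snd h).2 fun t ht => congrArg Prod.snd (e t ht)⟩

theorem const_mem (f : Per) : (fun _ => f) ∈ Curv O :=
  (f.2.1.comp contDiff_snd).contDiffOn

theorem line_mem (f g : Per) : (fun s : ℝ => f + s • g) ∈ Curv O :=
  ((f.2.1.comp contDiff_snd).add (contDiff_fst.mul (g.2.1.comp contDiff_snd))).contDiffOn

theorem smoothCurveOn_line (p Y : Phase) : SmoothCurveOn O (fun s => p + s • Y) :=
  (smoothCurveOn_iff _).2 ⟨line_mem p.1 Y.1, line_mem p.2 Y.2⟩

theorem hasDerivAt_line (f g : Per) (t x : ℝ) :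
    HasDerivAt (fun s : ℝ => (f + s • g).1 x) (g.1 x) t := by
  exact (((hasDerivAt_id t).mul_const (g.1 x)).const_add (f.1 x)).congr_deriv (by simp)

end Curv

theorem SmoothMapOn.comp {U : Set Phase} {Φ : Phase → Phase} (h : SmoothMapOn U Φ)
    {c : ℝ → Phase} (hc : SmoothCurveOn O c) (hU : ∀ t ∈ O, c t ∈ U) :
    SmoothCurveOn O (fun t => Φ (c t)) := h O c O.isOpen hc hU

theorem smoothMapOn_of_opens {U : Set Phase} {Φ : Phase → Phase}
    (h : ∀ (O : Opens ℝ) (c : ℝ → Phase), SmoothCurveOn O c → (∀ t ∈ O, c t ∈ U) →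
      SmoothCurveOn O (fun t => Φ (c t))) : SmoothMapOn U Φ :=
  fun O c hO hc hU => h ⟨O, hO⟩ c hc hU

theorem smoothMapOn_const (U : Set Phase) (q : Phase) : SmoothMapOn U (fun _ => q) :=
  smoothMapOn_of_opens fun _ _ _ _ =>
    (smoothCurveOn_iff _).2 ⟨Curv.const_mem q.1, Curv.const_mem q.2⟩

/-- A functional given by an integral of a density along curves has gradient `g` if the time
derivative of the density is `(g, ċ)` up to a total derivative. -/
theorem hasGradOn_of_density {U : Set Phase} {H : Phase → ℝ} {g : Phase → Phase}
    (hg : SmoothMapOn U g)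
    (h : ∀ (O : Opens ℝ) (c : ℝ → Phase) (hc : SmoothCurveOn O c), (∀ t, c t ∈ U) →
      ∃ G : Curv O, (∀ t ∈ O, H (c t) = perInt (G.1 t)) ∧ ∀ t ∈ O,
        perInt ((Curv.dt G).1 t) = perInt ((g (c t)).1 * (Curv.dt (Curv.fst hc)).1 t +
          (g (c t)).2 * (Curv.dt (Curv.snd hc)).1 t)) :
    HasGradOn U H g := by
  classical
  refine ⟨hg, fun O c hO hc hU t ht => ?_⟩
  -- Outside O the curve is replaced by one of its own points, so that it stays in U at all times.
  -- Identities in the algebra of curves, such as invertibility of a density, then hold also at the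
  -- irrelevant times.
  set d : ℝ → Phase := fun s => if s ∈ O then c s else c t with hd
  have hdc : ∀ s ∈ O, d s = c s := fun s hs => if_pos hs
  have hds : SmoothCurveOn O d := SmoothCurveOn.congr (O := ⟨O, hO⟩) hc hdc
  have hev : ∀ᶠ s in nhds t, c s = d s := by
    filter_upwards [hO.mem_nhds ht] with s hs
    exact (hdc s hs).symm
  obtain ⟨G, hG, hGd⟩ := h ⟨O, hO⟩ d hds fun s => by
    by_cases hs : s ∈ O
    · rw [hdc s hs]; exact hU hs
    · rw [hd]; simp only [if_neg hs]; exact hU ht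
  have hv : velocity c t = velocity d t := funext fun x =>
    Filter.EventuallyEq.deriv_eq (hev.mono fun s hs => by simp only [hs])
  rw [hv, Curv.velocity_eq (O := ⟨O, hO⟩) hds ht, pairing_toFun, ← hdc t ht, ← hGd t ht]
  refine (Curv.hasDerivAt_perInt G (t := t) ht).congr_of_eventuallyEq ?_
  filter_upwards [hO.mem_nhds ht] with s hs
  rw [← hdc s hs]
  exact hG s hs

/-! ### The nonsingular phase space -/

theorem exists_dx_eq_zero (f : Per) : ∃ x, (dx f).1 x = 0 := by
  obtain ⟨x, -, hx⟩ := exists_deriv_eq_zero (f := f.1) Real.two_pi_pos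
    (Per.continuous f).continuousOn (by have := f.2.2 0; rw [zero_add] at this; exact this.symm)
  exact ⟨x, hx⟩

/-- By Rolle v_x vanishes somewhere, and there the discriminant is the nonzero square u_x². A
continuous function without zeros keeps its sign. -/
theorem discriminant_pos {p : Phase} (hp : p ∈ nonsingular) (x : ℝ) :
    0 < (dx p.1).1 x ^ 2 - 2 * (dx p.2).1 x := by
  obtain ⟨y, hy⟩ := exists_dx_eq_zero p.2
  have hy' : 0 < (dx p.1).1 y ^ 2 - 2 * (dx p.2).1 y := by
    have := hp y
    rw [hy, mul_zero, sub_zero] at this ⊢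
    positivity
  by_contra hx
  have hc : Continuous fun x => (dx p.1).1 x ^ 2 - 2 * (dx p.2).1 x :=
    ((Per.continuous _).pow 2).sub (continuous_const.mul (Per.continuous _))
  obtain ⟨z, hz⟩ := mem_range_of_exists_le_of_exists_ge hc ⟨x, not_lt.1 hx⟩ ⟨y, hy'.le⟩
  exact hp z hz

/-- If u were constant, the discriminant would vanish at a zero of v_x. -/
theorem perInt_dx_sq_ne_zero {p : Phase} (hp : p ∈ nonsingular) :
    perInt (dx p.1 * dx p.1) ≠ 0 := by
  intro h
  have h0 : dx p.1 = 0 := (eq_zero_of_perInt_sq (g := 0) (by simpa using h)).1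
  obtain ⟨y, hy⟩ := exists_dx_eq_zero p.2
  refine hp y ?_
  rw [h0, hy]
  simp [show (0 : Per).1 y = 0 from rfl]

/-- Nonvanishing on one period is an open condition by compactness, and periodicity extends it to
the line. This gives an open time interval on which directional derivatives can be computed in `Curv
O`. -/
theorem exists_line_mem_nonsingular {p : Phase} (hp : p ∈ nonsingular) (Y : Phase) :
    ∃ O : Opens ℝ, 0 ∈ O ∧ ∀ s ∈ O, p + s • Y ∈ nonsingular := by
  set w : ℝ → ℝ → ℝ := fun s x =>
    ((dx p.1).1 x + s * (dx Y.1).1 x) ^ 2 - 2 * ((dx p.2).1 x + s * (dx Y.2).1 x)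
  have hw : ∀ s x, (dx (p + s • Y).1).1 x ^ 2 - 2 * (dx (p + s • Y).2).1 x = w s x := by
    intro s x
    have h1 : dx (p + s • Y).1 = dx p.1 + s • dx Y.1 := by
      rw [Prod.fst_add, Prod.smul_fst, dx_add, dx_smul]
    have h2 : dx (p + s • Y).2 = dx p.2 + s • dx Y.2 := by
      rw [Prod.snd_add, Prod.smul_snd, dx_add, dx_smul]
    rw [h1, h2]; rfl
  have hcont : Continuous (Function.uncurry w) := by
    have h1 := Per.continuous (dx p.1)
    have h2 := Per.continuous (dx p.2)
    have h3 := Per.continuous (dx Y.1)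
    have h4 := Per.continuous (dx Y.2)
    unfold w Function.uncurry
    fun_prop
  have hev : ∀ᶠ s in nhds (0 : ℝ), ∀ x ∈ Set.Icc (0 : ℝ) (2 * Real.pi), w s x ≠ 0 := by
    refine isCompact_Icc.eventually_forall_of_forall_eventually fun x _ => ?_
    refine hcont.continuousAt.eventually_ne ?_
    have := hp x
    simpa [w] using this
  obtain ⟨V, hV, hVo, h0⟩ := eventually_nhds_iff.1 hev
  refine ⟨⟨V, hVo⟩, h0, fun s hs x => ?_⟩
  have hper : Function.Periodic
      (fun x => (dx (p + s • Y).1).1 x ^ 2 - 2 * (dx (p + s • Y).2).1 x) (2 * Real.pi) := fun x => by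
    simp only [(dx (p + s • Y).1).2.2 x, (dx (p + s • Y).2).2.2 x]
  obtain ⟨y, hy, hxy⟩ := hper.exists_mem_Ico₀ Real.two_pi_pos x
  rw [hxy, hw]
  exact hV s hs y (Set.Ico_subset_Icc_self hy)

theorem dirDeriv_eq {p Y : Phase} {Φ : Phase → Phase} (h0 : (0 : ℝ) ∈ O)
    (h : SmoothCurveOn O (fun s => Φ (p + s • Y))) :
    dirDeriv Φ p Y = toFun ((Curv.dt (Curv.fst h)).1 0, (Curv.dt (Curv.snd h)).1 0) :=
  Curv.velocity_eq h h0

/-! ### The constant operator -/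

theorem isImplecticOn_thetaOp : IsImplecticOn nonsingular thetaOp where
  skew p _ e := by
    constructor
    · rintro he e' he'
      rw [pairing_toFun, pairing_toFun, show e.2 = _ from he, show e'.2 = _ from he', ← map_add]
      rw [← map_zero perInt]
      congr 1
      ring
    · intro h
      -- The test covector is the defect e.2 - ϑ e.1 itself, so the orthogonality relation becomes
      -- the vanishing of its L² norm.
      have h1 := h ((e.2.1 + e.1.2, e.2.2 - e.1.1), (-(e.2.2 - e.1.1), e.2.1 + e.1.2)) rfl
      rw [pairing_toFun, pairing_toFun, ← map_add] at h1
      have h2 := eq_zero_of_perInt_sq (f := e.2.1 + e.1.2) (g := e.2.2 - e.1.1)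
        (by rw [← h1]; congr 1; ring)
      exact Prod.ext (eq_neg_of_add_eq_zero_left h2.1) (sub_eq_zero.1 h2.2)
  smooth p _ e he := ⟨fun _ => e.1, fun _ => e.2,
    ⟨smoothMapOn_const _ _, smoothMapOn_const _ _, fun _ _ => he⟩, rfl⟩
  jacobi ξ₁ X₁ ξ₂ X₂ ξ₃ X₃ h₁ h₂ h₃ p hp := by
    -- Since ϑ has constant coefficients, the derivative of a section again has the form (ζ, ϑ ζ).
    have key : ∀ ξ X : Phase → Phase, IsSection nonsingular thetaOp ξ X → ∀ Y : Phase,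
        ∃ f g : Per, dirDeriv ξ p Y = toFun (f, g) ∧ dirDeriv X p Y = toFun (-g, f) := by
      intro ξ X h Y
      obtain ⟨O, h0, hO⟩ := exists_line_mem_nonsingular hp Y
      have hξ := h.smooth_covector.comp (Curv.smoothCurveOn_line p Y) hO
      have hX := h.smooth_vector.comp (Curv.smoothCurveOn_line p Y) hO
      refine ⟨_, _, dirDeriv_eq h0 hξ, (dirDeriv_eq h0 hX).trans ?_⟩
      have e1 : (Curv.dt (Curv.fst hX)).1 0 = (Curv.dt (-Curv.snd hξ)).1 0 :=
        Curv.dt_congr (fun t ht => congrArg Prod.fst (h.mem _ (hO t ht))) h0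
      have e2 : (Curv.dt (Curv.snd hX)).1 0 = (Curv.dt (Curv.fst hξ)).1 0 :=
        Curv.dt_congr (fun t ht => congrArg Prod.snd (h.mem _ (hO t ht))) h0
      rw [e1, e2, Curv.dt_neg_apply]
    obtain ⟨f₁, g₁, hξ₁, hX₁⟩ := key ξ₁ X₁ h₁ (X₃ p)
    obtain ⟨f₂, g₂, hξ₂, hX₂⟩ := key ξ₂ X₂ h₂ (X₁ p)
    obtain ⟨f₃, g₃, hξ₃, hX₃⟩ := key ξ₃ X₃ h₃ (X₂ p)
    simp only [lieTerm, hξ₁, hξ₂, hξ₃, hX₁, hX₂, hX₃, pairing_toFun, ← map_add]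
    rw [show X₁ p = _ from h₁.mem p hp, show X₂ p = _ from h₂.mem p hp,
      show X₃ p = _ from h₃.mem p hp, ← map_zero perInt]
    congr 1
    ring

end RiemannHydro
end

noncomputable section

namespace RiemannHydro

open TopologicalSpace

variable {O : Opens ℝ}

/-! ### The pencil `η + s ϑ` -/

/-- `(ξ, X)` with `ξ = (a', b')`, `X = (a + u_x b - s b', v_x b + c + s a')` and
`c' = u_x a' + v_x b'`. -/
structure PencilElt (s : ℝ) (p : Phase) (e : Phase × Phase) (a b c : Per) : Prop where
  covector : e.1 = (dx a, dx b)
  constraint : dx c = dx p.1 * dx a + dx p.2 * dx b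
  vector : e.2 = (a + dx p.1 * b - s • dx b, dx p.2 * b + c + s • dx a)

theorem mem_pencil_iff {s : ℝ} {p : Phase} {e : Phase × Phase} :
    e ∈ pencil thetaOp etaOp s p ↔ ∃ a b c, PencilElt s p e a b c := by
  constructor
  · rintro ⟨X, Y, hX, ⟨a, b, c, ha, hb, hc, hY⟩, he⟩
    simp only at ha hb hc hY
    rw [← ha, ← hb] at hc
    refine ⟨a, b, c, Prod.ext ha.symm hb.symm, hc, ?_⟩
    rw [he, show X = _ from hX, hY, ha, hb]
    ext1
    · simp [sub_eq_add_neg]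
    · simp
  · rintro ⟨a, b, c, h1, h2, h3⟩
    refine ⟨(-dx b, dx a), (a + dx p.1 * b, dx p.2 * b + c), ?_, ⟨a, b, c, ?_⟩, ?_⟩
    · rw [h1]; rfl
    · simp only [h1, h2, and_self]
    · rw [h3]
      ext1
      · simp [sub_eq_add_neg]
      · simp

theorem mem_etaOp_iff {p : Phase} {e : Phase × Phase} :
    e ∈ etaOp p ↔ ∃ a b c, PencilElt 0 p e a b c := by
  rw [← mem_pencil_iff]
  constructor
  · intro h
    exact ⟨(-e.1.2, e.1.1), e.2, rfl, h, by simp⟩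
  · rintro ⟨X, Y, -, hY, he⟩
    rw [zero_smul, add_zero] at he
    rw [← he] at hY
    exact hY

theorem etaOp_eq_pencil : etaOp = pencil thetaOp etaOp 0 :=
  funext fun _ => Set.ext fun _ => mem_etaOp_iff.trans mem_pencil_iff.symm

/-- The integrand is the x-derivative of aa' + bc' + b'c; the terms in s cancel pointwise. -/
theorem PencilElt.skew {s : ℝ} {p : Phase} {e e' : Phase × Phase} {a b c a' b' c' : Per}
    (h : PencilElt s p e a b c) (h' : PencilElt s p e' a' b' c') :
    pairing (toFun e.1) (toFun e'.2) + pairing (toFun e'.1) (toFun e.2) = 0 := by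
  rw [pairing_toFun, pairing_toFun, h.covector, h'.covector, h.vector, h'.vector, ← map_add,
    ← perInt_dx (a * a' + b * c' + b' * c)]
  congr 1
  simp only [dx_add, dx_mul, h.constraint, h'.constraint, Algebra.smul_def]
  ring

/-- These are the values at the zero covector, produced by the integration constants. Pairing with
them detects the domain of the operator. -/
theorem pencilElt_const (s : ℝ) (p : Phase) (α β κ : ℝ) :
    PencilElt s p (0, (algebraMap ℝ Per α + dx p.1 * algebraMap ℝ Per β,
      dx p.2 * algebraMap ℝ Per β + algebraMap ℝ Per κ))
      (algebraMap ℝ Per α) (algebraMap ℝ Per β) (algebraMap ℝ Per κ) := by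
  constructor
  · rw [dx_algebraMap, dx_algebraMap]; rfl
  · simp [dx_algebraMap]
  · simp [dx_algebraMap]

theorem exists_pencilElt (s : ℝ) (p : Phase) {ξ : Phase} (h1 : perInt ξ.1 = 0)
    (h2 : perInt ξ.2 = 0) (h3 : perInt (dx p.1 * ξ.1 + dx p.2 * ξ.2) = 0) :
    ∃ X a b c, PencilElt s p (ξ, X) a b c :=
  ⟨_, anti ξ.1, anti ξ.2, anti (dx p.1 * ξ.1 + dx p.2 * ξ.2),
    by rw [dx_anti_of_perInt_eq_zero h1, dx_anti_of_perInt_eq_zero h2],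
    by rw [dx_anti_of_perInt_eq_zero h1, dx_anti_of_perInt_eq_zero h2,
      dx_anti_of_perInt_eq_zero h3], rfl⟩

/-- A vector orthogonal to all covectors orthogonal to `(1, 0)`, `(0, 1)` and `(u_x, v_x)` is a
linear combination of these three. -/
theorem exists_eq_linear_combination {p : Phase} (hp : p ∈ nonsingular) (Y : Phase)
    (h : ∀ ξ : Phase, perInt ξ.1 = 0 → perInt ξ.2 = 0 →
      perInt (dx p.1 * ξ.1 + dx p.2 * ξ.2) = 0 → perInt (ξ.1 * Y.1 + ξ.2 * Y.2) = 0) :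
    ∃ α β κ : ℝ, Y = (algebraMap ℝ Per α + dx p.1 * algebraMap ℝ Per β,
      dx p.2 * algebraMap ℝ Per β + algebraMap ℝ Per κ) := by
  have hpi := Real.two_pi_pos.ne'
  set n : ℝ := perInt (dx p.1 * dx p.1 + dx p.2 * dx p.2)
  have hn : n ≠ 0 := fun h0 => perInt_dx_sq_ne_zero hp (by
    rw [(eq_zero_of_perInt_sq h0).1]; simp)
  -- α, κ, β are the coefficients of the orthogonal projection of Y; the three vectors are mutually
  -- orthogonal because u_x and v_x have mean zero.
  set α : ℝ := perInt Y.1 / (2 * Real.pi)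
  set κ : ℝ := perInt Y.2 / (2 * Real.pi)
  set β : ℝ := perInt (dx p.1 * Y.1 + dx p.2 * Y.2) / n
  set f : Per := Y.1 - algebraMap ℝ Per α - algebraMap ℝ Per β * dx p.1 with hf
  set g : Per := Y.2 - algebraMap ℝ Per κ - algebraMap ℝ Per β * dx p.2 with hg
  have e1 : perInt f = 0 := by
    rw [hf, map_sub, map_sub, perInt_algebraMap, perInt_algebraMap_mul, perInt_dx]
    simp only [α]; field_simp; ring
  have e2 : perInt g = 0 := by
    rw [hg, map_sub, map_sub, perInt_algebraMap, perInt_algebraMap_mul, perInt_dx]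
    simp only [κ]; field_simp; ring
  have e3 : perInt (dx p.1 * f + dx p.2 * g) = 0 := by
    have : dx p.1 * f + dx p.2 * g = (dx p.1 * Y.1 + dx p.2 * Y.2) -
        (algebraMap ℝ Per α * dx p.1 + algebraMap ℝ Per κ * dx p.2) -
        algebraMap ℝ Per β * (dx p.1 * dx p.1 + dx p.2 * dx p.2) := by rw [hf, hg]; ring
    rw [this, map_sub, map_sub, map_add perInt (algebraMap ℝ Per α * _), perInt_algebraMap_mul, perInt_algebraMap_mul,
      perInt_algebraMap_mul, perInt_dx, perInt_dx]
    change _ - _ - β * n = 0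
    simp only [β]; field_simp; ring
  -- The remainder (f, g) satisfies the three conditions on ξ, so it may be used as its own test
  -- covector.
  have e4 : perInt (f * f + g * g) = 0 := by
    have : f * f + g * g = (f * Y.1 + g * Y.2) - algebraMap ℝ Per α * f -
        algebraMap ℝ Per κ * g - algebraMap ℝ Per β * (dx p.1 * f + dx p.2 * g) := by
      conv_lhs => rw [show f * f = f * (Y.1 - algebraMap ℝ Per α - algebraMap ℝ Per β * dx p.1)
        from rfl, show g * g = g * (Y.2 - algebraMap ℝ Per κ - algebraMap ℝ Per β * dx p.2)
        from rfl]
      ring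
    have h5 := h (f, g) e1 e2 e3
    simp only at h5
    rw [this, map_sub, map_sub, map_sub, perInt_algebraMap_mul, perInt_algebraMap_mul,
      perInt_algebraMap_mul, e1, e2, e3, h5]
    simp
  obtain ⟨hf0, hg0⟩ := eq_zero_of_perInt_sq e4
  refine ⟨α, β, κ, Prod.ext ?_ ?_⟩
  · rw [hf] at hf0; linear_combination hf0
  · rw [hg] at hg0; linear_combination hg0

/-- For maximality, testing against the elements over the zero covector puts ξ in the domain. Then
e.2 differs from one value X at ξ by a vector orthogonal to the domain, and such a vector is
absorbed by changing the three integration constants. -/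
theorem pencil_skew (s : ℝ) {p : Phase} (hp : p ∈ nonsingular) (e : Phase × Phase) :
    e ∈ pencil thetaOp etaOp s p ↔ ∀ e' ∈ pencil thetaOp etaOp s p,
      pairing (toFun e.1) (toFun e'.2) + pairing (toFun e'.1) (toFun e.2) = 0 := by
  constructor
  · intro he e' he'
    obtain ⟨a, b, c, h⟩ := mem_pencil_iff.1 he
    obtain ⟨a', b', c', h'⟩ := mem_pencil_iff.1 he'
    exact h.skew h'
  · intro h
    have hc : ∀ α β κ : ℝ, α * perInt e.1.1 + κ * perInt e.1.2 +
        β * perInt (dx p.1 * e.1.1 + dx p.2 * e.1.2) = 0 := by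
      intro α β κ
      have := h _ (mem_pencil_iff.2 ⟨_, _, _, pencilElt_const s p α β κ⟩)
      rw [pairing_toFun, pairing_toFun, ← map_add] at this
      rw [← this, ← perInt_algebraMap_mul, ← perInt_algebraMap_mul, ← perInt_algebraMap_mul,
        ← map_add, ← map_add]
      congr 1
      simp only [Prod.fst_zero, Prod.snd_zero]
      ring
    obtain ⟨X, a, b, c, hX⟩ := exists_pencilElt s p (ξ := e.1) (by simpa using hc 1 0 0)
      (by simpa using hc 0 0 1) (by simpa using hc 0 1 0)
    obtain ⟨α, β, κ, hY⟩ := exists_eq_linear_combination hp (e.2 - X) (by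
      intro ξ h1 h2 h3
      obtain ⟨X', a', b', c', hX'⟩ := exists_pencilElt s p h1 h2 h3
      have h4 := h _ (mem_pencil_iff.2 ⟨_, _, _, hX'⟩)
      have h5 := hX.skew hX'
      simp only [pairing_toFun] at h4 h5
      rw [← sub_eq_zero.2 (h4.trans h5.symm), add_sub_add_left_eq_sub, ← map_sub]
      congr 1
      simp only [Prod.fst_sub, Prod.snd_sub]
      ring)
    refine mem_pencil_iff.2 ⟨a + algebraMap ℝ Per α, b + algebraMap ℝ Per β,
      c + algebraMap ℝ Per κ, ?_, ?_, ?_⟩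
    · rw [dx_add, dx_add, dx_algebraMap, dx_algebraMap, add_zero, add_zero]; exact hX.covector
    · simp only [dx_add, dx_algebraMap, add_zero]; exact hX.constraint
    · rw [← sub_add_cancel e.2 X, hY, show X = _ from hX.vector]
      simp only [dx_add, dx_algebraMap, add_zero]
      ext1
      · simp only [Prod.fst_add]; ring
      · simp only [Prod.snd_add]; ring

/-- The section of `η + s ϑ` through a given element. -/
theorem exists_pencil_section (s : ℝ) {p : Phase} {e : Phase × Phase}
    (he : e ∈ pencil thetaOp etaOp s p) :
    ∃ ξ X : Phase → Phase, IsSection nonsingular (pencil thetaOp etaOp s) ξ X ∧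
      (ξ p, X p) = e := by
  obtain ⟨a, b, c, h⟩ := mem_pencil_iff.1 he
  set l : Phase → ℝ := fun q => perInt (dx q.1 * dx a + dx q.2 * dx b) with hl
  set n : Phase → ℝ := fun q => perInt (dx q.1 * dx q.1) with hn
  -- With a and b frozen, the mean of u_x a_x + v_x b_x need not vanish at other points q.
  -- Subtracting the multiple l/n of u from a restores solvability for c, and changes nothing at p,
  -- where l = 0.
  set A : Phase → Per := fun q => a - algebraMap ℝ Per (l q * (n q)⁻¹) * q.1 with hA
  -- `anti` vanishes at the origin, so the constant c(0) makes this primitive equal to c at p.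
  set C : Phase → Per := fun q => algebraMap ℝ Per (c.1 0) +
    anti (dx q.1 * dx (A q) + dx q.2 * dx b) with hC
  have hlp : l p = 0 := by simp only [hl, ← h.constraint, perInt_dx]
  have hAp : A p = a := by simp [hA, hlp]
  have hCp : C p = c := by
    simp only [hC, hAp, ← h.constraint]
    have h1 := eq_algebraMap_of_dx_eq_zero (f := c - anti (dx c)) (by
      rw [dx_sub, dx_anti_of_perInt_eq_zero (perInt_dx c), sub_self])
    have h2 : (c - anti (dx c)).1 0 = c.1 0 := by
      change c.1 0 - (anti (dx c)).1 0 = c.1 0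
      rw [anti_zero_apply, sub_zero]
    rw [h2] at h1
    linear_combination -h1
  have hdA : ∀ q, dx (A q) = dx a - algebraMap ℝ Per (l q * (n q)⁻¹) * dx q.1 := fun q => by
    rw [hA, dx_sub, dx_mul, dx_algebraMap, zero_mul, zero_add]
  have hzero : ∀ q ∈ nonsingular, perInt (dx q.1 * dx (A q) + dx q.2 * dx b) = 0 := by
    intro q hq
    have hnq : n q ≠ 0 := perInt_dx_sq_ne_zero hq
    have : dx q.1 * dx (A q) + dx q.2 * dx b = (dx q.1 * dx a + dx q.2 * dx b) -
        algebraMap ℝ Per (l q * (n q)⁻¹) * (dx q.1 * dx q.1) := by rw [hdA]; ring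
    rw [this, map_sub, perInt_algebraMap_mul]
    change l q - l q * (n q)⁻¹ * n q = 0
    field_simp
    ring
  have hsm : ∀ (O : Opens ℝ) (γ : ℝ → Phase) (hγ : SmoothCurveOn O γ),
      (∀ t ∈ O, γ t ∈ nonsingular) →
      (fun t => A (γ t)) ∈ Curv O ∧ (fun t => C (γ t)) ∈ Curv O := by
    intro O γ hγ hU
    set u := Curv.fst hγ
    set v := Curv.snd hγ
    have h1 := Curv.perInt_mem (Curv.dx u * ⟨fun _ => dx a, Curv.const_mem _⟩ +
      Curv.dx v * ⟨fun _ => dx b, Curv.const_mem _⟩)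
    have h2 := Curv.perInt_mem (Curv.dx u * Curv.dx u)
    have h3 : (fun t => algebraMap ℝ Per (n (γ t))⁻¹) ∈ Curv O := Curv.inv_mem h2
      (fun t ht x => perInt_dx_sq_ne_zero (hU t ht)) (fun t ht x => rfl)
    have h4 : (fun t => A (γ t)) ∈ Curv O := by
      have := sub_mem (Curv.const_mem a) (mul_mem (mul_mem h1 h3) u.2)
      refine Curv.mem_congr this fun t _ => ?_
      simp only [hA, map_mul]
      rfl
    refine ⟨h4, ?_⟩
    exact add_mem (Curv.const_mem _) (Curv.anti_mem (Curv.dx u * Curv.dx ⟨_, h4⟩ +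
      Curv.dx v * ⟨fun _ => dx b, Curv.const_mem _⟩))
  refine ⟨fun q => (dx (A q), dx b),
    fun q => (A q + dx q.1 * b - s • dx b, dx q.2 * b + C q + s • dx (A q)),
    ⟨smoothMapOn_of_opens fun O γ hγ hU => ?_, smoothMapOn_of_opens fun O γ hγ hU => ?_,
      fun q hq => ?_⟩, ?_⟩
  · obtain ⟨h1, -⟩ := hsm O γ hγ hU
    exact smoothCurveOn_mk (Curv.dx ⟨_, h1⟩) ⟨_, Curv.const_mem _⟩
  · obtain ⟨h1, h2⟩ := hsm O γ hγ hU
    exact smoothCurveOn_mk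
      (⟨_, h1⟩ + Curv.dx (Curv.fst hγ) * ⟨_, Curv.const_mem b⟩ - s • ⟨_, Curv.const_mem (dx b)⟩)
      (Curv.dx (Curv.snd hγ) * ⟨_, Curv.const_mem b⟩ + ⟨_, h2⟩ + s • Curv.dx ⟨_, h1⟩)
  · refine mem_pencil_iff.2 ⟨A q, b, C q, rfl, ?_, rfl⟩
    rw [hC, dx_add, dx_algebraMap, zero_add, dx_anti_of_perInt_eq_zero (hzero q hq)]
  · refine Prod.ext ?_ ?_
    · simp only [hAp, h.covector]
    · simp only [hAp, hCp, h.vector]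

/-- The first-order variation of a section of `η + s ϑ` at a point. -/
theorem exists_section_deriv {s : ℝ} {ξ X : Phase → Phase}
    (h : IsSection nonsingular (pencil thetaOp etaOp s) ξ X) {p : Phase} (hp : p ∈ nonsingular) :
    ∃ a b c, PencilElt s p (ξ p, X p) a b c ∧ ∀ Y : Phase, ∃ a' b' c' : Per,
      dirDeriv ξ p Y = toFun (dx a', dx b') ∧
      dirDeriv X p Y = toFun (a' + dx Y.1 * b + dx p.1 * b' - s • dx b',
        dx Y.2 * b + dx p.2 * b' + c' + s • dx a') ∧
      dx c' = dx Y.1 * dx a + dx p.1 * dx a' + dx Y.2 * dx b + dx p.2 * dx b' := by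
  choose! a b c habc using fun q hq => mem_pencil_iff.1 (h.mem q hq)
  refine ⟨a p, b p, c p, habc p hp, fun Y => ?_⟩
  obtain ⟨O, h0, hO⟩ := exists_line_mem_nonsingular hp Y
  have hl : SmoothCurveOn O (fun t => p + t • Y) := Curv.smoothCurveOn_line p Y
  have hξ := h.smooth_covector.comp hl hO
  have hX := h.smooth_vector.comp hl hO
  set γ : ℝ → Phase := fun t => p + t • Y with hγ
  set u := Curv.fst hl
  set v := Curv.snd hl
  set ξ₁ := Curv.fst hξ
  set ξ₂ := Curv.snd hξ
  set X₁ := Curv.fst hX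
  set X₂ := Curv.snd hX
  have hcov₁ : ∀ t ∈ O, ξ₁.1 t = dx (a (γ t)) := fun t ht =>
    congrArg Prod.fst (habc _ (hO t ht)).covector
  have hcov₂ : ∀ t ∈ O, ξ₂.1 t = dx (b (γ t)) := fun t ht =>
    congrArg Prod.snd (habc _ (hO t ht)).covector
  have hvec₁ : ∀ t ∈ O, X₁.1 t = a (γ t) + dx (γ t).1 * b (γ t) - s • dx (b (γ t)) :=
    fun t ht => congrArg Prod.fst (habc _ (hO t ht)).vector
  have hvec₂ : ∀ t ∈ O, X₂.1 t = dx (γ t).2 * b (γ t) + c (γ t) + s • dx (a (γ t)) :=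
    fun t ht => congrArg Prod.snd (habc _ (hO t ht)).vector
  -- The potentials were chosen pointwise with no regularity, so their smoothness must be read off
  -- from ξ and X. Here b is known from ξ₂ up to a constant β; multiplying X₁ = a + u_x b - s ξ₂ by
  -- u_x and integrating, with ∫ u_x a = -∫ u ξ₁, determines β ∫ u_x². Afterwards a and c are
  -- obtained from X₁ and X₂.
  have hb : (fun t => b (γ t)) ∈ Curv O := by
    set B : Curv O := ⟨_, Curv.anti_mem ξ₂⟩ with hB
    have h1 := Curv.perInt_mem (Curv.dx u * X₁ + s • (Curv.dx u * ξ₂) + u * ξ₁ -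
      Curv.dx u * Curv.dx u * B)
    have h2 := Curv.perInt_mem (Curv.dx u * Curv.dx u)
    have h3 : (fun t => algebraMap ℝ Per (perInt (dx (γ t).1 * dx (γ t).1))⁻¹) ∈ Curv O :=
      Curv.inv_mem h2 (fun t ht x => perInt_dx_sq_ne_zero (hO t ht)) (fun t ht x => rfl)
    refine Curv.mem_congr (add_mem B.2 (mul_mem h1 h3)) fun t ht => ?_
    have hn := perInt_dx_sq_ne_zero (hO t ht)
    set β : ℝ := (b (γ t) - B.1 t).1 0
    have e1 : b (γ t) = B.1 t + algebraMap ℝ Per β := by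
      have := eq_algebraMap_of_dx_eq_zero (f := b (γ t) - B.1 t) (by
        change dx (b (γ t) - anti (ξ₂.1 t)) = 0
        rw [hcov₂ t ht, dx_sub, dx_anti_of_perInt_eq_zero (perInt_dx _), sub_self])
      rw [← this]; ring
    have e2 : perInt (dx (γ t).1 * X₁.1 t + s • (dx (γ t).1 * ξ₂.1 t) + (γ t).1 * ξ₁.1 t -
        dx (γ t).1 * dx (γ t).1 * B.1 t) = β * perInt (dx (γ t).1 * dx (γ t).1) := by
      rw [← perInt_algebraMap_mul]
      refine perInt_eq_of_sub_eq_dx (h := (γ t).1 * a (γ t)) ?_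
      rw [hvec₁ t ht, hcov₁ t ht, hcov₂ t ht, dx_mul, Algebra.smul_def, Algebra.smul_def, e1]
      ring
    change b (γ t) = B.1 t + algebraMap ℝ Per (perInt (dx (γ t).1 * X₁.1 t +
      s • (dx (γ t).1 * ξ₂.1 t) + (γ t).1 * ξ₁.1 t - dx (γ t).1 * dx (γ t).1 * B.1 t)) *
      algebraMap ℝ Per (perInt (dx (γ t).1 * dx (γ t).1))⁻¹
    rw [e2, ← map_mul, mul_assoc, mul_inv_cancel₀ hn, mul_one, ← e1]
  set b' : Curv O := ⟨_, hb⟩ with hb'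
  have ha : (fun t => a (γ t)) ∈ Curv O := by
    refine Curv.mem_congr (X₁ - Curv.dx u * b' + s • ξ₂).2 fun t ht => ?_
    change a (γ t) = X₁.1 t - dx (γ t).1 * b (γ t) + s • ξ₂.1 t
    rw [hvec₁ t ht, hcov₂ t ht]; ring
  have hc : (fun t => c (γ t)) ∈ Curv O := by
    refine Curv.mem_congr (X₂ - Curv.dx v * b' - s • ξ₁).2 fun t ht => ?_
    change c (γ t) = X₂.1 t - dx (γ t).2 * b (γ t) - s • ξ₁.1 t
    rw [hvec₂ t ht, hcov₁ t ht]; ring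
  set a' : Curv O := ⟨_, ha⟩ with ha'
  set c' : Curv O := ⟨_, hc⟩ with hc'
  have hγ0 : γ 0 = p := by simp [hγ]
  have hu0 : u.1 0 = p.1 := congrArg Prod.fst hγ0
  have hv0 : v.1 0 = p.2 := congrArg Prod.snd hγ0
  have ha0 : a'.1 0 = a p := congrArg a hγ0
  have hb0 : b'.1 0 = b p := congrArg b hγ0
  have hdu : (Curv.dt u).1 0 = Y.1 :=
    Curv.dt_eq_of_hasDerivAt u h0 fun x => Curv.hasDerivAt_line p.1 Y.1 0 x
  have hdv : (Curv.dt v).1 0 = Y.2 :=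
    Curv.dt_eq_of_hasDerivAt v h0 fun x => Curv.hasDerivAt_line p.2 Y.2 0 x
  have d1 : (Curv.dt ξ₁).1 0 = (Curv.dt (Curv.dx a')).1 0 := Curv.dt_congr hcov₁ h0
  have d2 : (Curv.dt ξ₂).1 0 = (Curv.dt (Curv.dx b')).1 0 := Curv.dt_congr hcov₂ h0
  have d3 : (Curv.dt X₁).1 0 = (Curv.dt (a' + Curv.dx u * b' - s • Curv.dx b')).1 0 :=
    Curv.dt_congr hvec₁ h0
  have d4 : (Curv.dt X₂).1 0 = (Curv.dt (Curv.dx v * b' + c' + s • Curv.dx a')).1 0 :=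
    Curv.dt_congr hvec₂ h0
  have d5 : (Curv.dt (Curv.dx c')).1 0 =
      (Curv.dt (Curv.dx u * Curv.dx a' + Curv.dx v * Curv.dx b')).1 0 :=
    Curv.dt_congr (fun t ht => (habc _ (hO t ht)).constraint) h0
  simp only [Curv.dt_add_apply, Curv.dt_sub_apply, Curv.dt_mul_apply, Curv.dt_smul_apply,
    Curv.dt_dx_apply, Curv.dx_apply, hdu, hdv, hu0, hv0, ha0, hb0] at d1 d2 d3 d4 d5
  refine ⟨(Curv.dt a').1 0, (Curv.dt b').1 0, (Curv.dt c').1 0, ?_, ?_, ?_⟩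
  · rw [dirDeriv_eq h0 hξ, d1, d2]
  · rw [dirDeriv_eq h0 hX, d3, d4]
    congr 2
    ring
  · rw [d5]; ring

/-- After the first variations of the three sections are inserted, the cyclic sum is the integral of
an exact derivative. The directions of differentiation are the vectors of the sections themselves,
so their own constraints enter as well. -/
theorem pencil_jacobi {s : ℝ} {ξ₁ X₁ ξ₂ X₂ ξ₃ X₃ : Phase → Phase}
    (h₁ : IsSection nonsingular (pencil thetaOp etaOp s) ξ₁ X₁)
    (h₂ : IsSection nonsingular (pencil thetaOp etaOp s) ξ₂ X₂)
    (h₃ : IsSection nonsingular (pencil thetaOp etaOp s) ξ₃ X₃) {p : Phase}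
    (hp : p ∈ nonsingular) :
    lieTerm X₁ ξ₂ X₃ p + lieTerm X₂ ξ₃ X₁ p + lieTerm X₃ ξ₁ X₂ p = 0 := by
  obtain ⟨a₁, b₁, c₁, e₁, k₁⟩ := exists_section_deriv h₁ hp
  obtain ⟨a₂, b₂, c₂, e₂, k₂⟩ := exists_section_deriv h₂ hp
  obtain ⟨a₃, b₃, c₃, e₃, k₃⟩ := exists_section_deriv h₃ hp
  obtain ⟨f₁, g₁, l₁, hξ₁, hX₁, hc₁⟩ := k₁ (X₃ p)
  obtain ⟨f₂, g₂, l₂, hξ₂, hX₂, hc₂⟩ := k₂ (X₁ p)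
  obtain ⟨f₃, g₃, l₃, hξ₃, hX₃, hc₃⟩ := k₃ (X₂ p)
  have hx₁ : ξ₁ p = _ := e₁.covector
  have hx₂ : ξ₂ p = _ := e₂.covector
  have hx₃ : ξ₃ p = _ := e₃.covector
  have hy₁ : X₁ p = _ := e₁.vector
  have hy₂ : X₂ p = _ := e₂.vector
  have hy₃ : X₃ p = _ := e₃.vector
  have hd₁ := e₁.constraint
  have hd₂ := e₂.constraint
  have hd₃ := e₃.constraint
  simp only [lieTerm, hξ₁, hξ₂, hξ₃, hX₁, hX₂, hX₃, hx₁, hx₂, hx₃, pairing_toFun, ← map_add]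
  rw [hy₁] at hc₂ ⊢
  rw [hy₂] at hc₃ ⊢
  rw [hy₃] at hc₁ ⊢
  -- The primitive of the integrand: the terms with varied potentials f, g, l come from the skew
  -- form, and the cubic cyclic term carries the factor s.
  rw [← perInt_dx (f₁ * a₂ + f₂ * a₃ + f₃ * a₁ + g₁ * c₂ + g₂ * c₃ + g₃ * c₁ +
    b₂ * l₁ + b₃ * l₂ + b₁ * l₃ + s • (dx a₁ * (b₂ * dx b₃ - b₃ * dx b₂) +
      dx a₂ * (b₃ * dx b₁ - b₁ * dx b₃) + dx a₃ * (b₁ * dx b₂ - b₂ * dx b₁)))]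
  congr 1
  simp only [dx_add, dx_sub, dx_mul, dx_smul] at hc₁ hc₂ hc₃ ⊢
  simp only [hd₁, hd₂, hd₃, hc₁, hc₂, hc₃]
  simp only [Algebra.smul_def]
  ring

theorem isImplecticOn_pencil (s : ℝ) : IsImplecticOn nonsingular (pencil thetaOp etaOp s) where
  skew _ hp e := pencil_skew s hp e
  smooth _ _ _ he := exists_pencil_section s he
  jacobi _ _ _ _ _ _ h₁ h₂ h₃ _ hp := pencil_jacobi h₁ h₂ h₃ hp

/-! ### The Hamiltonians -/

theorem hasGradOn_hamTheta (U : Set Phase) :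
    HasGradOn U hamTheta (fun p => (p.1 * dx p.2, p.2 - p.1 * dx p.1)) := by
  refine hasGradOn_of_density (smoothMapOn_of_opens fun O c hc _ => ?_) fun O c hc _ => ?_
  · exact smoothCurveOn_mk (Curv.fst hc * Curv.dx (Curv.snd hc))
      (Curv.snd hc - Curv.fst hc * Curv.dx (Curv.fst hc))
  · set u := Curv.fst hc
    set v := Curv.snd hc
    refine ⟨(1 / 2 : ℝ) • (v * v + Curv.dx v * (u * u)), fun t _ => ?_, fun t ht => ?_⟩
    · change _ = perInt ((1 / 2 : ℝ) • ((c t).2 * (c t).2 + dx (c t).2 * ((c t).1 * (c t).1)))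
      rw [map_smul, smul_eq_mul, hamTheta, perInt_apply]
      congr 1
      refine intervalIntegral.integral_congr fun x _ => ?_
      simp only [pow_two]
      rfl
    · refine perInt_eq_of_sub_eq_dx
        (h := (1 / 2 : ℝ) • ((c t).1 * (c t).1 * (Curv.dt v).1 t)) ?_
      have h2 : algebraMap ℝ Per (1 / 2) * 2 = 1 := by
        rw [← map_ofNat (algebraMap ℝ Per) 2, ← map_mul]; norm_num
      have h3 : (u * u).1 t = (c t).1 * (c t).1 := rfl
      simp only [h3, Curv.dt_add_apply, Curv.dt_mul_apply, Curv.dt_smul_apply, Curv.dt_dx_apply,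
        Curv.dx_apply, dx_smul, dx_mul]
      simp only [Algebra.smul_def]
      rw [show u.1 t = (c t).1 from rfl, show v.1 t = (c t).2 from rfl]
      linear_combination ((c t).2 * (Curv.dt v).1 t + (c t).1 * (Curv.dt u).1 t * dx (c t).2 -
        (c t).1 * dx (c t).1 * (Curv.dt v).1 t) * h2

theorem hasGradOn_hamEta (U : Set Phase) :
    HasGradOn U hamEta (fun p => (-dx p.2, dx p.1)) := by
  refine hasGradOn_of_density (smoothMapOn_of_opens fun O c hc _ => ?_) fun O c hc _ => ?_
  · exact smoothCurveOn_mk (-Curv.dx (Curv.snd hc)) (Curv.dx (Curv.fst hc))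
  · set u := Curv.fst hc
    set v := Curv.snd hc
    refine ⟨(1 / 2 : ℝ) • (Curv.dx u * v - Curv.dx v * u), fun t _ => ?_, fun t ht => ?_⟩
    · change _ = perInt ((1 / 2 : ℝ) • (dx (c t).1 * (c t).2 - dx (c t).2 * (c t).1))
      rw [map_smul, smul_eq_mul, hamEta, perInt_apply]
      rfl
    · refine perInt_eq_of_sub_eq_dx
        (h := (1 / 2 : ℝ) • ((Curv.dt u).1 t * (c t).2 - (Curv.dt v).1 t * (c t).1)) ?_
      have h2 : algebraMap ℝ Per (1 / 2) * 2 = 1 := by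
        rw [← map_ofNat (algebraMap ℝ Per) 2, ← map_mul]; norm_num
      simp only [Curv.dt_sub_apply, Curv.dt_mul_apply, Curv.dt_smul_apply, Curv.dt_dx_apply,
        Curv.dx_apply, dx_smul, dx_sub, dx_mul]
      simp only [Algebra.smul_def]
      rw [show u.1 t = (c t).1 from rfl, show v.1 t = (c t).2 from rfl]
      linear_combination (dx (c t).1 * (Curv.dt v).1 t - dx (c t).2 * (Curv.dt u).1 t) * h2

theorem isBiHamiltonianOn_riemannField :
    IsBiHamiltonianOn nonsingular thetaOp etaOp hamTheta hamEta riemannField where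
  implectic_fst := isImplecticOn_thetaOp
  implectic_snd := etaOp_eq_pencil ▸ isImplecticOn_pencil 0
  compatible := isImplecticOn_pencil
  hamiltonian_fst := ⟨_, hasGradOn_hamTheta _, fun p _ => by
    refine Prod.ext ?_ ?_ <;> simp [riemannField]⟩
  hamiltonian_snd := ⟨_, hasGradOn_hamEta _, fun p _ => by
    -- Here a = -v and b = u, and c = 0 is admissible because u_x(-v_x) + v_x u_x = 0.
    refine ⟨-p.2, p.1, 0, dx_neg _, rfl, ?_, ?_⟩
    · rw [dx_zero]; ring
    · refine Prod.ext ?_ ?_ <;> simp [riemannField, mul_comm, sub_eq_neg_add]⟩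

end RiemannHydro
end

noncomputable section

namespace RiemannHydro

/-! ### The resolvent of the Lax operator as a formal power series -/

section Resolvent

open PowerSeries

variable {A : Type} [CommRing A]

/-- The coefficientwise action of an additive map on power series. -/
def coeffMap (D : A →+ A) : A⟦X⟧ →+ A⟦X⟧ where
  toFun f := PowerSeries.mk fun n => D (coeff n f)
  map_zero' := by ext n; simp
  map_add' f g := by ext n; simp

@[simp] theorem coeff_coeffMap (D : A →+ A) (n : ℕ) (f : A⟦X⟧) :
    coeff n (coeffMap D f) = D (coeff n f) :=
  coeff_mk n fun n => D (coeff n f)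

/-- The Leibniz rule. -/
def IsLeibniz (D : A →+ A) : Prop := ∀ a b, D (a * b) = D a * b + a * D b

theorem IsLeibniz.map_one {D : A →+ A} (hD : IsLeibniz D) : D 1 = 0 := by
  have h := hD 1 1
  rw [one_mul, mul_one, one_mul] at h
  exact left_eq_add.1 h

theorem IsLeibniz.coeffMap {D : A →+ A} (hD : IsLeibniz D) : IsLeibniz (coeffMap D) := by
  intro f g
  ext n
  simp only [coeff_coeffMap, map_add, coeff_mul, map_sum, hD _ _, Finset.sum_add_distrib]

theorem coeffMap_X_mul (D : A →+ A) (f : A⟦X⟧) :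
    coeffMap D (X * f) = X * coeffMap D f := by
  ext n
  cases n with
  | zero => simp
  | succ n => simp [coeff_succ_X_mul]

theorem coeffMap_X_pow_mul (D : A →+ A) (k : ℕ) (f : A⟦X⟧) :
    coeffMap D (X ^ k * f) = X ^ k * coeffMap D f := by
  induction k with
  | zero => simp
  | succ k ih => rw [pow_succ', mul_assoc, coeffMap_X_mul, ih, mul_assoc]

theorem coeffMap_C (D : A →+ A) (a : A) : coeffMap D (C a) = C (D a) := by
  ext n
  simp only [coeff_coeffMap, coeff_C]
  split_ifs <;> simp

theorem coeffMap_C_mul {D : A →+ A} (hD : IsLeibniz D) (a : A) (f : A⟦X⟧) :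
    coeffMap D (C a * f) = C (D a) * f + C a * coeffMap D f := by
  rw [hD.coeffMap, coeffMap_C]

variable (D : A →+ A) (w m : A)

/-- The potential `w - 2 λ m`. -/
def potential : A⟦X⟧ := C w - 2 * X * C m

/-- The defect `Q b² - 1 - λ² (2 b b'' - b'²)`. -/
def defect (b : A⟦X⟧) : A⟦X⟧ :=
  potential w m * b ^ 2 - 1 -
    X ^ 2 * (2 * b * coeffMap D (coeffMap D b) - coeffMap D b ^ 2)

/-- Successive approximations of the resolvent. -/
def resolventApprox (r k : A) : ℕ → A⟦X⟧
  | 0 => C r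
  | n + 1 => resolventApprox r k n - C k * defect D w m (resolventApprox r k n)

/-- The formal solution `b` of `Q b² = 1 + λ² (2 b b'' - b'²)` with `b = r + O(λ)`. -/
def resolvent (r k : A) : A⟦X⟧ :=
  PowerSeries.mk fun n => coeff n (resolventApprox D w m r k n)

variable {D w m}

/-- An exact expansion, since λ is a constant for D. Apart from the term -2Qbd, the changes have
order at least 2n or n + 2 in λ. -/
theorem defect_sub_X_pow_mul (b d : A⟦X⟧) (n : ℕ) :
    defect D w m (b - X ^ n * d) = defect D w m b - X ^ n * (2 * potential w m * b * d)
      + X ^ n * X ^ n * (potential w m * d ^ 2) + X ^ 2 * X ^ n *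
        (2 * d * coeffMap D (coeffMap D b) + 2 * b * coeffMap D (coeffMap D d)
        - 2 * X ^ n * d * coeffMap D (coeffMap D d) - 2 * coeffMap D b * coeffMap D d
        + X ^ n * coeffMap D d ^ 2) := by
  simp only [defect, map_sub, coeffMap_X_pow_mul]
  ring

/-- A Newton iteration with frozen slope: the linear part of the defect at λ = 0 is multiplication
by 2wr, whose inverse is k = r/2 because w r² = 1. Each step therefore cancels the lowest remaining
coefficient of the defect, and derivatives enter only two orders later. -/
theorem resolventApprox_spec {r k : A} (h1 : w * r * r = 1) (h2 : 2 * k = r) (n : ℕ) :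
    X ∣ resolventApprox D w m r k n - C r ∧
      X ^ (n + 1) ∣ defect D w m (resolventApprox D w m r k n) := by
  induction n with
  | zero =>
    refine ⟨by simp [resolventApprox], ⟨-(2 * C m * C r ^ 2) - X * (2 * C r *
      coeffMap D (coeffMap D (C r)) - coeffMap D (C r) ^ 2), ?_⟩⟩
    have h3 : (C w * C r * C r : A⟦X⟧) = 1 := by rw [← map_mul, ← map_mul, h1, map_one]
    simp only [resolventApprox, defect, potential]
    linear_combination h3
  | succ n ih =>
    obtain ⟨⟨β, hβ⟩, ⟨e, he⟩⟩ := ih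
    set b := resolventApprox D w m r k n
    have hstep : resolventApprox D w m r k (n + 1) = b - X ^ (n + 1) * (C k * e) := by
      rw [resolventApprox, he]; ring
    have hb : b = C r + X * β := by rw [← hβ]; ring
    have h3 : (2 * C w * C r * C k : A⟦X⟧) = 1 := by
      have : (2 * C k : A⟦X⟧) = C r := by rw [← h2, map_mul, map_ofNat]
      have h4 : (C w * C r * C r : A⟦X⟧) = 1 := by rw [← map_mul, ← map_mul, h1, map_one]
      linear_combination C w * C r * this + h4
    rw [hstep]
    constructor
    · exact ⟨β - X ^ n * (C k * e), by rw [hb]; ring⟩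
    · rw [defect_sub_X_pow_mul, he]
      refine ⟨(4 * C m * b * C k - 2 * C w * β * C k) * e +
        X ^ n * (potential w m * (C k * e) ^ 2) + X *
        (2 * (C k * e) * coeffMap D (coeffMap D b) + 2 * b * coeffMap D (coeffMap D (C k * e))
        - 2 * X ^ (n + 1) * (C k * e) * coeffMap D (coeffMap D (C k * e))
        - 2 * coeffMap D b * coeffMap D (C k * e)
        + X ^ (n + 1) * coeffMap D (C k * e) ^ 2), ?_⟩
      have h5 : X ^ (n + 1) * e - X ^ (n + 1) * (2 * potential w m * b * (C k * e)) =
          X ^ (n + 2) * ((4 * C m * b * C k - 2 * C w * β * C k) * e) := by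
        rw [potential]
        have hb' : C w * b = C w * C r + X * (C w * β) := by rw [hb]; ring
        linear_combination (-(X ^ (n + 1) * e)) * h3 - 2 * X ^ (n + 1) * C k * e * hb'
      rw [h5]
      ring

/-- The coefficients stabilise: later corrections do not touch order j, so taking the n-th
coefficient of the n-th approximation defines the limit. -/
theorem X_pow_dvd_resolventApprox_sub {r k : A} (h1 : w * r * r = 1) (h2 : 2 * k = r)
    {j n : ℕ} (hjn : j ≤ n) :
    X ^ (j + 1) ∣ resolventApprox D w m r k n - resolventApprox D w m r k j := by
  induction n, hjn using Nat.le_induction with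
  | base => simp
  | succ n hjn ih =>
    have h3 : X ^ (j + 1) ∣ C k * defect D w m (resolventApprox D w m r k n) :=
      ((pow_dvd_pow X (by omega)).trans (resolventApprox_spec h1 h2 n).2).mul_left _
    have := ih.sub h3
    rw [sub_right_comm] at this
    exact this

theorem X_pow_dvd_resolvent_sub {r k : A} (h1 : w * r * r = 1) (h2 : 2 * k = r) (n : ℕ) :
    X ^ (n + 1) ∣ resolventApprox D w m r k n - resolvent D w m r k := by
  rw [X_pow_dvd_iff]
  intro j hj
  have := X_pow_dvd_iff.1 (X_pow_dvd_resolventApprox_sub (D := D) (m := m) h1 h2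
    (Nat.lt_succ_iff.1 hj)) j (Nat.lt_succ_self j)
  rw [map_sub] at this ⊢
  simpa [resolvent] using this

theorem defect_resolvent {r k : A} (h1 : w * r * r = 1) (h2 : 2 * k = r) :
    defect D w m (resolvent D w m r k) = 0 := by
  have h : ∀ n, X ^ (n + 1) ∣ defect D w m (resolvent D w m r k) := by
    intro n
    obtain ⟨d, hd⟩ := X_pow_dvd_resolvent_sub (D := D) (m := m) h1 h2 n
    have hb : resolvent D w m r k = resolventApprox D w m r k n - X ^ (n + 1) * d := by
      rw [← hd]; ring
    rw [hb, defect_sub_X_pow_mul]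
    refine dvd_add (dvd_add (dvd_sub (resolventApprox_spec h1 h2 n).2 (dvd_mul_right _ _)) ?_) ?_
    · rw [mul_assoc]; exact dvd_mul_right _ _
    · rw [mul_comm (X ^ 2), mul_assoc]; exact dvd_mul_right _ _
  ext n
  exact X_pow_dvd_iff.1 (h n) n (Nat.lt_succ_self n)

theorem potential_mul_resolvent_sq {r k : A} (h1 : w * r * r = 1) (h2 : 2 * k = r) :
    potential w m * resolvent D w m r k ^ 2 = 1 + X ^ 2 * (2 * resolvent D w m r k *
      coeffMap D (coeffMap D (resolvent D w m r k)) - coeffMap D (resolvent D w m r k) ^ 2) := by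
  have := defect_resolvent (D := D) (m := m) h1 h2
  rw [defect] at this
  linear_combination this

theorem constantCoeff_resolvent (r k : A) :
    constantCoeff (resolvent D w m r k) = r := by
  rw [← coeff_zero_eq_constantCoeff_apply, resolvent, coeff_mk, resolventApprox]
  simp

theorem isUnit_resolvent {r k : A} (h1 : w * r * r = 1) : IsUnit (resolvent D w m r k) := by
  rw [isUnit_iff_constantCoeff, constantCoeff_resolvent]
  exact IsUnit.of_mul_eq_one_right (w * r) h1

/-- The construction uses only ring operations and D, hence is natural. Applied to evaluation at a
time, it identifies the resolvent over the ring of curves with the pointwise one. -/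
theorem map_resolvent {A' : Type} [CommRing A'] {D' : A' →+ A'} (φ : A →+* A')
    (hφ : ∀ a, φ (D a) = D' (φ a)) (r k : A) :
    PowerSeries.map φ (resolvent D w m r k) = resolvent D' (φ w) (φ m) (φ r) (φ k) := by
  have hc : ∀ f : A⟦X⟧, PowerSeries.map φ (coeffMap D f) = coeffMap D' (PowerSeries.map φ f) := by
    intro f; ext n; simp [hφ]
  have h : ∀ n, PowerSeries.map φ (resolventApprox D w m r k n) =
      resolventApprox D' (φ w) (φ m) (φ r) (φ k) n := by
    intro n
    induction n with
    | zero => simp [resolventApprox]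
    | succ n ih => simp [resolventApprox, defect, potential, hc, ih, map_ofNat (PowerSeries.map φ) 2]
  ext n
  simp only [resolvent, coeff_map, coeff_mk, ← h]

/-- The linear third order equation satisfied by the resolvent. -/
theorem resolvent_linear {B : Type} [CommRing B] {D : B →+ B} (hD : IsLeibniz D) {Q b ρ l : B}
    (hl : ∀ f, D (l * f) = l * D f) (hb : b * ρ = 1)
    (h : Q * b ^ 2 = 1 + l * (2 * b * D (D b) - D b ^ 2)) :
    D Q * b + 2 * Q * D b = 2 * l * D (D (D b)) := by
  have h2 : (2 : B) = 1 + 1 := one_add_one_eq_two.symm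
  have e := congrArg D h
  rw [map_add, hl, map_sub, hD, pow_two, pow_two, hD b b, hD.map_one, hD, hD, hD, h2, map_add,
    hD.map_one] at e
  -- The differentiated quadratic equation is b times the claim, so it is multiplied by ρ = 1/b.
  linear_combination ρ * e - (D Q * b + 2 * Q * D b - 2 * l * D (D (D b))) * hb

/-- The first variation of the density `1 / b`. -/
theorem resolvent_variation {B : Type} [CommRing B] {D δ : B →+ B} (hD : IsLeibniz D)
    (hδ : IsLeibniz δ) (hc : ∀ f, δ (D f) = D (δ f)) {Q b ρ l : B}
    (hl : ∀ f, D (l * f) = l * D f) (hl' : ∀ f, δ (l * f) = l * δ f) (hb : b * ρ = 1)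
    (h : Q * b ^ 2 = 1 + l * (2 * b * D (D b) - D b ^ 2)) :
    2 * δ ρ = b * δ Q + 2 * D (l * (δ b * D b * ρ - D (δ b))) := by
  have h2 : (2 : B) = 1 + 1 := one_add_one_eq_two.symm
  have e := congrArg δ h
  rw [map_add, hl', map_sub, hδ, pow_two, pow_two, hδ b b, hδ.map_one, hδ, hδ, hδ, h2, map_add,
    hδ.map_one, hc, hc] at e
  have e1 := congrArg D hb
  have e2 := congrArg δ hb
  rw [hD, hD.map_one] at e1
  rw [hδ, hδ.map_one] at e2
  have e1' : D ρ = -(ρ ^ 2 * D b) := by linear_combination ρ * e1 - D ρ * hb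
  have e2' : δ ρ = -(ρ ^ 2 * δ b) := by linear_combination ρ * e2 - δ ρ * hb
  rw [hl, map_sub, hD, hD, e1', e2']
  -- The undifferentiated equation `h` eliminates the term Q δb that remains after varying the
  -- quadratic relation.
  linear_combination (-ρ) * e + 2 * ρ ^ 2 * δ b * h + (b * δ Q - 2 * Q * δ b * ρ * b -
    2 * l * D (D (δ b)) + 4 * l * ρ * δ b * D (D b)) * hb

end Resolvent

end RiemannHydro
end

noncomputable section

namespace RiemannHydro

open TopologicalSpace PowerSeries

variable {O : Opens ℝ}

/-! ### The hierarchy of conserved functionals -/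

/-- `d/dx` as an additive map. -/
def dxHom : Per →+ Per := (dxD : Per →ₗ[ℝ] Per).toAddMonoidHom

theorem dxHom_apply (f : Per) : dxHom f = dx f := rfl

theorem isLeibniz_dxHom : IsLeibniz dxHom := dx_mul

/-- The ring of smooth curves. -/
def CurvRing (O : Opens ℝ) : Type := Curv O

namespace CurvRing

instance : CommRing (CurvRing O) := inferInstanceAs (CommRing (Curv O))
instance : Algebra ℝ (CurvRing O) := inferInstanceAs (Algebra ℝ (Curv O))

/-- A smooth curve as an element of the ring of smooth curves. -/
def of (f : Curv O) : CurvRing O := f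

/-- Evaluation at a time. -/
def ev (t : ℝ) : CurvRing O →+* Per := Curv.ev t

theorem ext {f g : CurvRing O} (h : ∀ t, ev t f = ev t g) : f = g :=
  Subtype.ext <| funext h

/-- The space derivative of smooth curves as an additive map. -/
def dxHom : CurvRing O →+ CurvRing O where
  toFun f := Curv.dxLin f
  map_zero' := map_zero (Curv.dxLin (O := O))
  map_add' f g := map_add (Curv.dxLin (O := O)) f g

/-- The time derivative of smooth curves as an additive map. -/
def dtHom : CurvRing O →+ CurvRing O where
  toFun f := Curv.dtLin f
  map_zero' := map_zero (Curv.dtLin (O := O))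
  map_add' f g := map_add (Curv.dtLin (O := O)) f g

theorem isLeibniz_dxHom : IsLeibniz (dxHom (O := O)) := fun _ _ =>
  ext fun _ => dx_mul _ _

theorem isLeibniz_dtHom : IsLeibniz (dtHom (O := O)) := fun f g => ext fun t =>
  Curv.dt_mul_apply f g t

theorem dtHom_dxHom (f : CurvRing O) : dtHom (dxHom f) = dxHom (dtHom f) := Curv.dt_dx f

theorem dxHom_of (f : Curv O) : dxHom (of f) = of (Curv.dx f) := rfl

theorem ev_dxHom (f : CurvRing O) (t : ℝ) : ev t (dxHom f) = dx (ev t f) := rfl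

end CurvRing

/-- The discriminant `u_x² - 2 v_x`. -/
def disc (p : Phase) : Per := dx p.1 * dx p.1 - 2 * dx p.2

theorem disc_apply (p : Phase) (x : ℝ) :
    (disc p).1 x = (dx p.1).1 x ^ 2 - 2 * (dx p.2).1 x := by
  rw [pow_two]; rfl

open Classical in
/-- The function `(u_x² - 2 v_x)^{-1/2}`. -/
def rsqrtDisc (p : Phase) : Per :=
  if hp : p ∈ nonsingular then
    ⟨fun x => (√((disc p).1 x))⁻¹, by
      refine ContDiff.inv ((disc p).2.1.sqrt fun x => ?_) fun x => ?_
      · rw [disc_apply]; exact hp x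
      · rw [disc_apply]; exact (Real.sqrt_pos.2 (discriminant_pos hp x)).ne',
     fun x => by simp only [(disc p).2.2 x]⟩
  else 0

theorem rsqrtDisc_apply {p : Phase} (hp : p ∈ nonsingular) (x : ℝ) :
    (rsqrtDisc p).1 x = (√((disc p).1 x))⁻¹ := by
  simp [rsqrtDisc, hp]

theorem disc_mul_rsqrtDisc {p : Phase} (hp : p ∈ nonsingular) :
    disc p * rsqrtDisc p * rsqrtDisc p = 1 := by
  refine Subtype.ext <| funext fun x => ?_
  change (disc p).1 x * (rsqrtDisc p).1 x * (rsqrtDisc p).1 x = 1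
  have h : 0 < (disc p).1 x := by rw [disc_apply]; exact discriminant_pos hp x
  have h2 := Real.sqrt_pos.2 h
  rw [rsqrtDisc_apply hp]
  field_simp
  rw [Real.sq_sqrt h.le]

theorem two_mul_half_smul {A : Type} [CommRing A] [Algebra ℝ A] (r : A) :
    2 * ((1 / 2 : ℝ) • r) = r := by
  rw [Algebra.smul_def, ← mul_assoc, ← map_ofNat (algebraMap ℝ A) 2, ← map_mul]
  norm_num

/-- The generating series `b` of the hierarchy. -/
def bSer (p : Phase) : Per⟦X⟧ :=
  resolvent dxHom (disc p) (dx (dx p.1)) (rsqrtDisc p) ((1 / 2 : ℝ) • rsqrtDisc p)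

/-- The generating series `a = -u_x b - λ b_x` of the hierarchy. -/
def aSer (p : Phase) : Per⟦X⟧ := -(C (dx p.1) * bSer p) - X * coeffMap dxHom (bSer p)

/-- The generating series of the components `c = λ a_x - v_x b`. -/
def cSer (p : Phase) : Per⟦X⟧ := X * coeffMap dxHom (aSer p) - C (dx p.2) * bSer p

/-- The functionals of the hierarchy, with generating function `∫ 1 / b`. -/
def gammaFun (n : ℕ) (p : Phase) : ℝ := perInt (coeff n (Ring.inverse (bSer p)))

/-- The gradients of the hierarchy. -/
def gammaGrad (n : ℕ) (p : Phase) : Phase := (dx (coeff n (aSer p)), dx (coeff n (bSer p)))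

/-- This constraint is half of the third order equation for b with Q = u_x² - 2v_x - 2λ u_xx,
rewritten through a and c. -/
theorem coeffMap_cSer {p : Phase} (hp : p ∈ nonsingular) :
    coeffMap dxHom (cSer p) = C (dx p.1) * coeffMap dxHom (aSer p) +
      C (dx p.2) * coeffMap dxHom (bSer p) := by
  have hD := isLeibniz_dxHom.coeffMap
  have h1 := disc_mul_rsqrtDisc hp
  have hlin := resolvent_linear hD (coeffMap_X_pow_mul dxHom 2)
    (Ring.mul_inverse_cancel _ (isUnit_resolvent h1))
    (potential_mul_resolvent_sq (D := dxHom) (m := dx (dx p.1)) h1 (two_mul_half_smul _))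
  change coeffMap dxHom (potential _ _) * bSer p + 2 * potential _ _ * coeffMap dxHom (bSer p) =
    2 * X ^ 2 * coeffMap dxHom (coeffMap dxHom (coeffMap dxHom (bSer p))) at hlin
  have hpot : potential (disc p) (dx (dx p.1)) =
      C (dx p.1) * C (dx p.1) - C (dx p.2) - C (dx p.2) - X * C (dx (dx p.1)) -
        X * C (dx (dx p.1)) := by
    rw [potential, disc, map_sub, map_mul, map_mul, map_ofNat]; ring
  rw [hpot] at hlin
  simp only [map_sub, coeffMap_C_mul isLeibniz_dxHom, coeffMap_X_mul, coeffMap_C,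
    dxHom_apply] at hlin
  have h2 : ∀ f g : Per⟦X⟧, 2 * f = 2 * g → f = g := fun f g h => by
    have e : (2 : Per⟦X⟧) * C (algebraMap ℝ Per (1 / 2)) = 1 := by
      rw [← map_ofNat C 2, ← map_mul, ← map_ofNat (algebraMap ℝ Per) 2, ← map_mul]; norm_num
    linear_combination C (algebraMap ℝ Per (1 / 2)) * h - (f - g) * e
  refine h2 _ _ ?_
  simp only [cSer, aSer, map_sub, map_neg, map_add, coeffMap_C_mul isLeibniz_dxHom,
    coeffMap_X_mul, dxHom_apply]
  linear_combination hlin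

/-- The Lenard recursion: `0 ∈ η g_0` and `ϑ g_n ∈ η g_{n+1}`. -/
theorem pencilElt_gammaGrad {p : Phase} (hp : p ∈ nonsingular) (n : ℕ) :
    PencilElt 0 p (gammaGrad n p, (coeff n (-(X * coeffMap dxHom (bSer p))),
      coeff n (X * coeffMap dxHom (aSer p))))
      (coeff n (aSer p)) (coeff n (bSer p)) (coeff n (cSer p)) := by
  refine ⟨rfl, ?_, ?_⟩
  · have := congrArg (coeff n) (coeffMap_cSer hp)
    simpa [coeff_C_mul, dxHom_apply] using this
  · simp only [aSer, cSer, map_sub, map_neg, coeff_C_mul, zero_smul, sub_zero, add_zero]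
    ext1
    · simp only; ring
    · simp only; ring

theorem gammaGrad_zero_mem {p : Phase} (hp : p ∈ nonsingular) : (gammaGrad 0 p, 0) ∈ etaOp p := by
  have := mem_etaOp_iff.2 ⟨_, _, _, pencilElt_gammaGrad hp 0⟩
  simp only [map_neg, coeff_zero_X_mul, neg_zero] at this
  exact this

theorem gammaGrad_succ_mem {p : Phase} (hp : p ∈ nonsingular) (n : ℕ) :
    (gammaGrad (n + 1) p, (-(gammaGrad n p).2, (gammaGrad n p).1)) ∈ etaOp p := by
  have := mem_etaOp_iff.2 ⟨_, _, _, pencilElt_gammaGrad hp (n + 1)⟩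
  simp only [map_neg, coeff_succ_X_mul, coeff_coeffMap] at this
  exact this

/-! ### The generating series along smooth curves and their first variation -/

namespace Curv

theorem rsqrtDisc_mem {c : ℝ → Phase} (hc : SmoothCurveOn O c) (hU : ∀ t ∈ O, c t ∈ nonsingular) :
    (fun t => rsqrtDisc (c t)) ∈ Curv O := by
  have hd : (fun t => disc (c t)) ∈ Curv O :=
    (dx (fst hc) * dx (fst hc) - 2 * dx (snd hc)).2
  have hpos : ∀ z ∈ (O : Set ℝ) ×ˢ (Set.univ : Set ℝ), 0 < (disc (c z.1)).1 z.2 := fun z hz => by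
    rw [disc_apply]; exact discriminant_pos (hU z.1 hz.1) z.2
  exact ((ContDiffOn.sqrt hd fun z hz => (hpos z hz).ne').inv fun z hz =>
    (Real.sqrt_pos.2 (hpos z hz)).ne').congr fun z hz => rsqrtDisc_apply (hU z.1 hz.1) z.2

/-- The discriminant along a smooth curve. -/
def disc {c : ℝ → Phase} (hc : SmoothCurveOn O c) : CurvRing O :=
  CurvRing.of (dx (fst hc)) * CurvRing.of (dx (fst hc)) - 2 * CurvRing.of (dx (snd hc))

/-- The function `(u_x² - 2 v_x)^{-1/2}` along a smooth curve. -/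
def rsqrtDisc {c : ℝ → Phase} (hc : SmoothCurveOn O c) (hU : ∀ t ∈ O, c t ∈ nonsingular) :
    CurvRing O := CurvRing.of ⟨_, rsqrtDisc_mem hc hU⟩

/-- The generating series `b` along a smooth curve. -/
def bSer {c : ℝ → Phase} (hc : SmoothCurveOn O c) (hU : ∀ t ∈ O, c t ∈ nonsingular) :
    (CurvRing O)⟦X⟧ :=
  resolvent CurvRing.dxHom (disc hc) (CurvRing.of (dx (dx (fst hc))))
    (rsqrtDisc hc hU) ((1 / 2 : ℝ) • rsqrtDisc hc hU)

/-- The generating series `a` along a smooth curve. -/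
def aSer {c : ℝ → Phase} (hc : SmoothCurveOn O c) (hU : ∀ t ∈ O, c t ∈ nonsingular) :
    (CurvRing O)⟦X⟧ :=
  -(C (CurvRing.of (dx (fst hc))) * bSer hc hU) - X * coeffMap CurvRing.dxHom (bSer hc hU)

theorem map_ev_bSer {c : ℝ → Phase} (hc : SmoothCurveOn O c) (hU : ∀ t ∈ O, c t ∈ nonsingular)
    (t : ℝ) : PowerSeries.map (CurvRing.ev t) (bSer hc hU) = RiemannHydro.bSer (c t) :=
  map_resolvent (D' := dxHom) (CurvRing.ev t) (fun _ => rfl) _ _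

theorem map_ev_aSer {c : ℝ → Phase} (hc : SmoothCurveOn O c) (hU : ∀ t ∈ O, c t ∈ nonsingular)
    (t : ℝ) : PowerSeries.map (CurvRing.ev t) (aSer hc hU) = RiemannHydro.aSer (c t) := by
  have h : PowerSeries.map (CurvRing.ev t) (coeffMap CurvRing.dxHom (bSer hc hU)) =
      coeffMap dxHom (PowerSeries.map (CurvRing.ev t) (bSer hc hU)) := by
    ext1 n
    simp only [coeff_map, coeff_coeffMap]; rfl
  rw [aSer, map_sub, map_neg, map_mul, map_mul, h, map_ev_bSer, map_C, map_X]
  rfl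

theorem coeff_bSer {c : ℝ → Phase} (hc : SmoothCurveOn O c) (hU : ∀ t ∈ O, c t ∈ nonsingular)
    (n : ℕ) (t : ℝ) : coeff n (RiemannHydro.bSer (c t)) = CurvRing.ev t (coeff n (bSer hc hU)) := by
  rw [← map_ev_bSer hc hU, coeff_map]

theorem coeff_aSer {c : ℝ → Phase} (hc : SmoothCurveOn O c) (hU : ∀ t ∈ O, c t ∈ nonsingular)
    (n : ℕ) (t : ℝ) : coeff n (RiemannHydro.aSer (c t)) = CurvRing.ev t (coeff n (aSer hc hU)) := by
  rw [← map_ev_aSer hc hU, coeff_map]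

end Curv

/-- The resolvent computed over the ring of curves has smooth curves as coefficients by
construction, and evaluation returns the pointwise series. -/
theorem smoothMapOn_gammaGrad (n : ℕ) : SmoothMapOn nonsingular (gammaGrad n) := by
  refine smoothMapOn_of_opens fun O c hc hU => ?_
  refine SmoothCurveOn.congr (smoothCurveOn_mk (CurvRing.dxHom (coeff n (Curv.aSer hc hU)))
    (CurvRing.dxHom (coeff n (Curv.bSer hc hU)))) fun t _ => ?_
  rw [gammaGrad, Curv.coeff_aSer hc hU, Curv.coeff_bSer hc hU]
  rfl

/-- The first variation of `1 / b` along a smooth curve in the nonsingular phase space. -/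
theorem exists_variation_gamma {c : ℝ → Phase} (hc : SmoothCurveOn O c)
    (hU : ∀ t, c t ∈ nonsingular) :
    ∃ ρ W : (CurvRing O)⟦X⟧, Curv.bSer hc (fun t _ => hU t) * ρ = 1 ∧
      coeffMap CurvRing.dtHom ρ -
        (coeffMap CurvRing.dxHom (Curv.aSer hc fun t _ => hU t) *
            C (CurvRing.dtHom (CurvRing.of (Curv.fst hc))) +
          coeffMap CurvRing.dxHom (Curv.bSer hc fun t _ => hU t) *
            C (CurvRing.dtHom (CurvRing.of (Curv.snd hc)))) = coeffMap CurvRing.dxHom W := by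
  have hU' : ∀ t ∈ O, c t ∈ nonsingular := fun t _ => hU t
  set u := CurvRing.of (Curv.fst hc) with hu
  set v := CurvRing.of (Curv.snd hc) with hv
  set b := Curv.bSer hc hU' with hb
  have h1 : Curv.disc hc * Curv.rsqrtDisc hc hU' * Curv.rsqrtDisc hc hU' = 1 :=
    CurvRing.ext fun t => disc_mul_rsqrtDisc (hU t)
  have hinv : b * Ring.inverse b = 1 := Ring.mul_inverse_cancel _ (isUnit_resolvent h1)
  have hD := (CurvRing.isLeibniz_dxHom (O := O)).coeffMap
  have hδ := (CurvRing.isLeibniz_dtHom (O := O)).coeffMap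
  have hcomm : ∀ f : (CurvRing O)⟦X⟧, coeffMap CurvRing.dtHom (coeffMap CurvRing.dxHom f) =
      coeffMap CurvRing.dxHom (coeffMap CurvRing.dtHom f) := fun f => by
    ext1 k; simp only [coeff_coeffMap, CurvRing.dtHom_dxHom]
  have hvar := resolvent_variation hD hδ hcomm (coeffMap_X_pow_mul _ 2) (coeffMap_X_pow_mul _ 2)
    hinv (potential_mul_resolvent_sq (D := CurvRing.dxHom)
      (m := CurvRing.of (Curv.dx (Curv.dx (Curv.fst hc)))) h1 (two_mul_half_smul _))
  have hpot : potential (Curv.disc hc) (CurvRing.of (Curv.dx (Curv.dx (Curv.fst hc)))) =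
      C (CurvRing.dxHom u) * C (CurvRing.dxHom u) - C (CurvRing.dxHom v) - C (CurvRing.dxHom v) -
        X * C (CurvRing.dxHom (CurvRing.dxHom u)) - X * C (CurvRing.dxHom (CurvRing.dxHom u)) := by
    rw [potential, Curv.disc, map_sub, map_mul, map_mul, map_ofNat, hu, hv]
    simp only [CurvRing.dxHom_of]
    ring
  rw [hpot] at hvar
  set F : (CurvRing O)⟦X⟧ := X ^ 2 * (coeffMap CurvRing.dtHom b * coeffMap CurvRing.dxHom b *
    Ring.inverse b - coeffMap CurvRing.dxHom (coeffMap CurvRing.dtHom b))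
  change 2 * _ = b * _ + 2 * coeffMap CurvRing.dxHom F at hvar
  simp only [map_sub, coeffMap_C_mul CurvRing.isLeibniz_dtHom, coeffMap_X_mul, coeffMap_C,
    CurvRing.dtHom_dxHom] at hvar
  have h2 : ∀ f g : (CurvRing O)⟦X⟧, 2 * f = 2 * g → f = g := fun f g h => by
    have e : (2 : (CurvRing O)⟦X⟧) * C (algebraMap ℝ (CurvRing O) (1 / 2)) = 1 := by
      rw [← map_ofNat C 2, ← map_mul, ← map_ofNat (algebraMap ℝ (CurvRing O)) 2, ← map_mul]
      norm_num
    linear_combination C (algebraMap ℝ (CurvRing O) (1 / 2)) * h - (f - g) * e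
  -- W consists of F from the variation formula together with the boundary terms created by moving
  -- the x-derivatives of δu and δv in ½ b δQ onto the coefficients.
  refine ⟨Ring.inverse b, F + C (CurvRing.dxHom u) * (C (CurvRing.dtHom u) * b) -
    C (CurvRing.dtHom v) * b -
    X * (C (CurvRing.dxHom (CurvRing.dtHom u)) * b -
      C (CurvRing.dtHom u) * coeffMap CurvRing.dxHom b), hinv, h2 _ _ ?_⟩
  have ha : Curv.aSer hc hU' = -(C (CurvRing.dxHom u) * b) - X * coeffMap CurvRing.dxHom b := rfl
  rw [ha]
  simp only [map_sub, map_add, map_neg, coeffMap_C_mul CurvRing.isLeibniz_dxHom, coeffMap_X_mul]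
  linear_combination hvar

theorem hasGradOn_gammaFun (n : ℕ) : HasGradOn nonsingular (gammaFun n) (gammaGrad n) := by
  refine hasGradOn_of_density (smoothMapOn_gammaGrad n) fun O c hc hU => ?_
  have hU' : ∀ t ∈ O, c t ∈ nonsingular := fun t _ => hU t
  obtain ⟨ρ, W, hρ, hW⟩ := exists_variation_gamma hc hU
  refine ⟨coeff n ρ, fun t _ => ?_, fun t _ => ?_⟩
  · rw [gammaFun]
    congr 1
    change _ = CurvRing.ev t (coeff n ρ)
    rw [← coeff_map]
    congr 1
    have h1 := congrArg (PowerSeries.map (CurvRing.ev t)) hρ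
    rw [map_mul, map_one, Curv.map_ev_bSer hc hU'] at h1
    rw [← mul_one (Ring.inverse _), ← h1, ← mul_assoc,
      Ring.inverse_mul_cancel _ (IsUnit.of_mul_eq_one _ h1), one_mul]
  · refine perInt_eq_of_sub_eq_dx (h := CurvRing.ev t (coeff n W)) ?_
    have h1 := congrArg (fun f => CurvRing.ev t (coeff n f)) hW
    simp only [map_sub, map_add, coeff_coeffMap, coeff_mul_C, map_mul, CurvRing.ev_dxHom] at h1
    rw [gammaGrad, Curv.coeff_aSer hc hU', Curv.coeff_bSer hc hU']
    exact h1

/-! ### Involution -/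

theorem etaOp_skew {p : Phase} {e e' : Phase × Phase} (h : e ∈ etaOp p) (h' : e' ∈ etaOp p) :
    pairing (toFun e.1) (toFun e'.2) + pairing (toFun e'.1) (toFun e.2) = 0 := by
  obtain ⟨a, b, c, k⟩ := mem_etaOp_iff.1 h
  obtain ⟨a', b', c', k'⟩ := mem_etaOp_iff.1 h'
  exact k.skew k'

theorem pairing_comm (p q : Phase) : pairing (toFun p) (toFun q) = pairing (toFun q) (toFun p) := by
  simp only [pairing_toFun, mul_comm]

theorem pairing_zero (p : Phase) : pairing (toFun p) (toFun 0) = 0 := by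
  simp [pairing_toFun]

/-- The value of `ϑ` on a covector. -/
def thetaMap (ξ : Phase) : Phase := (-ξ.2, ξ.1)

theorem pairing_thetaMap (ξ ζ : Phase) :
    pairing (toFun ξ) (toFun (thetaMap ζ)) = -pairing (toFun ζ) (toFun (thetaMap ξ)) := by
  rw [pairing_toFun, pairing_toFun, ← map_neg]
  congr 1
  simp only [thetaMap]
  ring

/-- The Lenard–Magri argument: skew-symmetry of η and the recursion give (g_{m+1}, ϑ g_n) =
-(g_{n+1}, ϑ g_m), and skew-symmetry of ϑ turns this into (g_m, ϑ g_{n+1}). The first index descends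
to 0, where 0 is a value of η. -/
theorem pairing_gammaGrad_theta {p : Phase} (hp : p ∈ nonsingular) (m n : ℕ) :
    pairing (toFun (gammaGrad m p)) (toFun (thetaMap (gammaGrad n p))) = 0 := by
  induction m generalizing n with
  | zero =>
    have h := etaOp_skew (gammaGrad_zero_mem hp) (gammaGrad_succ_mem hp n)
    rw [pairing_zero, add_zero] at h
    exact h
  | succ m ih =>
    have h := etaOp_skew (gammaGrad_succ_mem hp m) (gammaGrad_succ_mem hp n)
    have h2 := ih (n + 1)
    rw [pairing_thetaMap, neg_eq_zero] at h2
    change _ + pairing _ (toFun (thetaMap _)) = 0 at h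
    rw [h2, add_zero] at h
    exact h

theorem pairing_gammaGrad_eta {p : Phase} (hp : p ∈ nonsingular) (m n : ℕ) {X : Phase}
    (hX : (gammaGrad n p, X) ∈ etaOp p) : pairing (toFun (gammaGrad m p)) (toFun X) = 0 := by
  cases m with
  | zero =>
    have h := etaOp_skew (gammaGrad_zero_mem hp) hX
    rw [pairing_zero, add_zero] at h
    exact h
  | succ m =>
    have h := etaOp_skew (gammaGrad_succ_mem hp m) hX
    have h2 := pairing_gammaGrad_theta hp n m
    change _ + pairing _ (toFun (thetaMap _)) = 0 at h
    rw [h2, add_zero] at h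
    exact h

/-- ϑ grad H_η is minus the translation field (u_x, v_x), obtained at the zero covector from the
integration constant b = -1. -/
theorem translation_mem_etaOp (p : Phase) : (0, thetaMap (-dx p.2, dx p.1)) ∈ etaOp p := by
  refine ⟨0, -1, 0, dx_zero, ?_, ?_, ?_⟩
  · rw [dx_neg, ← map_one (algebraMap ℝ Per), dx_algebraMap, neg_zero]; rfl
  · simp [dx_zero]
  · simp only [thetaMap]
    ext1 <;> simp only <;> ring

/-- One recursion step replaces η grad H_η by ϑ grad H_η, a value of η at 0, which is orthogonal to
every covector in the domain of η. -/
theorem pairing_gammaGrad_riemannField {p : Phase} (hp : p ∈ nonsingular) (n : ℕ) :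
    pairing (toFun (gammaGrad n p)) (toFun (riemannField p)) = 0 := by
  have hη : ((-dx p.2, dx p.1), -riemannField p) ∈ etaOp p := by
    refine ⟨-p.2, p.1, 0, dx_neg _, rfl, ?_, ?_⟩
    · rw [dx_zero]; ring
    · refine Prod.ext ?_ ?_ <;> simp [riemannField, mul_comm, sub_eq_neg_add]
  have hneg : pairing (toFun (gammaGrad n p)) (toFun (-riemannField p)) =
      -pairing (toFun (gammaGrad n p)) (toFun (riemannField p)) := by
    rw [pairing_toFun, pairing_toFun, ← map_neg]
    congr 1
    simp only [Prod.fst_neg, Prod.snd_neg]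
    ring
  cases n with
  | zero =>
    have h := etaOp_skew (gammaGrad_zero_mem hp) hη
    rw [pairing_zero, add_zero] at h
    simp only at h
    linarith
  | succ n =>
    have h := etaOp_skew (gammaGrad_succ_mem hp n) hη
    change _ + pairing (toFun (-dx p.2, dx p.1)) (toFun (thetaMap (gammaGrad n p))) = 0 at h
    rw [pairing_thetaMap] at h
    have h2 : pairing (toFun (gammaGrad n p)) (toFun (thetaMap (-dx p.2, dx p.1))) = 0 := by
      cases n with
      | zero =>
        have h3 := etaOp_skew (gammaGrad_zero_mem hp) (translation_mem_etaOp p)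
        rw [pairing_zero, add_zero] at h3
        exact h3
      | succ n =>
        have h3 := etaOp_skew (gammaGrad_succ_mem hp n) (translation_mem_etaOp p)
        rw [pairing_comm (0, thetaMap (-dx p.2, dx p.1)).1, pairing_zero, add_zero] at h3
        exact h3
    rw [h2, neg_zero, add_zero] at h
    simp only at h
    linarith

end RiemannHydro
end

noncomputable section

namespace RiemannHydro

/-! ### Leading harmonics -/

/-- `f` is a trigonometric polynomial of degree at most `n` whose coefficient of `e^{inx}`
is `z`. -/
def HasTop (n : ℕ) (z : ℂ) (f : Per) : Prop :=
  ∃ p : Polynomial ℂ, p.natDegree ≤ 2 * n ∧ p.coeff (2 * n) = z ∧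
    ∀ x : ℝ, (f.1 x : ℂ) * Complex.exp (x * Complex.I) ^ n = p.eval (Complex.exp (x * Complex.I))

namespace HasTop

theorem zero (n : ℕ) : HasTop n 0 0 :=
  ⟨0, by simp, by simp, fun x => by simp [show (0 : Per).1 x = 0 from rfl]⟩

theorem add {n : ℕ} {z w : ℂ} {f g : Per} (hf : HasTop n z f) (hg : HasTop n w g) :
    HasTop n (z + w) (f + g) := by
  obtain ⟨p, hp, rfl, hp'⟩ := hf
  obtain ⟨q, hq, rfl, hq'⟩ := hg
  refine ⟨p + q, (Polynomial.natDegree_add_le _ _).trans (max_le hp hq), by simp, fun x => ?_⟩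
  rw [Polynomial.eval_add, ← hp', ← hq', show (f + g).1 x = f.1 x + g.1 x from rfl]
  push_cast
  ring

theorem mul {n k : ℕ} {z w : ℂ} {f g : Per} (hf : HasTop n z f) (hg : HasTop k w g) :
    HasTop (n + k) (z * w) (f * g) := by
  obtain ⟨p, hp, rfl, hp'⟩ := hf
  obtain ⟨q, hq, rfl, hq'⟩ := hg
  refine ⟨p * q, Polynomial.natDegree_mul_le.trans (by omega), ?_, fun x => ?_⟩
  · rw [mul_add, Polynomial.coeff_mul_add_eq_of_natDegree_le hp hq]
  · rw [Polynomial.eval_mul, ← hp', ← hq', show (f * g).1 x = f.1 x * g.1 x from rfl, pow_add]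
    push_cast
    ring

theorem const (r : ℝ) : HasTop 0 r (algebraMap ℝ Per r) :=
  ⟨Polynomial.C (r : ℂ), by simp, by simp, fun x => by
    simp [show (algebraMap ℝ Per r).1 x = r from rfl]⟩

theorem smul {n : ℕ} {z : ℂ} {f : Per} (r : ℝ) (hf : HasTop n z f) : HasTop n (r * z) (r • f) := by
  have := (const r).mul hf
  rwa [zero_add, ← Algebra.smul_def] at this

theorem neg {n : ℕ} {z : ℂ} {f : Per} (hf : HasTop n z f) : HasTop n (-z) (-f) := by
  have := hf.smul (-1)
  simpa using this

theorem sub {n : ℕ} {z w : ℂ} {f g : Per} (hf : HasTop n z f) (hg : HasTop n w g) :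
    HasTop n (z - w) (f - g) := by
  rw [sub_eq_add_neg, sub_eq_add_neg]; exact hf.add hg.neg

theorem succ {n : ℕ} {z : ℂ} {f : Per} (hf : HasTop n z f) : HasTop (n + 1) 0 f := by
  obtain ⟨p, hp, rfl, hp'⟩ := hf
  refine ⟨Polynomial.X * p, ?_, ?_, fun x => ?_⟩
  · have := Polynomial.natDegree_mul_le (p := (Polynomial.X : Polynomial ℂ)) (q := p)
    rw [Polynomial.natDegree_X] at this
    omega
  · rw [show 2 * (n + 1) = (2 * n + 1) + 1 by ring, Polynomial.coeff_X_mul]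
    exact Polynomial.coeff_eq_zero_of_natDegree_lt (by omega)
  · rw [Polynomial.eval_mul, ← hp', Polynomial.eval_X, pow_succ]
    ring

theorem dx {n : ℕ} {z : ℂ} {f : Per} (hf : HasTop n z f) :
    HasTop n (Complex.I * n * z) (dx f) := by
  obtain ⟨p, hp, rfl, hp'⟩ := hf
  refine ⟨Polynomial.C Complex.I * (Polynomial.X * Polynomial.derivative p) -
    Polynomial.C (Complex.I * n) * p, ?_, ?_, fun x => ?_⟩
  · refine (Polynomial.natDegree_sub_le _ _).trans (max_le ?_
      ((Polynomial.natDegree_C_mul_le _ _).trans hp))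
    refine (Polynomial.natDegree_C_mul_le _ _).trans ?_
    rw [Polynomial.natDegree_le_iff_coeff_eq_zero]
    intro N hN
    obtain ⟨N, rfl⟩ : ∃ k, N = k + 1 := ⟨N - 1, by omega⟩
    rw [Polynomial.coeff_X_mul, Polynomial.coeff_derivative,
      Polynomial.coeff_eq_zero_of_natDegree_lt (by omega), zero_mul]
  · rw [Polynomial.coeff_sub, Polynomial.coeff_C_mul, Polynomial.coeff_C_mul]
    have h : (Polynomial.X * Polynomial.derivative p).coeff (2 * n) = 2 * n * p.coeff (2 * n) := by
      cases n with
      | zero => simp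
      | succ n =>
        rw [show 2 * (n + 1) = (2 * n + 1) + 1 by ring, Polynomial.coeff_X_mul,
          Polynomial.coeff_derivative]
        push_cast
        ring
    rw [h]; ring
  · set E : ℝ → ℂ := fun x => Complex.exp (x * Complex.I) with hE
    have hEd : HasDerivAt E (E x * Complex.I) x := by
      have h1 : HasDerivAt (fun x : ℝ => (x : ℂ) * Complex.I) Complex.I x := by
        simpa using (Complex.ofRealCLM.hasDerivAt (x := x)).mul_const Complex.I
      exact h1.cexp
    have hfd : HasDerivAt (fun y => (f.1 y : ℂ)) ((RiemannHydro.dx f).1 x : ℂ) x :=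
      (Per.hasDerivAt f x).ofReal_comp
    have h1 := hfd.mul (hEd.pow n)
    have h2 : HasDerivAt (fun y => p.eval (E y)) (p.derivative.eval (E x) * (E x * Complex.I)) x :=
      (p.hasDerivAt (E x)).comp x hEd
    have h3 : (fun y => (f.1 y : ℂ)) * (E ^ n) = fun y => p.eval (E y) := funext fun y => hp' y
    rw [h3] at h1
    have h4 := h1.unique h2
    have h5 : (n : ℂ) * E x ^ (n - 1) * (E x * Complex.I) = n * Complex.I * E x ^ n := by
      cases n with
      | zero => simp
      | succ n => simp only [Nat.add_sub_cancel, pow_succ]; ring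
    have h6 := hp' x
    change _ * E x ^ n = Polynomial.eval (E x) _
    change _ * E x ^ n = Polynomial.eval (E x) _ at h6
    rw [Polynomial.eval_sub, Polynomial.eval_mul, Polynomial.eval_mul, Polynomial.eval_mul,
      Polynomial.eval_C, Polynomial.eval_C, Polynomial.eval_X, ← h6]
    rw [h5] at h4
    simp only [Pi.pow_apply] at h4
    linear_combination h4

/-- Uniqueness of the leading harmonic: the polynomial vanishes on the unit circle, hence
identically. -/
theorem eq_zero {n : ℕ} {z : ℂ} (h : HasTop n z 0) : z = 0 := by
  obtain ⟨p, -, rfl, hp⟩ := h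
  have hinf : Set.Infinite {y | p.IsRoot y} := by
    have hinj : Set.InjOn (fun x : ℝ => Complex.exp (x * Complex.I)) (Set.Ioc (-Real.pi) Real.pi) := by
      intro x hx y hy hxy
      have h1 := Complex.exp_inj_of_neg_pi_lt_of_le_pi (by simpa using hx.1) (by simpa using hx.2)
        (by simpa using hy.1) (by simpa using hy.2) hxy
      exact_mod_cast mul_right_cancel₀ Complex.I_ne_zero h1
    refine (((Set.Ioc_infinite (by linarith [Real.pi_pos])).image hinj)).mono ?_
    rintro _ ⟨x, -, rfl⟩
    have := hp x
    rw [show (0 : Per).1 x = 0 from rfl] at this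
    simpa [Polynomial.IsRoot] using this.symm
  rw [Polynomial.eq_zero_of_infinite_isRoot p hinf, Polynomial.coeff_zero]

end HasTop

/-- Functions with leading harmonics of increasing degrees are linearly independent. -/
theorem linearIndependent_of_hasTop {f : ℕ → Per} {z : ℕ → ℂ} (h : ∀ n, HasTop (n + 1) (z n) (f n))
    (hz : ∀ n, z n ≠ 0) : LinearIndependent ℝ f := by
  have hdeg : ∀ (c : ℕ → ℝ) (N : ℕ), ∃ w, HasTop N w (∑ i ∈ Finset.range N, c i • f i) := by
    intro c N
    induction N with
    | zero => exact ⟨0, by simpa using HasTop.zero 0⟩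
    | succ N ih =>
      obtain ⟨w, hw⟩ := ih
      rw [Finset.sum_range_succ]
      exact ⟨_, hw.succ.add ((h N).smul (c N))⟩
  have key : ∀ (c : ℕ → ℝ) (N : ℕ), ∑ i ∈ Finset.range N, c i • f i = 0 → ∀ i < N, c i = 0 := by
    intro c N
    induction N with
    | zero => intro _ i hi; omega
    | succ N ih =>
      intro hsum i hi
      obtain ⟨w, hw⟩ := hdeg c N
      rw [Finset.sum_range_succ] at hsum
      have h1 := hw.succ.add ((h N).smul (c N))
      rw [hsum, zero_add] at h1
      have hc : c N = 0 := by simpa [hz N] using h1.eq_zero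
      rw [hc, zero_smul, add_zero] at hsum
      rcases Nat.lt_succ_iff_lt_or_eq.1 hi with hi | rfl
      · exact ih hsum i hi
      · exact hc
  rw [linearIndependent_iff]
  intro l hl
  rw [Finsupp.linearCombination_apply, Finsupp.sum_of_support_subset l
    (s := Finset.range (l.support.sup id + 1)) (fun i hi => Finset.mem_range.2
      (Nat.lt_succ_of_le (Finset.le_sup (f := id) hi))) _ (by simp)] at hl
  ext i
  by_cases hi : i ∈ l.support
  · exact key l _ hl i (Nat.lt_succ_of_le (Finset.le_sup (f := id) hi))
  · exact Finsupp.notMem_support_iff.1 hi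

/-! ### Leading harmonics of power series coefficients -/

open PowerSeries

/-- The `n`-th coefficient of `f` has leading harmonic of degree `n` given by that of `Z`. -/
def SerTop (f : Per⟦X⟧) (Z : ℂ⟦X⟧) : Prop := ∀ n, HasTop n (coeff n Z) (coeff n f)

namespace SerTop

variable {f g : Per⟦X⟧} {Z W : ℂ⟦X⟧}

theorem add (hf : SerTop f Z) (hg : SerTop g W) : SerTop (f + g) (Z + W) := fun n => by
  rw [map_add, map_add]; exact (hf n).add (hg n)

theorem sub (hf : SerTop f Z) (hg : SerTop g W) : SerTop (f - g) (Z - W) := fun n => by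
  rw [map_sub, map_sub]; exact (hf n).sub (hg n)

theorem mul (hf : SerTop f Z) (hg : SerTop g W) : SerTop (f * g) (Z * W) := fun n => by
  have hsum : ∀ (s : Finset (ℕ × ℕ)), (∀ i ∈ s, i.1 + i.2 = n) →
      HasTop n (∑ i ∈ s, coeff i.1 Z * coeff i.2 W) (∑ i ∈ s, coeff i.1 f * coeff i.2 g) := by
    intro s
    induction s using Finset.induction_on with
    | empty => intro _; simpa using HasTop.zero n
    | insert i s hi ih =>
      intro h
      rw [Finset.sum_insert hi, Finset.sum_insert hi]
      refine HasTop.add ?_ (ih fun j hj => h j (Finset.mem_insert_of_mem hj))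
      have := (hf i.1).mul (hg i.2)
      rwa [h i (Finset.mem_insert_self _ _)] at this
  rw [coeff_mul, coeff_mul]
  exact hsum _ fun i hi => Finset.HasAntidiagonal.mem_antidiagonal.1 hi

theorem C {a : Per} {z : ℂ} (h : HasTop 0 z a) : SerTop (C a) (C z) := fun n => by
  cases n with
  | zero => simpa using h
  | succ n => simpa [coeff_C] using HasTop.zero (n + 1)

theorem X_mul_C {a : Per} {z : ℂ} (h : HasTop 1 z a) :
    SerTop (X * PowerSeries.C a) (X * PowerSeries.C z) := fun n => by
  rcases n with _ | _ | n
  · simpa using HasTop.zero 0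
  · simpa [coeff_succ_X_mul] using h
  · simpa [coeff_succ_X_mul, coeff_C, coeff_X] using HasTop.zero (n + 1 + 1)

theorem one : SerTop 1 1 := by
  have := C (HasTop.const 1)
  simpa using this

theorem two : SerTop 2 2 := by
  rw [← one_add_one_eq_two, ← one_add_one_eq_two]; exact one.add one

/-- The factor λ² raises the permitted degree by two without raising the actual one, so the
derivative terms of the resolvent equation do not affect leading harmonics. -/
theorem X_sq_mul (hf : SerTop f Z) : SerTop (X ^ 2 * f) 0 := fun n => by
  rcases n with _ | _ | n
  · simpa using HasTop.zero 0
  · simpa [pow_two, mul_assoc, coeff_succ_X_mul] using HasTop.zero 1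
  · simpa [pow_two, mul_assoc, coeff_succ_X_mul] using (hf n).succ.succ

theorem exists_coeffMap (hf : SerTop f Z) : ∃ W, SerTop (coeffMap dxHom f) W :=
  ⟨PowerSeries.mk fun n => Complex.I * n * coeff n Z, fun n => by
    rw [coeff_mk, coeff_coeffMap, dxHom_apply]; exact (hf n).dx⟩

/-- Passing to leading harmonics amounts to replacing D by 0, which leaves the algebraic equation
(w' - 2λm') Z² = 1 when w' r'² = 1 and 2k' = r'. -/
theorem resolvent {w m r k : Per} {w' m' r' k' : ℂ} (hw : HasTop 0 w' w) (hm : HasTop 1 m' m)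
    (hr : HasTop 0 r' r) (hk : HasTop 0 k' k) :
    SerTop (resolvent dxHom w m r k) (RiemannHydro.resolvent 0 w' m' r' k') := by
  have happ : ∀ n, SerTop (resolventApprox dxHom w m r k n) (resolventApprox 0 w' m' r' k' n) := by
    intro n
    induction n with
    | zero => exact C hr
    | succ n ih =>
      obtain ⟨W, hW⟩ := ih.exists_coeffMap
      obtain ⟨W', hW'⟩ := hW.exists_coeffMap
      have hpot : SerTop (potential w m) (potential w' m') := by
        rw [potential, potential, mul_assoc, mul_assoc]
        exact (C hw).sub (two.mul (X_mul_C hm))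
      have hdef : defect 0 w' m' (resolventApprox 0 w' m' r' k' n) =
          potential w' m' * (resolventApprox 0 w' m' r' k' n *
            resolventApprox 0 w' m' r' k' n) - 1 - 0 := by
        have h0 : ∀ g : ℂ⟦X⟧, coeffMap (0 : ℂ →+ ℂ) g = 0 := fun g => by ext; simp
        rw [defect, h0, h0]; ring
      have hdef' : defect dxHom w m (resolventApprox dxHom w m r k n) =
          potential w m * (resolventApprox dxHom w m r k n * resolventApprox dxHom w m r k n) - 1 -
            X ^ 2 * (2 * resolventApprox dxHom w m r k n *
              coeffMap dxHom (coeffMap dxHom (resolventApprox dxHom w m r k n)) -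
              coeffMap dxHom (resolventApprox dxHom w m r k n) *
              coeffMap dxHom (resolventApprox dxHom w m r k n)) := by
        rw [defect]; ring
      rw [resolventApprox, resolventApprox, hdef, hdef']
      exact ih.sub ((C hk).mul (((hpot.mul (ih.mul ih)).sub one).sub
        (X_sq_mul (((two.mul ih).mul hW').sub (hW.mul hW)))))
  intro n
  simp only [RiemannHydro.resolvent, coeff_mk]
  exact happ n n

end SerTop

/-- The coefficients of `(1 - 2 μ λ)^{-1/2}` do not vanish. -/
theorem coeff_resolvent_zero_ne_zero {μ : ℂ} (hμ : μ ≠ 0) (n : ℕ) :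
    coeff n (resolvent 0 1 μ 1 (1 / 2)) ≠ 0 := by
  set Z := resolvent (0 : ℂ →+ ℂ) 1 μ 1 (1 / 2) with hZ
  have h0 : ∀ g : ℂ⟦X⟧, coeffMap (0 : ℂ →+ ℂ) g = 0 := fun g => by ext; simp
  have h1 : (1 - 2 * X * C μ) * Z ^ 2 = 1 := by
    have := potential_mul_resolvent_sq (D := (0 : ℂ →+ ℂ)) (w := 1) (m := μ) (r := 1) (k := 1 / 2)
      (by norm_num) (by norm_num)
    rw [h0, h0, potential, map_one] at this
    rw [hZ, this]; ring
  -- The differential equation of (1 - 2μλ)^{-1/2}, obtained by differentiating `h1`.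
  have h2 : (1 - 2 * X * C μ) * derivative ℂ Z = C μ * Z := by
    have h3 := congrArg (derivative ℂ) h1
    have h4 : derivative ℂ (1 - 2 * X * C μ : ℂ⟦X⟧) = -(2 * C μ) := by
      rw [map_sub, Derivation.leibniz, Derivation.leibniz, derivative_C, derivative_X,
        ← map_ofNat C 2, derivative_C]
      simp [mul_comm]
    rw [Derivation.leibniz, Derivation.leibniz_pow, h4, Derivation.map_one_eq_zero] at h3
    simp only [smul_eq_mul, nsmul_eq_mul, pow_one, Nat.cast_ofNat, Nat.add_one_sub_one] at h3
    have h5 : (2 : ℂ⟦X⟧) * C (1 / 2) = 1 := by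
      rw [← map_ofNat C 2, ← map_mul]; norm_num
    linear_combination C (1 / 2) * (1 - 2 * X * C μ) * Z * h3 -
      ((1 - 2 * X * C μ) * derivative ℂ Z - C μ * Z) * h1 -
      ((1 - 2 * X * C μ) * derivative ℂ Z - C μ * Z) * ((1 - 2 * X * C μ) * Z ^ 2) * (h5)
  induction n with
  | zero =>
    rw [coeff_zero_eq_constantCoeff_apply, hZ, constantCoeff_resolvent]
    exact one_ne_zero
  | succ n ih =>
    have h3 := congrArg (coeff n) h2
    have h4 : (1 - 2 * X * C μ) * derivative ℂ Z = derivative ℂ Z - C (2 * μ) * (X * derivative ℂ Z) := by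
      rw [map_mul, map_ofNat]; ring
    have h5 : coeff n (X * derivative ℂ Z) = n * coeff n Z := by
      cases n with
      | zero => simp
      | succ n => rw [coeff_succ_X_mul, coeff_derivative]; push_cast; ring
    rw [h4, map_sub, coeff_C_mul, coeff_C_mul, h5, coeff_derivative] at h3
    -- A two-term recursion with nonzero factor μ(2n + 1), so no coefficient can vanish.
    have h6 : coeff (n + 1) Z * (n + 1) = μ * (2 * n + 1) * coeff n Z := by linear_combination h3
    intro h7
    rw [h7, zero_mul] at h6
    have h8 : (2 * (n : ℂ) + 1) ≠ 0 := by exact_mod_cast Nat.succ_ne_zero (2 * n)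
    exact mul_ne_zero (mul_ne_zero hμ h8) ih h6.symm

/-! ### A point with independent gradients -/

/-- The point `(√2 sin x, sin 2x / 4)`, at which `u_x² - 2 v_x = 1`. -/
def basePoint : Phase :=
  (⟨fun x => √2 * Real.sin x, by fun_prop, fun x => by simp only [Real.sin_add_two_pi]⟩,
   ⟨fun x => Real.sin (2 * x) / 4, by fun_prop, fun x => by
      simp only
      rw [show 2 * (x + 2 * Real.pi) = 2 * x + 2 * Real.pi + 2 * Real.pi by ring,
        Real.sin_add_two_pi, Real.sin_add_two_pi]⟩)

theorem disc_basePoint : disc basePoint = 1 := by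
  refine Subtype.ext <| funext fun x => ?_
  rw [disc_apply]
  have h1 : (dx basePoint.1).1 x = √2 * Real.cos x :=
    ((Real.hasDerivAt_sin x).const_mul √2).deriv
  have h2 : (dx basePoint.2).1 x = Real.cos (2 * x) / 2 := by
    have := (((hasDerivAt_id x).const_mul 2).sin.div_const 4).deriv
    refine this.trans ?_
    simp only [id]; ring
  rw [h1, h2, Real.cos_two_mul, mul_pow, Real.sq_sqrt (by norm_num)]
  change _ = (1 : ℝ)
  ring

theorem basePoint_mem : basePoint ∈ nonsingular := fun x => by
  rw [← disc_apply, disc_basePoint]; exact one_ne_zero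

theorem rsqrtDisc_basePoint : rsqrtDisc basePoint = 1 := by
  refine Subtype.ext <| funext fun x => ?_
  rw [rsqrtDisc_apply basePoint_mem, disc_basePoint, show (1 : Per).1 x = 1 from rfl]
  simp

theorem hasTop_basePoint : HasTop 1 (√2 / (2 * Complex.I)) basePoint.1 := by
  refine ⟨Polynomial.C (√2 / (2 * Complex.I) : ℂ) * (Polynomial.X ^ 2 - 1), ?_, ?_, fun x => ?_⟩
  · refine (Polynomial.natDegree_C_mul_le _ _).trans ?_
    exact (Polynomial.natDegree_sub_le _ _).trans (by simp)
  · simp [Polynomial.coeff_one]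
  · change ((√2 * Real.sin x : ℝ) : ℂ) * _ = _
    have h := Complex.exp_ne_zero ((x : ℂ) * Complex.I)
    simp only [Polynomial.eval_mul, Polynomial.eval_C, Polynomial.eval_sub, Polynomial.eval_pow,
      Polynomial.eval_X, Polynomial.eval_one]
    push_cast
    rw [Complex.sin, neg_mul, Complex.exp_neg]
    field_simp
    linear_combination (1 - Complex.exp (x * Complex.I) ^ 2) * Complex.I_sq

/-- At this point w = 1, so only u_xx contributes to the leading harmonics of b. The factor u_x in a
raises the degree to n + 1, which is positive, so the leading harmonic survives the derivative in
a_x; the first components alone are then independent. -/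
theorem linearIndependent_gammaGrad : LinearIndependent ℝ fun n => gammaGrad n basePoint := by
  set α : ℂ := √2 / (2 * Complex.I) with hα
  have hα0 : α ≠ 0 := by
    rw [hα]
    have : (√2 : ℂ) ≠ 0 := by
      exact_mod_cast (Real.sqrt_pos.2 (by norm_num : (0 : ℝ) < 2)).ne'
    exact div_ne_zero this (mul_ne_zero two_ne_zero Complex.I_ne_zero)
  have hu := hasTop_basePoint
  have hux := hu.dx
  have huxx := hux.dx
  simp only [Nat.cast_one, mul_one] at hux huxx
  set μ : ℂ := Complex.I * (Complex.I * (√2 / (2 * Complex.I))) with hμ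
  have hμ0 : μ ≠ 0 := mul_ne_zero Complex.I_ne_zero (mul_ne_zero Complex.I_ne_zero hα0)
  have h1 : HasTop 0 1 (1 : Per) := by simpa using HasTop.const 1
  have hb : SerTop (bSer basePoint) (resolvent 0 1 μ 1 (1 / 2)) := by
    have := SerTop.resolvent h1 huxx h1 (h1.smul (1 / 2))
    rw [bSer, disc_basePoint, rsqrtDisc_basePoint]
    convert this using 2
    push_cast
    ring
  have ha : ∀ n, HasTop (n + 1) (-(Complex.I * α * coeff n (resolvent 0 1 μ 1 (1 / 2))))
      (coeff n (aSer basePoint)) := by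
    intro n
    have h2 := (hux.mul (hb n)).neg
    rw [add_comm 1 n] at h2
    have h3 : HasTop (n + 1) 0 (coeff n (X * coeffMap dxHom (bSer basePoint))) := by
      cases n with
      | zero => simpa using HasTop.zero 1
      | succ n =>
        rw [coeff_succ_X_mul, coeff_coeffMap, dxHom_apply]
        exact (hb n).dx.succ.succ
    have h4 := h2.sub h3
    rw [sub_zero] at h4
    rw [aSer, map_sub, map_neg, coeff_C_mul]
    exact h4
  refine LinearIndependent.of_comp (LinearMap.fst ℝ Per Per) ?_
  refine linearIndependent_of_hasTop (fun n => (ha n).dx) fun n => ?_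
  refine mul_ne_zero (mul_ne_zero Complex.I_ne_zero (by exact_mod_cast Nat.succ_ne_zero n)) ?_
  exact neg_ne_zero.2 (mul_ne_zero (mul_ne_zero Complex.I_ne_zero hα0)
    (coeff_resolvent_zero_ne_zero hμ0 n))

theorem isCompletelyIntegrableOn_riemannField :
    IsCompletelyIntegrableOn nonsingular thetaOp etaOp riemannField :=
  ⟨gammaFun, gammaGrad, hasGradOn_gammaFun, fun n _ hp => pairing_gammaGrad_riemannField hp n,
    fun n p hp => ⟨thetaMap (gammaGrad n p), rfl, gammaGrad_succ_mem hp n⟩,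
    fun n _ hp => ⟨_, mem_etaOp_iff.2 ⟨_, _, _, pencilElt_gammaGrad hp n⟩⟩,
    fun m n _ hp X hX => by
      rw [show X = thetaMap (gammaGrad n _) from hX]
      exact pairing_gammaGrad_theta hp m n,
    fun m n _ hp _ hX => pairing_gammaGrad_eta hp m n hX,
    ⟨basePoint, basePoint_mem, linearIndependent_gammaGrad⟩⟩

end RiemannHydro
end

noncomputable section

namespace RiemannHydro

open TopologicalSpace

variable {O : Opens ℝ}

/-! ### The second order equation -/

theorem materialDeriv_eq (u f : Curv O) {F : ℝ → ℝ → ℝ} (hF : ∀ t ∈ O, ∀ x, F t x = (f.1 t).1 x)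
    {t : ℝ} (ht : t ∈ O) (x : ℝ) :
    materialDeriv (fun s y => (u.1 s).1 y) F t x = ((Curv.dt f + u * Curv.dx f).1 t).1 x := by
  have h1 : deriv (fun s => F s x) t = ((Curv.dt f).1 t).1 x := by
    refine ((Curv.hasDerivAt_dt f ht x).congr_of_eventuallyEq ?_).deriv
    filter_upwards [O.isOpen.mem_nhds ht] with s hs
    exact hF s hs x
  have h2 : (fun y => F t y) = (f.1 t).1 := funext (hF t ht)
  rw [materialDeriv, h1, h2]
  rfl

theorem materialDeriv_sq_eq_zero_iff {J : Set ℝ} {u : ℝ → Per} (hJ : IsOpen J)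
    (hu : SmoothCurveOn J (fun t => (u t, 0))) :
    (∀ t ∈ J, ∀ x : ℝ, materialDeriv (fun s y => (u s).1 y)
        (materialDeriv (fun s y => (u s).1 y) (fun s y => (u s).1 y)) t x = 0) ↔
      ∃ v : ℝ → Per, IsSolutionOn riemannField J (fun t => (u t, v t)) := by
  set O : Opens ℝ := ⟨J, hJ⟩
  set U : Curv O := Curv.fst (O := O) hu
  constructor
  · intro h
    set V : Curv O := Curv.dt U + U * Curv.dx U with hV
    have hc : SmoothCurveOn O (fun t => (U.1 t, V.1 t)) := smoothCurveOn_mk U V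
    refine ⟨V.1, hc, fun t ht x => ?_⟩
    have h1 : ∀ x, ((Curv.dt V + U * Curv.dx V).1 t).1 x = 0 := fun x => by
      rw [← materialDeriv_eq U V (fun s hs y => materialDeriv_eq U U (fun _ _ _ => rfl) hs y) ht]
      exact h t ht x
    have h2 : (Curv.dt V).1 t = -(u t * dx (V.1 t)) :=
      eq_neg_of_add_eq_zero_left (Subtype.ext (funext h1))
    have h3 : (Curv.dt U).1 t = V.1 t - u t * dx (u t) := eq_sub_of_add_eq rfl
    have h4 := Curv.velocity_eq hc (t := t) ht
    rw [show Curv.fst hc = U from rfl, show Curv.snd hc = V from rfl, h2, h3] at h4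
    exact congrFun h4 x
  · rintro ⟨v, hc, hv⟩ t ht x
    set V : Curv O := Curv.snd (O := O) hc
    have h1 : ∀ s ∈ O, toFun ((Curv.dt U).1 s, (Curv.dt V).1 s) =
        toFun (riemannField (u s, v s)) := fun s hs =>
      (Curv.velocity_eq (O := O) hc hs).symm.trans (funext (hv s hs))
    have h2 : ∀ s ∈ O, ∀ y, materialDeriv (fun s y => (u s).1 y) (fun s y => (u s).1 y) s y =
        (V.1 s).1 y := fun s hs y => by
      refine (materialDeriv_eq U U (fun _ _ _ => rfl) hs y).trans ?_
      have h3 : ((Curv.dt U).1 s).1 y = (v s).1 y - (u s).1 y * (dx (u s)).1 y :=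
        congrArg Prod.fst (congrFun (h1 s hs) y)
      change ((Curv.dt U).1 s).1 y + (u s).1 y * (dx (u s)).1 y = (v s).1 y
      rw [h3]; ring
    refine (materialDeriv_eq U V h2 ht x).trans ?_
    have h3 : ((Curv.dt V).1 t).1 x = -((u t).1 x * (dx (v t)).1 x) :=
      congrArg Prod.snd (congrFun (h1 t ht) x)
    change ((Curv.dt V).1 t).1 x + (u t).1 x * (dx (v t)).1 x = 0
    rw [h3]; ring

/-! ### The zero curvature equation -/

/-- The lower left entry vanishes identically, the diagonal entries are ∓z times the first
expression and the upper right entry is minus the second. The condition z ≠ 0 recovers the first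
from the diagonal. -/
theorem zeroCurvature_iff {z : ℂ} (hz : z ≠ 0) {J : Set ℝ} {c : ℝ → Phase} (hJ : IsOpen J)
    (hc : SmoothCurveOn J c) :
    ZeroCurvature z J c ↔ ∀ t ∈ J, ∀ x : ℝ,
      deriv (fun y => (velocity c t y - toFun (riemannField (c t)) y).1) x = 0 ∧
      deriv (fun y => (velocity c t y - toFun (riemannField (c t)) y).2) x = 0 := by
  set O : Opens ℝ := ⟨J, hJ⟩
  set U : Curv O := Curv.fst (O := O) hc
  set V : Curv O := Curv.snd (O := O) hc
  have key : ∀ t ∈ J, ∀ x : ℝ,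
      ((∀ i j : Fin 2, deriv (fun s => laxL z (c s) x i j) t - deriv (fun y => laxP z (c t) y i j) x
        + (laxL z (c t) x * laxP z (c t) x - laxP z (c t) x * laxL z (c t) x) i j = 0) ↔
      (deriv (fun y => (velocity c t y - toFun (riemannField (c t)) y).1) x = 0 ∧
      deriv (fun y => (velocity c t y - toFun (riemannField (c t)) y).2) x = 0)) := by
    intro t ht x
    set A := (Curv.dt U).1 t
    set B := (Curv.dt V).1 t
    have hvel : velocity c t = toFun (A, B) := Curv.velocity_eq (O := O) hc ht
    have d1 : deriv (fun y => (velocity c t y - toFun (riemannField (c t)) y).1) x =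
        (dx A).1 x - ((dx (c t).2).1 x - ((dx (c t).1).1 x * (dx (c t).1).1 x +
          (c t).1.1 x * (dx (dx (c t).1)).1 x)) := by
      rw [hvel]
      exact ((Per.hasDerivAt A x).sub ((Per.hasDerivAt (c t).2 x).sub
        ((Per.hasDerivAt (c t).1 x).mul (Per.hasDerivAt (dx (c t).1) x)))).deriv
    have d2 : deriv (fun y => (velocity c t y - toFun (riemannField (c t)) y).2) x =
        (dx B).1 x - -((dx (c t).1).1 x * (dx (c t).2).1 x +
          (c t).1.1 x * (dx (dx (c t).2)).1 x) := by
      rw [hvel]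
      exact ((Per.hasDerivAt B x).sub
        ((Per.hasDerivAt (c t).1 x).mul (Per.hasDerivAt (dx (c t).2) x)).neg).deriv
    have hU : HasDerivAt (fun s => ((dx (c s).1).1 x : ℂ)) ((dx A).1 x : ℂ) t := by
      have := (Curv.hasDerivAt_dt (Curv.dx U) (t := t) ht x).ofReal_comp
      rwa [Curv.dt_dx_apply] at this
    have hV : HasDerivAt (fun s => ((dx (c s).2).1 x : ℂ)) ((dx B).1 x : ℂ) t := by
      have := (Curv.hasDerivAt_dt (Curv.dx V) (t := t) ht x).ofReal_comp
      rwa [Curv.dt_dx_apply] at this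
    have k0 := (Per.hasDerivAt (c t).1 x).ofReal_comp
    have k1 := (Per.hasDerivAt (dx (c t).1) x).ofReal_comp
    have k2 := (Per.hasDerivAt (dx (c t).2) x).ofReal_comp
    have l00 : deriv (fun s => laxL z (c s) x 0 0) t = -z * ((dx A).1 x : ℂ) :=
      (hU.const_mul (-z)).deriv
    have l01 : deriv (fun s => laxL z (c s) x 0 1) t = -((dx B).1 x : ℂ) := hV.neg.deriv
    have l10 : deriv (fun s => laxL z (c s) x 1 0) t = 0 := deriv_const t (2 * z ^ 2)
    have l11 : deriv (fun s => laxL z (c s) x 1 1) t = z * ((dx A).1 x : ℂ) :=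
      (hU.const_mul z).deriv
    have p00 : deriv (fun y => laxP z (c t) y 0 0) x = _ :=
      (((k0.mul (k1.const_mul (-z))).neg).add_const 0).deriv
    have p01 : deriv (fun y => laxP z (c t) y 0 1) x =
        -(((dx (c t).1).1 x : ℂ) * -((dx (c t).2).1 x : ℂ) +
          ((c t).1.1 x : ℂ) * -((dx (dx (c t).2)).1 x : ℂ)) :=
      (((k0.mul k2.neg).neg).add_const 0).deriv
    have q10 : (fun y => laxP z (c t) y 1 0) =
        fun y => -(((c t).1.1 y : ℂ) * (2 * z ^ 2)) + -z := by
      funext y; simp [laxP, laxL, laxQ]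
    have p10 : deriv (fun y => laxP z (c t) y 1 0) x =
        -(((dx (c t).1).1 x : ℂ) * (2 * z ^ 2)) := by
      rw [q10]
      exact (((k0.mul_const (2 * z ^ 2)).neg).add_const (-z)).deriv
    have p11 : deriv (fun y => laxP z (c t) y 1 1) x = _ :=
      (((k0.mul (k1.const_mul z)).neg).add_const 0).deriv
    rw [d1, d2]
    simp only [Fin.forall_fin_two, l00, l01, l10, l11, p00, p01, p10, p11]
    simp only [laxL, laxP, laxQ, Matrix.sub_apply, Matrix.mul_apply, Fin.sum_univ_two,
      Matrix.add_apply, Matrix.neg_apply, Matrix.smul_apply, Matrix.of_apply, Matrix.cons_val',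
      Matrix.cons_val_zero, Matrix.cons_val_one, smul_eq_mul, Matrix.cons_val_fin_one]
    constructor
    · rintro ⟨⟨e1, e2⟩, -⟩
      constructor
      · rw [← Complex.ofReal_eq_zero]
        refine (mul_eq_zero.1 (?_ : -z * _ = 0)).resolve_left (neg_ne_zero.2 hz)
        rw [← e1]; push_cast; ring
      · rw [← Complex.ofReal_eq_zero, ← neg_eq_zero, ← e2]; push_cast; ring
    · rintro ⟨e1, e2⟩
      have e1' := congrArg (fun r : ℝ => (r : ℂ)) e1
      have e2' := congrArg (fun r : ℝ => (r : ℂ)) e2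
      push_cast at e1' e2'
      refine ⟨⟨?_, ?_⟩, ?_, ?_⟩
      · linear_combination (-z) * e1'
      · linear_combination -e2'
      · ring
      · linear_combination z * e1'
  constructor
  · intro h t ht x
    exact (key t ht x).1 (h t ht x)
  · intro h t ht x
    exact (key t ht x).2 (h t ht x)

end RiemannHydro
end

noncomputable section

/-! ### Linear ordinary differential equations -/

section LinearODE

variable {E : Type} [NormedAddCommGroup E] [NormedSpace ℝ E]

theorem eq_zero_of_norm_deriv_le_right {y y' : ℝ → E} {C : ℝ → ℝ} {a b : ℝ}
    (hC : ContinuousOn C (Set.Icc a b)) (hd : ∀ s ∈ Set.Icc a b, HasDerivAt y (y' s) s)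
    (hb : ∀ s ∈ Set.Icc a b, ‖y' s‖ ≤ C s * ‖y s‖) (ha : y a = 0) :
    ∀ s ∈ Set.Icc a b, y s = 0 := by
  obtain ⟨K, hK⟩ := isCompact_Icc.exists_bound_of_continuousOn hC
  refine eq_zero_of_abs_deriv_le_mul_abs_self_of_eq_zero_right (f' := y') (K := K)
    (fun s hs => (hd s hs).continuousAt.continuousWithinAt)
    (fun s hs => (hd s (Set.Ico_subset_Icc_self hs)).hasDerivWithinAt) ha fun s hs => ?_
  have hs' := Set.Ico_subset_Icc_self hs
  exact (hb s hs').trans (mul_le_mul_of_nonneg_right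
    ((le_abs_self _).trans (hK s hs')) (norm_nonneg _))

/-- A solution of a homogeneous linear differential inequality on an interval vanishes if it
vanishes at one point. -/
theorem eq_zero_of_norm_deriv_le {J : Set ℝ} (hJ : J.OrdConnected) {y y' : ℝ → E} {C : ℝ → ℝ}
    (hC : ContinuousOn C J) (hd : ∀ s ∈ J, HasDerivAt y (y' s) s)
    (hb : ∀ s ∈ J, ‖y' s‖ ≤ C s * ‖y s‖) {s₀ : ℝ} (hs₀ : s₀ ∈ J) (h0 : y s₀ = 0) {s : ℝ}
    (hs : s ∈ J) : y s = 0 := by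
  rcases le_total s₀ s with h | h
  · have hsub : Set.Icc s₀ s ⊆ J := hJ.out hs₀ hs
    exact eq_zero_of_norm_deriv_le_right (hC.mono hsub) (fun r hr => hd r (hsub hr))
      (fun r hr => hb r (hsub hr)) h0 s ⟨h, le_rfl⟩
  -- Times before s₀ are reduced to the forward case by reflecting time.
  · have hsub : ∀ r ∈ Set.Icc (-s₀) (-s), -r ∈ J := fun r hr =>
      hJ.out hs hs₀ ⟨by linarith [hr.2], by linarith [hr.1]⟩
    have := eq_zero_of_norm_deriv_le_right (y := fun r => y (-r)) (y' := fun r => -y' (-r))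
      (C := fun r => C (-r)) (a := -s₀) (b := -s)
      (hC.comp continuous_neg.continuousOn hsub)
      (fun r hr => by
        have := (hd (-r) (hsub r hr)).scomp r (hasDerivAt_neg r)
        exact this.congr_deriv (by simp))
      (fun r hr => by simpa using hb (-r) (hsub r hr)) (by simpa using h0) (-s)
      ⟨by linarith, le_rfl⟩
    simpa using this

/-- The terms of the Dyson series. -/
def dysonTerm (A : ℝ → E →L[ℝ] E) (x₀ : ℝ) (y₀ : E) : ℕ → ℝ → E
  | 0 => fun _ => y₀
  | n + 1 => fun x => ∫ s in x₀..x, A s (dysonTerm A x₀ y₀ n s)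

theorem continuous_dysonTerm {A : ℝ → E →L[ℝ] E} (hA : Continuous A) (x₀ : ℝ) (y₀ : E) (n : ℕ) :
    Continuous (dysonTerm A x₀ y₀ n) := by
  induction n with
  | zero => exact continuous_const
  | succ n ih =>
    exact intervalIntegral.continuous_primitive (μ := MeasureTheory.volume)
      (fun a b => (hA.clm_apply ih).intervalIntegrable a b) x₀

theorem hasDerivAt_dysonTerm_succ [CompleteSpace E]
    {A : ℝ → E →L[ℝ] E} (hA : Continuous A) (x₀ : ℝ) (y₀ : E) (n : ℕ)
    (x : ℝ) : HasDerivAt (dysonTerm A x₀ y₀ (n + 1)) (A x (dysonTerm A x₀ y₀ n x)) x := by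
  have hc := hA.clm_apply (continuous_dysonTerm hA x₀ y₀ n)
  exact intervalIntegral.integral_hasDerivAt_right (hc.intervalIntegrable _ _)
    (hc.stronglyMeasurableAtFilter _ _) hc.continuousAt

/-- Iterated integration yields the factorial, which makes the Dyson series converge on every
bounded interval and hence gives a global solution. -/
theorem norm_dysonTerm_le {A : ℝ → E →L[ℝ] E} (hA : Continuous A) {x₀ T C : ℝ} (hC0 : 0 ≤ C)
    (hC : ∀ x, |x - x₀| ≤ T → ‖A x‖ ≤ C) (y₀ : E) (n : ℕ) {x : ℝ} (hx : |x - x₀| ≤ T) :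
    ‖dysonTerm A x₀ y₀ n x‖ ≤ ‖y₀‖ * C ^ n / n.factorial * |x - x₀| ^ n := by
  induction n generalizing x with
  | zero => simp [dysonTerm]
  | succ n ih =>
    have hin : ∀ s ∈ Set.uIoc x₀ x, |s - x₀| ≤ T := fun s hs =>
      (Set.abs_sub_left_of_mem_uIcc (Set.uIoc_subset_uIcc hs)).trans hx
    have hc := hA.clm_apply (continuous_dysonTerm hA x₀ y₀ n)
    calc ‖dysonTerm A x₀ y₀ (n + 1) x‖
        ≤ ∫ s in Set.uIoc x₀ x, ‖A s (dysonTerm A x₀ y₀ n s)‖ :=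
          intervalIntegral.norm_integral_le_integral_norm_uIoc
      _ ≤ ∫ s in Set.uIoc x₀ x, (C * (‖y₀‖ * C ^ n / n.factorial)) * |s - x₀| ^ n := by
          refine MeasureTheory.setIntegral_mono_on ?_ ?_ measurableSet_uIoc fun s hs => ?_
          · exact (intervalIntegrable_iff.1 (hc.norm.intervalIntegrable _ _))
          · refine intervalIntegrable_iff.1 (Continuous.intervalIntegrable ?_ _ _)
            fun_prop
          · refine ((A s).le_opNorm _).trans ?_
            rw [mul_assoc]
            exact mul_le_mul (hC s (hin s hs)) (ih (hin s hs)) (norm_nonneg _) hC0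
      _ = ‖y₀‖ * C ^ (n + 1) / (n + 1).factorial * |x - x₀| ^ (n + 1) := by
          rw [MeasureTheory.integral_const_mul, integral_pow_abs_sub_uIoc, Nat.factorial_succ]
          push_cast
          field_simp
          ring

/-- Global existence for linear differential equations. -/
theorem exists_linear_ode_solution [CompleteSpace E]
    {A : ℝ → E →L[ℝ] E} (hA : Continuous A) (x₀ : ℝ) (y₀ : E) :
    ∃ y : ℝ → E, y x₀ = y₀ ∧ ∀ x, HasDerivAt y (A x (y x)) x := by
  have hbound : ∀ T : ℝ, ∃ K : ℕ → ℝ, Summable K ∧ ∃ C, 0 ≤ C ∧ ∀ x, |x - x₀| ≤ T → ‖A x‖ ≤ C ∧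
      ∀ n, ‖dysonTerm A x₀ y₀ n x‖ ≤ K n := by
    intro T
    obtain ⟨C, hC⟩ := (isCompact_closedBall x₀ T).exists_bound_of_continuousOn hA.continuousOn
    have hC' : ∀ x, |x - x₀| ≤ T → ‖A x‖ ≤ max C 0 := fun x hx =>
      (hC x (by simpa [Real.dist_eq] using hx)).trans (le_max_left _ _)
    refine ⟨fun n => ‖y₀‖ * ((max C 0 * |T|) ^ n / n.factorial),
      (Real.summable_pow_div_factorial _).mul_left _, max C 0, le_max_right _ _,
      fun x hx => ⟨hC' x hx, fun n => ?_⟩⟩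
    refine (norm_dysonTerm_le hA (le_max_right _ _) hC' y₀ n hx).trans ?_
    have h1 : |x - x₀| ^ n ≤ |T| ^ n :=
      pow_le_pow_left₀ (abs_nonneg _) (hx.trans (le_abs_self T)) n
    calc ‖y₀‖ * max C 0 ^ n / n.factorial * |x - x₀| ^ n
        ≤ ‖y₀‖ * max C 0 ^ n / n.factorial * |T| ^ n :=
          mul_le_mul_of_nonneg_left h1 (by positivity)
      _ = ‖y₀‖ * ((max C 0 * |T|) ^ n / n.factorial) := by rw [mul_pow]; ring
  have hsum : ∀ x, Summable fun n => dysonTerm A x₀ y₀ n x := fun x => by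
    obtain ⟨K, hK, C, -, h⟩ := hbound |x - x₀|
    exact Summable.of_norm_bounded hK (h x le_rfl).2
  have hzero : ∀ n, dysonTerm A x₀ y₀ (n + 1) x₀ = 0 := fun n =>
    intervalIntegral.integral_same
  refine ⟨fun x => y₀ + ∑' n, dysonTerm A x₀ y₀ (n + 1) x, by simp [hzero], fun x => ?_⟩
  have hy : y₀ + ∑' n, dysonTerm A x₀ y₀ (n + 1) x = ∑' n, dysonTerm A x₀ y₀ n x :=
    ((hsum x).tsum_eq_zero_add).symm
  simp only [hy]
  rw [(A x).map_tsum (hsum x)]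
  -- The extra 1 puts x inside an open ball on which the differentiated series is dominated.
  obtain ⟨K, hK, C, hC0, h⟩ := hbound (|x - x₀| + 1)
  have hball : ∀ z ∈ Metric.ball x₀ (|x - x₀| + 1), |z - x₀| ≤ |x - x₀| + 1 := fun z hz =>
    (Real.dist_eq z x₀ ▸ Metric.mem_ball.1 hz).le
  refine HasDerivAt.const_add _ (hasDerivAt_tsum_of_isPreconnected
    (u := fun n => C * K n) (g := fun n => dysonTerm A x₀ y₀ (n + 1))
    (g' := fun n z => A z (dysonTerm A x₀ y₀ n z)) (t := Metric.ball x₀ (|x - x₀| + 1)) (y₀ := x₀)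
    (hK.mul_left C) Metric.isOpen_ball
    (convex_ball x₀ _).isPreconnected (fun n z _ => hasDerivAt_dysonTerm_succ hA x₀ y₀ n z)
    (fun n z hz => ?_) (Metric.mem_ball_self (by positivity)) ?_ ?_)
  · refine ((A z).le_opNorm _).trans ?_
    exact mul_le_mul (h z (hball z hz)).1 ((h z (hball z hz)).2 n) (norm_nonneg _) hC0
  · simp only [hzero]; exact summable_zero
  · rw [Metric.mem_ball, Real.dist_eq]; linarith

theorem contDiff_of_linear_ode {A : ℝ → E →L[ℝ] E} (hA : ContDiff ℝ ∞ A) {y : ℝ → E}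
    (hy : ∀ x, HasDerivAt y (A x (y x)) x) : ContDiff ℝ ∞ y := by
  have h : ∀ n : ℕ, ContDiff ℝ n y := by
    intro n
    induction n with
    | zero =>
      rw [Nat.cast_zero, contDiff_zero]
      exact continuous_iff_continuousAt.2 fun x => (hy x).continuousAt
    | succ n ih =>
      rw [Nat.cast_add, Nat.cast_one, contDiff_succ_iff_deriv]
      refine ⟨fun x => (hy x).differentiableAt, by simp, ?_⟩
      rw [funext fun x => (hy x).deriv]
      exact (contDiff_infty.1 hA n).clm_apply ih
  exact contDiff_infty.2 h

end LinearODE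

namespace RiemannHydro

open TopologicalSpace

variable {O : Opens ℝ}

/-! ### Characteristics -/

namespace Curv

theorem hasDerivAt_along (f : Curv O) {y : ℝ → ℝ} {y' s : ℝ} (hs : s ∈ O) (hy : HasDerivAt y y' s) :
    HasDerivAt (fun s => (f.1 s).1 (y s))
      (((dt f).1 s).1 (y s) + y' * (dx f |>.1 s).1 (y s)) s := by
  have h := (hasFDerivAt f hs (y s)).comp_hasDerivAt s ((hasDerivAt_id s).prodMk hy)
  refine h.congr_deriv ?_
  have h1 : ((dt f).1 s).1 (y s) = _ := (hasDerivAt_dt f hs (y s)).unique (hasDerivAt_fst f hs (y s))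
  have h2 : ((dx f).1 s).1 (y s) = _ :=
    (Per.hasDerivAt (f.1 s) (y s)).unique (hasDerivAt_snd f hs (y s))
  rw [h1, h2, ← smul_eq_mul, ← map_smul, ← map_add]
  simp

theorem continuousOn_along (f : Curv O) {y : ℝ → ℝ} (hy : Continuous y) :
    ContinuousOn (fun s => (f.1 s).1 (y s)) O :=
  ContDiffOn.continuousOn (f := fun q : ℝ × ℝ => (f.1 q.1).1 q.2) f.2 |>.comp
    (f := fun s => (s, y s)) (by fun_prop) fun s hs => ⟨hs, trivial⟩

end Curv

theorem IsSolutionOn.dt_eq {c : ℝ → Phase} (h : IsSolutionOn riemannField O c) {t : ℝ}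
    (ht : t ∈ O) (x : ℝ) :
    ((Curv.dt (Curv.fst h.1)).1 t).1 x = (c t).2.1 x - (c t).1.1 x * (dx (c t).1).1 x ∧
      ((Curv.dt (Curv.snd h.1)).1 t).1 x = -((c t).1.1 x * (dx (c t).2).1 x) := by
  have h1 := h.2 t ht x
  rw [Curv.velocity_eq h.1 ht] at h1
  exact ⟨congrArg Prod.fst h1, congrArg Prod.snd h1⟩

/-- Along the characteristics, which are parabolas, `v` is constant and `u` is affine. -/
theorem IsSolutionOn.eq_along {c : ℝ → Phase} (h : IsSolutionOn riemannField O c)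
    (hO : (O : Set ℝ).OrdConnected) {t t₀ : ℝ} (ht : t ∈ O) (ht₀ : t₀ ∈ O) (x : ℝ) :
    (c t₀).1.1 (x + (c t).1.1 x * (t₀ - t) + (c t).2.1 x * (t₀ - t) ^ 2 / 2) =
        (c t).1.1 x + (c t).2.1 x * (t₀ - t) ∧
      (c t₀).2.1 (x + (c t).1.1 x * (t₀ - t) + (c t).2.1 x * (t₀ - t) ^ 2 / 2) =
        (c t).2.1 x := by
  set u := Curv.fst h.1
  set v := Curv.snd h.1
  set a := (c t).1.1 x
  set b := (c t).2.1 x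
  set y : ℝ → ℝ := fun s => x + a * (s - t) + b * (s - t) ^ 2 / 2 with hy
  have hyd : ∀ s, HasDerivAt y (a + b * (s - t)) s := by
    intro s
    have h1 : HasDerivAt (fun s => s - t) 1 s := (hasDerivAt_id s).sub_const t
    refine (((h1.const_mul a).const_add x).add (((h1.pow 2).const_mul b).div_const 2)).congr_deriv ?_
    simp
    ring
  have hyc : Continuous y := by fun_prop
  -- Along the explicit parabola the errors α = u - (a + b(s - t)) and β = v - b satisfy α' = β -
  -- u_x α and β' = -v_x α. This linear system starts from zero at s = t, so no existence theorem
  -- for characteristics is needed.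
  have key := eq_zero_of_norm_deriv_le (E := ℝ × ℝ) hO
    (y := fun s => ((u.1 s).1 (y s) - (a + b * (s - t)), (v.1 s).1 (y s) - b))
    (y' := fun s => (((v.1 s).1 (y s) - b) - ((Curv.dx u).1 s).1 (y s) *
      ((u.1 s).1 (y s) - (a + b * (s - t))),
      -(((Curv.dx v).1 s).1 (y s) * ((u.1 s).1 (y s) - (a + b * (s - t))))))
    (C := fun s => 1 + |((Curv.dx u).1 s).1 (y s)| + |((Curv.dx v).1 s).1 (y s)|)
    ((continuousOn_const.add (Curv.continuousOn_along (Curv.dx u) hyc).abs).add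
      (Curv.continuousOn_along (Curv.dx v) hyc).abs)
    (fun s hs => ?_) (fun s _ => ?_) ht ?_ ht₀
  · exact ⟨sub_eq_zero.1 (congrArg Prod.fst key), sub_eq_zero.1 (congrArg Prod.snd key)⟩
  · obtain ⟨e1, e2⟩ := h.dt_eq hs (y s)
    have h1 : HasDerivAt (fun s => a + b * (s - t)) b s :=
      ((((hasDerivAt_id s).sub_const t).const_mul b).const_add a).congr_deriv (mul_one b)
    refine HasDerivAt.prodMk ?_ ?_
    · refine ((Curv.hasDerivAt_along u hs (hyd s)).sub h1).congr_deriv ?_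
      rw [e1]
      change _ = (c s).2.1 (y s) - b - (dx (c s).1).1 (y s) * ((c s).1.1 (y s) - _)
      change _ - _ * (dx (c s).1).1 (y s) + _ * (dx (c s).1).1 (y s) - _ = _
      ring
    · refine ((Curv.hasDerivAt_along v hs (hyd s)).sub_const b).congr_deriv ?_
      rw [e2]
      change -(_ * (dx (c s).2).1 (y s)) + _ * (dx (c s).2).1 (y s) =
        -((dx (c s).2).1 (y s) * ((c s).1.1 (y s) - _))
      ring
  · set α := (u.1 s).1 (y s) - (a + b * (s - t))
    set β := (v.1 s).1 (y s) - b
    set U := ((Curv.dx u).1 s).1 (y s)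
    set V := ((Curv.dx v).1 s).1 (y s)
    set N := ‖((α, β) : ℝ × ℝ)‖
    have hα : |α| ≤ N := le_max_left _ _
    have hβ : |β| ≤ N := le_max_right _ _
    have hN : 0 ≤ N := norm_nonneg _
    refine max_le ?_ ?_
    · refine (norm_sub_le _ _).trans ?_
      rw [norm_mul]
      have h1 := mul_le_mul_of_nonneg_left hα (abs_nonneg U)
      have h2 := mul_nonneg (abs_nonneg V) hN
      simp only [Real.norm_eq_abs]
      linarith
    · rw [norm_neg, norm_mul]
      have h1 := mul_le_mul_of_nonneg_left hα (abs_nonneg V)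
      have h2 := mul_nonneg (abs_nonneg U) hN
      simp only [Real.norm_eq_abs]
      linarith
  · simp only [hy, sub_self, mul_zero, add_zero]
    refine Prod.ext ?_ ?_
    · simp [u, a, Curv.fst_apply]
    · simp [v, b, Curv.snd_apply]

/-! ### The Lax system -/

/-- The action of a complex matrix on `ℂ²`. -/
def matCLM : Matrix (Fin 2) (Fin 2) ℂ →ₗ[ℝ] (Fin 2 → ℂ) →L[ℝ] (Fin 2 → ℂ) where
  toFun M := LinearMap.toContinuousLinearMap ((Matrix.mulVecLin M).restrictScalars ℝ)
  map_add' M N := by ext1 y; exact Matrix.add_mulVec M N y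
  map_smul' r M := by ext1 y; exact Matrix.smul_mulVec r M y

theorem matCLM_apply (M : Matrix (Fin 2) (Fin 2) ℂ) (y : Fin 2 → ℂ) :
    matCLM M y = M.mulVec y := rfl

theorem laxL_eq (z : ℂ) (p : Phase) (x : ℝ) :
    laxL z p x = (dx p.1).1 x • !![-z, 0; 0, z] + (dx p.2).1 x • !![0, -1; 0, 0] +
      !![0, 0; 2 * z ^ 2, 0] := by
  ext i j
  fin_cases i <;> fin_cases j <;> simp [laxL, mul_comm]

theorem matCLM_laxL (z : ℂ) (p : Phase) (x : ℝ) :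
    matCLM (laxL z p x) = (dx p.1).1 x • matCLM !![-z, 0; 0, z] +
      (dx p.2).1 x • matCLM !![0, -1; 0, 0] + matCLM !![0, 0; 2 * z ^ 2, 0] := by
  rw [laxL_eq, map_add, map_add, map_smul, map_smul]

theorem matCLM_laxP (z : ℂ) (p : Phase) (x : ℝ) :
    matCLM (laxP z p x) = -(p.1.1 x • matCLM (laxL z p x)) + matCLM (laxQ z) := by
  rw [laxP, map_add, map_neg, ← map_smul]
  rfl

theorem contDiff_matCLM_laxL (z : ℂ) (p : Phase) :
    ContDiff ℝ ∞ (fun x => matCLM (laxL z p x)) := by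
  rw [funext (matCLM_laxL z p)]
  exact (((dx p.1).2.1.smul contDiff_const).add ((dx p.2).2.1.smul contDiff_const)).add
    contDiff_const

theorem IsLaxSolution.hasDerivAt_snd {z : ℂ} {c : ℝ → Phase} {f : ℝ × ℝ → Fin 2 → ℂ}
    (h : IsLaxSolution z O c f) {t : ℝ} (ht : t ∈ O) (x : ℝ) :
    HasDerivAt (fun y => f (t, y)) (matCLM (laxL z (c t) x) (f (t, x))) x := by
  have h1 : DifferentiableAt ℝ f (t, x) :=
    (h.1.contDiffAt ((isOpen_strip O).mem_nhds ⟨ht, trivial⟩)).differentiableAt (by simp)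
  have h2 : DifferentiableAt ℝ (fun y => f (t, y)) x :=
    h1.comp x ((hasFDerivAt_prodMk_right (𝕜 := ℝ) t x).differentiableAt)
  rw [matCLM_apply, ← (h.2 t ht x).1]
  exact h2.hasDerivAt

theorem IsLaxSolution.hasDerivAt_fst {z : ℂ} {c : ℝ → Phase} {f : ℝ × ℝ → Fin 2 → ℂ}
    (h : IsLaxSolution z O c f) {t : ℝ} (ht : t ∈ O) (x : ℝ) :
    HasDerivAt (fun s => f (s, x)) (matCLM (laxP z (c t) x) (f (t, x))) t := by
  have h1 : DifferentiableAt ℝ f (t, x) :=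
    (h.1.contDiffAt ((isOpen_strip O).mem_nhds ⟨ht, trivial⟩)).differentiableAt (by simp)
  have h2 : DifferentiableAt ℝ (fun s => f (s, x)) t :=
    h1.comp (f := fun s => (s, x)) t ((hasFDerivAt_prodMk_left (𝕜 := ℝ) t x).differentiableAt)
  rw [matCLM_apply, ← (h.2 t ht x).2]
  exact h2.hasDerivAt

/-- A common solution of the Lax system is determined by one value. -/
theorem IsLaxSolution.eqOn {z : ℂ} {c : ℝ → Phase} (hc : SmoothCurveOn O c)
    (hO : (O : Set ℝ).OrdConnected) {f g : ℝ × ℝ → Fin 2 → ℂ} (hf : IsLaxSolution z O c f)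
    (hg : IsLaxSolution z O c g) {t₀ x₀ : ℝ} (ht₀ : t₀ ∈ O) (h0 : f (t₀, x₀) = g (t₀, x₀)) :
    Set.EqOn f g ((O : Set ℝ) ×ˢ Set.univ) := by
  set u := Curv.fst hc
  set v := Curv.snd hc
  have hcontL : ContinuousOn (fun t => matCLM (laxL z (c t) x₀)) O := by
    have h1 : ContinuousOn (fun t => ((Curv.dx u).1 t).1 x₀) O :=
      Curv.continuousOn_along (Curv.dx u) continuous_const
    have h2 : ContinuousOn (fun t => ((Curv.dx v).1 t).1 x₀) O :=
      Curv.continuousOn_along (Curv.dx v) continuous_const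
    refine (((h1.smul continuousOn_const).add (h2.smul continuousOn_const)).add
      continuousOn_const).congr fun t _ => matCLM_laxL z (c t) x₀
  have hcontP : ContinuousOn (fun t => ‖matCLM (laxP z (c t) x₀)‖) O := by
    have h1 : ContinuousOn (fun t => (u.1 t).1 x₀) O :=
      Curv.continuousOn_along u continuous_const
    exact ((h1.smul hcontL).neg.add continuousOn_const |>.congr
      fun t _ => matCLM_laxP z (c t) x₀).norm
  -- Uniqueness first in t on the line x = x₀, then in x at each fixed time.
  have hline : ∀ t ∈ O, f (t, x₀) - g (t, x₀) = 0 := fun t ht =>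
    eq_zero_of_norm_deriv_le hO hcontP
      (y := fun t => f (t, x₀) - g (t, x₀))
      (y' := fun t => matCLM (laxP z (c t) x₀) (f (t, x₀) - g (t, x₀)))
      (fun s hs => ((hf.hasDerivAt_fst hs x₀).sub (hg.hasDerivAt_fst hs x₀)).congr_deriv
        (map_sub _ _ _).symm)
      (fun s _ => ContinuousLinearMap.le_opNorm _ _) ht₀ (sub_eq_zero.2 h0) ht
  rintro ⟨t, x⟩ ⟨ht, -⟩
  have ht : t ∈ O := ht
  refine sub_eq_zero.1 (eq_zero_of_norm_deriv_le (J := Set.univ) Set.ordConnected_univ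
    (contDiff_matCLM_laxL z (c t)).continuous.norm.continuousOn
    (y := fun x => f (t, x) - g (t, x))
    (y' := fun x => matCLM (laxL z (c t) x) (f (t, x) - g (t, x)))
    (fun y _ => ((hf.hasDerivAt_snd ht y).sub (hg.hasDerivAt_snd ht y)).congr_deriv
        (map_sub _ _ _).symm)
    (fun s _ => ContinuousLinearMap.le_opNorm _ _) (Set.mem_univ x₀) (hline t ht)
    (Set.mem_univ x))

/-- Existence of common solutions of the Lax system, transported along the characteristics. -/
theorem exists_isLaxSolution {c : ℝ → Phase} (h : IsSolutionOn riemannField O c)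
    (hO : (O : Set ℝ).OrdConnected) (z : ℂ) {t₀ : ℝ} (ht₀ : t₀ ∈ O) (x₀ : ℝ) (f₀ : Fin 2 → ℂ) :
    ∃ f, IsLaxSolution z O c f ∧ f (t₀, x₀) = f₀ := by
  have hA := contDiff_matCLM_laxL z (c t₀)
  obtain ⟨F, hF0, hF⟩ := exists_linear_ode_solution hA.continuous x₀ f₀
  have hFs := contDiff_of_linear_ode hA hF
  set u := Curv.fst h.1
  set v := Curv.snd h.1
  -- ξ(t, x) is the position at time t₀ of the characteristic through (t, x); it satisfies ξ_t = -u
  -- ξ_x.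
  set ξ : ℝ → ℝ → ℝ := fun t x => x + (c t).1.1 x * (t₀ - t) + (c t).2.1 x * (t₀ - t) ^ 2 / 2
    with hξ
  have hξs : ContDiffOn ℝ ∞ (fun q : ℝ × ℝ => ξ q.1 q.2) ((O : Set ℝ) ×ˢ Set.univ) := by
    have h1 : ContDiffOn ℝ ∞ (fun q : ℝ × ℝ => (c q.1).1.1 q.2) ((O : Set ℝ) ×ˢ Set.univ) := u.2
    have h2 : ContDiffOn ℝ ∞ (fun q : ℝ × ℝ => (c q.1).2.1 q.2) ((O : Set ℝ) ×ˢ Set.univ) := v.2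
    fun_prop
  refine ⟨fun q => F (ξ q.1 q.2) + (q.1 - t₀) • matCLM (laxQ z) (F (ξ q.1 q.2)), ⟨?_, ?_⟩, ?_⟩
  · have h1 := hFs.comp_contDiffOn hξs
    exact h1.add ((contDiffOn_fst.sub contDiffOn_const).smul
      ((matCLM (laxQ z)).contDiff.comp_contDiffOn h1))
  · intro t ht x
    have ht : t ∈ O := ht
    obtain ⟨e1, e2⟩ := h.dt_eq ht x
    set d : ℝ := 1 + (dx (c t).1).1 x * (t₀ - t) + (dx (c t).2).1 x * (t₀ - t) ^ 2 / 2 with hd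
    have hξx : HasDerivAt (fun y => ξ t y) d x :=
      ((hasDerivAt_id x).add ((Per.hasDerivAt (c t).1 x).mul_const (t₀ - t))).add
        (((Per.hasDerivAt (c t).2 x).mul_const ((t₀ - t) ^ 2)).div_const 2)
    have hξt : HasDerivAt (fun s => ξ s x) (-((c t).1.1 x * d)) t := by
      have h1 : HasDerivAt (fun s => t₀ - s) (-1) t := (hasDerivAt_id t).const_sub t₀
      have hu : HasDerivAt (fun s => (c s).1.1 x) _ t := Curv.hasDerivAt_dt u ht x
      have hv : HasDerivAt (fun s => (c s).2.1 x) _ t := Curv.hasDerivAt_dt v ht x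
      refine (((hasDerivAt_const t x).add (hu.mul h1)).add
        ((hv.mul (h1.pow 2)).div_const 2)).congr_deriv ?_
      rw [e1, e2, hd]
      simp
      ring
    -- Differentiating the conservation laws along characteristics in x expresses ℓ at (t₀, ξ),
    -- multiplied by ξ_x = d, through the data at (t, x).
    have hu0 : (dx (c t₀).1).1 (ξ t x) * d = (dx (c t).1).1 x + (dx (c t).2).1 x * (t₀ - t) := by
      have h1 := (Per.hasDerivAt (c t₀).1 (ξ t x)).comp x hξx
      have h2 := (Per.hasDerivAt (c t).1 x).add ((Per.hasDerivAt (c t).2 x).mul_const (t₀ - t))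
      refine h1.unique (h2.congr_of_eventuallyEq (Filter.Eventually.of_forall fun y => ?_))
      exact (h.eq_along hO ht ht₀ y).1
    have hv0 : (dx (c t₀).2).1 (ξ t x) * d = (dx (c t).2).1 x := by
      have h1 := (Per.hasDerivAt (c t₀).2 (ξ t x)).comp x hξx
      refine h1.unique ((Per.hasDerivAt (c t).2 x).congr_of_eventuallyEq
        (Filter.Eventually.of_forall fun y => ?_))
      exact (h.eq_along hO ht ht₀ y).2
    have hFx := (hF (ξ t x)).scomp x hξx
    have hFt := (hF (ξ t x)).scomp t hξt
    set G := F (ξ t x)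
    -- The intertwining relation d (1 + (t - t₀) q) ℓ(t₀, ξ) = ℓ(t, x) (1 + (t - t₀) q), which is
    -- the x-equation for the transported solution.
    have hGx : d • matCLM (laxL z (c t₀) (ξ t x)) G +
        (t - t₀) • matCLM (laxQ z) (d • matCLM (laxL z (c t₀) (ξ t x)) G) =
        (laxL z (c t) x).mulVec (G + (t - t₀) • matCLM (laxQ z) G) := by
      have hu1 := congrArg (fun r : ℝ => (r : ℂ)) hu0
      have hv1 := congrArg (fun r : ℝ => (r : ℂ)) hv0
      have hd1 := congrArg (fun r : ℝ => (r : ℂ)) hd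
      push_cast at hu1 hv1 hd1
      ext i
      fin_cases i
      · simp [matCLM_apply, laxL, laxQ, Matrix.mulVec, dotProduct, Fin.sum_univ_two]
        linear_combination (-z * G 0) * hu1 - G 1 * hv1
      · simp [matCLM_apply, laxL, laxQ, Matrix.mulVec, dotProduct, Fin.sum_univ_two]
        linear_combination (z * G 1 + (t - t₀) * z ^ 2 * G 0) * hu1 +
          ((t - t₀) * z * G 1) * hv1 + 2 * z ^ 2 * G 0 * hd1
    refine ⟨?_, ?_⟩
    · refine Eq.trans (HasDerivAt.deriv ?_) hGx
      exact hFx.add (((matCLM (laxQ z)).hasFDerivAt.comp_hasDerivAt x hFx).const_smul (t - t₀))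
    -- Since q² = 0, the factor 1 + (t - t₀) q is the exponential; together with ξ_t = -u ξ_x this
    -- gives f_t + u f_x = q f.
    · have hq : matCLM (laxQ z) (matCLM (laxQ z) G) = 0 := by
        ext i
        fin_cases i <;> simp [matCLM_apply, laxQ, Matrix.mulVec, dotProduct, Fin.sum_univ_two]
      have hderiv := hFt.add (((hasDerivAt_id t).sub_const t₀).smul
        ((matCLM (laxQ z)).hasFDerivAt.comp_hasDerivAt t hFt))
      have hq' : matCLM (laxQ z) (G + (t - t₀) • matCLM (laxQ z) G) = matCLM (laxQ z) G := by
        rw [map_add, map_smul, hq, smul_zero, add_zero]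
      have hQ : (matCLM (laxQ z) ∘ F ∘ fun s => ξ s x) t = matCLM (laxQ z) G := rfl
      refine Eq.trans hderiv.deriv ?_
      rw [← matCLM_apply, matCLM_laxP, add_apply, neg_apply, smul_apply,
        matCLM_apply (laxL z (c t) x), ← hGx]
      refine Eq.trans ?_ (congrArg (_ + ·) hq'.symm)
      rw [hQ]
      simp only [map_smul, id, one_smul]
      module
  · have h1 : ξ t₀ x₀ = x₀ := by simp [hξ]
    simp only [h1, sub_self, zero_smul, add_zero, hF0]

theorem laxCompatible_of_isSolutionOn {J : Set ℝ} {c : ℝ → Phase} (hJ : IsOpen J)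
    (hJ' : J.OrdConnected) (h : IsSolutionOn riemannField J c) (z : ℂ) : LaxCompatible z J c := by
  intro t₀ ht₀ x₀ f₀
  obtain ⟨f, hf, hf0⟩ := exists_isLaxSolution (O := ⟨J, hJ⟩) h hJ' z ht₀ x₀ f₀
  exact ⟨f, ⟨hf, hf0⟩, fun g hg hg0 => IsLaxSolution.eqOn (O := ⟨J, hJ⟩) h.1 hJ' hg hf ht₀
    (hg0.trans hf0.symm)⟩

end RiemannHydro
end

theorem proposition3 :
    -- the equation `D_t² u = 0` is equivalent to the flow of `K[u, v] = (v - u u_x, -u v_x)`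
    (∀ (J : Set ℝ) (u : ℝ → Per), IsOpen J → SmoothCurveOn J (fun t => (u t, 0)) →
      ((∀ t ∈ J, ∀ x : ℝ,
          materialDeriv (fun s y => (u s).1 y)
            (materialDeriv (fun s y => (u s).1 y) (fun s y => (u s).1 y)) t x = 0) ↔
        ∃ v : ℝ → Per, IsSolutionOn riemannField J (fun t => (u t, v t)))) ∧
    -- this flow is bi-Hamiltonian and completely integrable on the nonsingular phase space
    IsBiHamiltonianOn nonsingular thetaOp etaOp hamTheta hamEta riemannField ∧
    IsCompletelyIntegrableOn nonsingular thetaOp etaOp riemannField ∧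
    -- and has the Lax representation `f_x = ℓ f`, `f_t = (-u ℓ + q) f`
    (∀ (J : Set ℝ) (c : ℝ → Phase), IsOpen J → J.OrdConnected → SmoothCurveOn J c →
      (IsSolutionOn riemannField J c → ∀ z : ℂ, LaxCompatible z J c) ∧
      (∀ z : ℂ, z ≠ 0 →
        (ZeroCurvature z J c ↔
          ∀ t ∈ J, ∀ x : ℝ,
            deriv (fun y => (velocity c t y - toFun (riemannField (c t)) y).1) x = 0 ∧
            deriv (fun y => (velocity c t y - toFun (riemannField (c t)) y).2) x = 0))) := by
  refine ⟨fun J u hJ hu => materialDeriv_sq_eq_zero_iff hJ hu, isBiHamiltonianOn_riemannField,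
    isCompletelyIntegrableOn_riemannField, fun J c hJ hJ' hc => ⟨fun h z =>
      laxCompatible_of_isSolutionOn hJ hJ' h z, fun z hz => zeroCurvature_iff hz hJ hc⟩⟩
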